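/- Let $n\ge 3$ and $d\ge 1$ be integers. Let $\mathcal F_2(d+1,n)$ be the set of two-dimensional holomorphic foliations of degree $d+1$ on $\mathbb P^n$ (over $\mathbb C$), i.e. of classes $[\Omega]$, up to multiplication by nonzero scalars, of nonzero integrable $(n-2)$-forms $\Omega$ on $\mathbb C^{n+1}$ whose coefficients are homogeneous polynomials of degree $d+2$, with $i_R\Omega=0$ for the radial vector field $R$ and with $\operatorname{codim}\operatorname{Sing}(\Omega)\ge 2$, where $\operatorname{Sing}(\Omega)$ is the zero set of $\Omega$. It is a subset of a projective space and carries the Zariski topology. For a tuple $\mathfrak P=(p_1,\dots,p_n)$ of positive integers and $\lambda\in\mathbb Z$ put $S=\sum_{j=1}^n p_jx_j\,\partial/\partial x_j$, and let $\mathcal F(\mathfrak P,\lambda,d+1)\subset\mathcal F_2(d+1,n)$ be the set of foliations $[\Omega]$ such that in some affine chart $(x_1,\dots,x_n)$ of $\mathbb P^n$ (a chart $T\circ\alpha_0$ with $\alpha_0(x_1,\dots,x_n)=(x_1:\cdots:x_n:1)$ and $T\in\operatorname{Aut}(\mathbb P^n)$) the form $\Omega$ restricts, up to a nonzero scalar,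 to $i_Si_X(dx_1\wedge\cdots\wedge dx_n)$ for some polynomial vector field $X$ with $[S,X]=\lambda X$. Let $\overline{\mathcal F(\mathfrak P,\lambda,d+1)}$ be its Zariski closure in $\mathcal F_2(d+1,n)$. **Proposition 2.9.** Let $p_1>\cdots>p_n$ and $l_1>\cdots>l_n$ be tuples of positive integers with $\gcd(p_1,\dots,p_n)=\gcd(l_1,\dots,l_n)=1$, let $\mathfrak P=(p_1,\dots,p_n)$, $\mathfrak L=(l_1,\dots,l_n)$ and $\lambda,\mu\in\mathbb Z$, and assume that $\mathcal F(\mathfrak P,\lambda,d+1)$ and $\mathcal F(\mathfrak L,\mu,d+1)$ are not both empty. Then $$\overline{\mathcal F(\mathfrak P,\lambda,d+1)}=\overline{\mathcal F(\mathfrak L,\mu,d+1)}$$ if and only if either $\mathfrak L=\mathfrak P$ and $\mu=\lambda$, or $\mathfrak L=\overline{\mathfrak P}$ and $\mu=\lambda_1$, where $\overline{\mathfrak P}=(\bar p_1,\dots,\bar p_n)$ with $\bar p_j=p_1-p_{n-j+2}$ for $j=1,\dots,n$ (with the convention $p_{n+1}=0$) and $\lambda_1=p_1(d-1)-\lambda$.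 -/

import Mathlib

open scoped LinearAlgebra.Projectivization

noncomputable section

namespace AffFoliation

/-- The polynomial ring `ℂ[x₁, …, x_N]`. -/
abbrev Poly (N : ℕ) : Type := MvPolynomial (Fin N) ℂ

/-- Polynomial vector fields on `ℂ^N`: the tuple `X` stands for `∑ Xⱼ ∂/∂xⱼ`. -/
abbrev VField (N : ℕ) : Type := Fin N → Poly N

/-- Differential `k`-forms on `ℂ^N` with polynomial coefficients, as alternating `k`-linear maps
on constant vectors with values in the polynomial ring. -/
abbrev Form (N k : ℕ) : Type := (Fin N → ℂ) [⋀^Fin k]→ₗ[ℂ] Poly N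

/-- The Lie bracket `[V, W]` of polynomial vector fields, `[V, W](f) = V(W(f)) - W(V(f))`. -/
def bracket {N : ℕ} (V W : VField N) : VField N := fun j =>
  ∑ i, (V i * MvPolynomial.pderiv i (W j) - W i * MvPolynomial.pderiv i (V j))

/-- The interior product `i_X ω`. -/
def contract {N k : ℕ} (X : VField N) (ω : Form N (k + 1)) : Form N k :=
  ∑ j, X j • ω.curryLeft (Pi.single j 1)

/-- The volume form `dx₁ ∧ ⋯ ∧ dx_N`. -/
def vol (N : ℕ) : Form N N :=
  (Algebra.linearMap ℂ (Poly N)).compAlternatingMap Matrix.detRowAlternating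

/-- The exterior derivative,
`dω (v₀, …, v_k) = ∑ (-1)^i ∂_{vᵢ} (ω (v₀, …, v̂ᵢ, …, v_k))`. -/
def extD {N k : ℕ} (ω : Form N k) : Form N (k + 1) :=
  AlternatingMap.alternatizeUncurryFin
    (∑ j, (LinearMap.proj j : (Fin N → ℂ) →ₗ[ℂ] ℂ).smulRight
      ((MvPolynomial.pderiv j : Derivation ℂ (Poly N) (Poly N)).toLinearMap.compAlternatingMap ω))

/-- The wedge product of a one-form `η` with a `k`-form `θ`,
`(η ∧ θ) (v₀, …, v_k) = ∑ (-1)^i η(vᵢ) θ (v₀, …, v̂ᵢ, …, v_k)`. -/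
def wedgeOne {N k : ℕ} (η : (Fin N → ℂ) →ₗ[ℂ] Poly N) (θ : Form N k) : Form N (k + 1) :=
  AlternatingMap.alternatizeUncurryFin
    { toFun := fun v => η v • θ
      map_add' := fun v w => by rw [map_add, add_smul]
      map_smul' := fun c v => by ext u; simp }

/-- Integrability of a `k`-form `ω` (`k ≥ 1`): `(i_v ω) ∧ ω = 0` (`ω` is decomposable where it does
not vanish) and `(i_v ω) ∧ dω = 0` (Frobenius), for all `(k-1)`-vectors `v`. It suffices to take
`v` decomposable and constant; `i_v ω` is then, up to sign, the one-form
`w ↦ ω (u₁, …, w, …, u_k)`, with `w` in the `j`-th slot. -/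
def Integrable {N k : ℕ} (ω : Form N k) : Prop :=
  ∀ (u : Fin k → Fin N → ℂ) (j : Fin k),
    wedgeOne (ω.toMultilinearMap.toLinearMap u j) ω = 0 ∧
    wedgeOne (ω.toMultilinearMap.toLinearMap u j) (extD ω) = 0

/-- `codim Sing(ω) ≥ 2`, where `Sing(ω)` is the zero set of `ω`: the codimension of this zero set
is the height of the ideal generated by the coefficients of `ω`. -/
def SingCodimGeTwo {N k : ℕ} (ω : Form N k) : Prop :=
  2 ≤ (Ideal.span (Set.range ω)).height

/-- The radial vector field `∑ xⱼ ∂/∂xⱼ`. -/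
def radial (N : ℕ) : VField N := fun j => MvPolynomial.X j

theorem contract_add {N k : ℕ} (X : VField N) (ω η : Form N (k + 1)) :
    contract X (ω + η) = contract X ω + contract X η := by
  simp [contract, Finset.sum_add_distrib, smul_add]

theorem contract_smul {N k : ℕ} (X : VField N) (c : ℂ) (ω : Form N (k + 1)) :
    contract X (c • ω) = c • contract X ω := by
  simp [contract, Finset.smul_sum, smul_comm c]

/-- The finite-dimensional space of `(m+1)`-forms on `ℂ^{n+1}`, `n = m + 3`, whose coefficients are
homogeneous polynomials of degree `e` and which are annihilated by the radial vector field. -/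
def projForms (m e : ℕ) : Submodule ℂ (Form (m + 4) (m + 1)) where
  carrier := {Ω | (∀ v, (Ω v).IsHomogeneous e) ∧ contract (radial (m + 4)) Ω = 0}
  add_mem' := fun {a b} ha hb =>
    ⟨fun v => (ha.1 v).add (hb.1 v), by rw [contract_add, ha.2, hb.2, add_zero]⟩
  zero_mem' := ⟨fun _ => MvPolynomial.isHomogeneous_zero _ _ _, by
    simpa using contract_smul (radial (m + 4)) 0 (0 : Form (m + 4) (m + 1))⟩
  smul_mem' := fun c a ha =>
    ⟨fun v => (MvPolynomial.homogeneousSubmodule (Fin (m + 4)) ℂ e).smul_mem c (ha.1 v),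
      by rw [contract_smul, ha.2, smul_zero]⟩

/-- `ℱ₂(D, n)`, `n = m + 3`: the two-dimensional holomorphic foliations of degree `D` on `ℙⁿ`, as
points `[Ω]` of the projective space of homogeneous `(n-2)`-forms of coefficient degree `D + 1` on
`ℂ^{n+1}` that are annihilated by the radial vector field; `Ω` is integrable and its singular set
has codimension at least two. -/
def Foliations (m D : ℕ) : Set (ℙ ℂ (projForms m (D + 1))) :=
  {F | Integrable (F.rep : Form (m + 4) (m + 1)) ∧
    SingCodimGeTwo (F.rep : Form (m + 4) (m + 1))}

/-- The pull-back `α^*Ω` of a form `Ω` on `ℂ^{N+1}` under the affine chart `α = T ∘ α₀` of `ℙ^N`,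
where `α₀ (x₁, …, x_N) = (x₁ : ⋯ : x_N : 1)` and `T` is the projective automorphism induced by the
matrix `A`. It is the pull-back under the affine map `x ↦ A (x, 1)`: substitute this map in the
coefficients and apply its linear part `v ↦ A (v, 0)` to the arguments. -/
def chartPullback {N k : ℕ} (A : Matrix (Fin (N + 1)) (Fin (N + 1)) ℂ) (Ω : Form (N + 1) k) :
    Form N k :=
  (MvPolynomial.aeval (fun i => (∑ j : Fin N, MvPolynomial.C (A i j.castSucc) * MvPolynomial.X j) +
      MvPolynomial.C (A i (Fin.last N))) : Poly (N + 1) →ₐ[ℂ] Poly N).toLinearMap.compAlternatingMap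
    (Ω.compLinearMap (A.submatrix id Fin.castSucc).mulVecLin)

/-- The diagonal vector field `S = ∑ pⱼ xⱼ ∂/∂xⱼ`. -/
def diagField {N : ℕ} (p : Fin N → ℤ) : VField N := fun j =>
  MvPolynomial.C (p j : ℂ) * MvPolynomial.X j

/-- `ℱ(𝔓, λ, D) ⊆ ℱ₂(D, n)`, `n = m + 3`: the foliations given in some affine chart by
`i_S i_X (dx₁ ∧ ⋯ ∧ dxₙ)`, where `X` is a polynomial vector field with `[S, X] = λ X`. -/
def AffFoliations (m : ℕ) (p : Fin (m + 3) → ℤ) (lam : ℤ) (D : ℕ) :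
    Set (ℙ ℂ (projForms m (D + 1))) :=
  {F | F ∈ Foliations m D ∧ ∃ (A : GL (Fin (m + 4)) ℂ) (X : VField (m + 3)),
    bracket (diagField p) X = (lam : ℂ) • X ∧
    chartPullback (A : Matrix (Fin (m + 4)) (Fin (m + 4)) ℂ) (F.rep : Form (m + 4) (m + 1)) =
      contract (diagField p) (contract X (vol (m + 3)))}

/-- The Zariski closure of a subset `Z` of the projective space `ℙ(V)` of a finite-dimensional
complex vector space `V`: the common zeros of all homogeneous polynomial functions on `V`
(homogeneous polynomials in linear functionals) that vanish on `Z`. -/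
def zariskiClosure {V : Type*} [AddCommGroup V] [Module ℂ V] (Z : Set (ℙ ℂ V)) : Set (ℙ ℂ V) :=
  {x | ∀ (k : ℕ) (f : MvPolynomial (Module.Dual ℂ V) ℂ), f.IsHomogeneous k →
    (∀ z ∈ Z, MvPolynomial.eval (fun φ => φ z.rep) f = 0) →
    MvPolynomial.eval (fun φ => φ x.rep) f = 0}

/-- The Zariski closure of `ℱ(𝔓, λ, D)` in `ℱ₂(D, n)`, `n = m + 3`. -/
def AffFoliationsClosure (m : ℕ) (p : Fin (m + 3) → ℤ) (lam : ℤ) (D : ℕ) :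
    Set (ℙ ℂ (projForms m (D + 1))) :=
  zariskiClosure (AffFoliations m p lam D) ∩ Foliations m D

/-- `p̄ⱼ = p₁ - p_{n-j+2}` for `j = 1, …, n`, with the convention `p_{n+1} = 0`. With indices from
`0`, the entry `p_{n-j+2}` of `(p₁, …, pₙ, 0)` is the one at the reversed position of `j`. -/
def conjTuple {m : ℕ} (p : Fin (m + 3) → ℤ) : Fin (m + 3) → ℤ := fun j =>
  p 0 - (Fin.snoc p 0 : Fin (m + 4) → ℤ) (Fin.rev j.castSucc)

/-- `λ₁ = p₁ (d - 1) - λ`. -/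
def conjWeight {m : ℕ} (p : Fin (m + 3) → ℤ) (lam : ℤ) (d : ℕ) : ℤ :=
  p 0 * ((d : ℤ) - 1) - lam

/-- `p₁ > ⋯ > pₙ` are relatively prime positive integers. -/
structure IsWeightTuple {m : ℕ} (p : Fin (m + 3) → ℤ) : Prop where
  strictAnti : StrictAnti p
  pos : ∀ i, 0 < p i
  gcd_eq_one : Finset.univ.gcd p = 1

end AffFoliation

end

namespace AffFoliation

open MvPolynomial

theorem alternating_sum_apply {ι κ M P : Type*} [AddCommMonoid M] [Module ℂ M] [AddCommMonoid P]
    [Module ℂ P] (s : Finset κ) (f : κ → M [⋀^ι]→ₗ[ℂ] P) (v : ι → M) :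
    (∑ i ∈ s, f i) v = ∑ i ∈ s, f i v := by
  classical
  induction s using Finset.induction_on with
  | empty => simp
  | insert a s ha ih => simp [Finset.sum_insert ha, ih]

/-- The value of a polynomial vector field at a point. -/
noncomputable def fieldAt {N : ℕ} (x : Fin N → ℂ) (X : VField N) : Fin N → ℂ :=
  fun j => MvPolynomial.eval x (X j)

/-- The value of a polynomial form at a point. -/
noncomputable def formAt {N k : ℕ} (x : Fin N → ℂ) (ω : Form N k) :
    (Fin N → ℂ) [⋀^Fin k]→ₗ[ℂ] ℂ :=
  (MvPolynomial.aeval x : Poly N →ₐ[ℂ] ℂ).toLinearMap.compAlternatingMap ω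

theorem formAt_apply {N k : ℕ} (x : Fin N → ℂ) (ω : Form N k) (v : Fin k → Fin N → ℂ) :
    formAt x ω v = MvPolynomial.eval x (ω v) := by
  simp [formAt, MvPolynomial.aeval_eq_eval]

theorem form_ext {N k : ℕ} {ω η : Form N k} (h : ∀ x v, formAt x ω v = formAt x η v) : ω = η := by
  ext1 v
  refine MvPolynomial.funext fun x => ?_
  rw [← formAt_apply, ← formAt_apply, h]

theorem formAt_smul {N k : ℕ} (x : Fin N → ℂ) (c : ℂ) (ω : Form N k) (v : Fin k → Fin N → ℂ) :
    formAt x (c • ω) v = c * formAt x ω v := by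
  simp [formAt_apply, MvPolynomial.smul_eval]

theorem formAt_sub {N k : ℕ} (x : Fin N → ℂ) (ω η : Form N k) (v : Fin k → Fin N → ℂ) :
    formAt x (ω - η) v = formAt x ω v - formAt x η v := by
  simp [formAt_apply]

theorem formAt_zero {N k : ℕ} (x : Fin N → ℂ) (v : Fin k → Fin N → ℂ) :
    formAt x (0 : Form N k) v = 0 := by
  simp [formAt_apply]

theorem contract_apply {N k : ℕ} (X : VField N) (ω : Form N (k + 1)) (v : Fin k → Fin N → ℂ) :
    contract X ω v = ∑ j, X j * ω (Matrix.vecCons (Pi.single j 1) v) := by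
  simp [contract, alternating_sum_apply]

theorem formAt_contract {N k : ℕ} (x : Fin N → ℂ) (X : VField N) (ω : Form N (k + 1))
    (v : Fin k → Fin N → ℂ) :
    formAt x (contract X ω) v = formAt x ω (Matrix.vecCons (fieldAt x X) v) := by
  have h : fieldAt x X = ∑ j, fieldAt x X j • (Pi.single j 1 : Fin N → ℂ) := by
    ext i; simp [Finset.sum_apply, Pi.single_apply]
  have h2 : ∀ w, formAt x ω (Matrix.vecCons w v) = (formAt x ω).curryLeft w v := fun w => rfl
  rw [h2, h, map_sum, alternating_sum_apply, formAt_apply, contract_apply, map_sum]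
  refine Finset.sum_congr rfl fun j _ => ?_
  rw [map_smul, AlternatingMap.smul_apply, ← h2, formAt_apply, map_mul]
  rfl

theorem contract_contract_self {N k : ℕ} (X : VField N) (ω : Form N (k + 2)) :
    contract X (contract X ω) = 0 := by
  refine form_ext fun x v => ?_
  rw [formAt_contract, formAt_contract, formAt_zero]
  exact AlternatingMap.map_eq_zero_of_eq _ _ (i := 0) (j := 1) (by simp) (by simp)

theorem formAt_swap {N k : ℕ} (x : Fin N → ℂ) (ω : Form N (k + 2)) (a b : Fin N → ℂ)
    (v : Fin k → Fin N → ℂ) :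
    formAt x ω (Matrix.vecCons a (Matrix.vecCons b v)) =
      -formAt x ω (Matrix.vecCons b (Matrix.vecCons a v)) := by
  rw [← AlternatingMap.map_swap _ _ (i := 0) (j := 1) (by simp)]
  congr 1
  ext i j
  refine Fin.cases ?_ (fun i => Fin.cases ?_ (fun i => ?_) i) i
  · simp
  · simp
  · have h1 : (i.succ.succ : Fin (k + 2)) ≠ 0 := Fin.succ_ne_zero _
    have h2 : (i.succ.succ : Fin (k + 2)) ≠ 1 := by
      rw [← Fin.succ_zero_eq_one]; exact fun h => Fin.succ_ne_zero _ (Fin.succ_injective _ h)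
    simp [Equiv.swap_apply_of_ne_of_ne h1 h2]

theorem contract_contract_comm {N k : ℕ} (X Y : VField N) (ω : Form N (k + 2)) :
    contract X (contract Y ω) = -contract Y (contract X ω) := by
  refine form_ext fun x v => ?_
  have : formAt x (-contract Y (contract X ω)) v = -formAt x (contract Y (contract X ω)) v := by
    simp [formAt_apply]
  rw [this]
  simp only [formAt_contract]
  rw [formAt_swap]

/-- The linear vector field `∑ (B x)ⱼ ∂/∂xⱼ` of a matrix `B`. -/
noncomputable def linField {N : ℕ} (B : Matrix (Fin N) (Fin N) ℂ) : VField N :=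
  fun j => ∑ k, C (B j k) * X k

theorem fieldAt_linField {N : ℕ} (x : Fin N → ℂ) (B : Matrix (Fin N) (Fin N) ℂ) :
    fieldAt x (linField B) = B.mulVec x := by
  ext j
  simp [fieldAt, linField, Matrix.mulVec, dotProduct]

theorem linField_one {N : ℕ} : linField (1 : Matrix (Fin N) (Fin N) ℂ) = radial N := by
  ext1 j
  simp [linField, radial, Matrix.one_apply]

theorem linField_diagonal {N : ℕ} (p : Fin N → ℤ) :
    linField (Matrix.diagonal fun i => (p i : ℂ)) = diagField p := by
  ext1 j
  simp only [linField, diagField, Matrix.diagonal_apply]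
  rw [Finset.sum_eq_single j] <;> simp +contextual [eq_comm]

theorem fieldAt_radial {N : ℕ} (x : Fin N → ℂ) : fieldAt x (radial N) = x := by
  rw [← linField_one, fieldAt_linField, Matrix.one_mulVec]

theorem fieldAt_diagField {N : ℕ} (x : Fin N → ℂ) (p : Fin N → ℤ) :
    fieldAt x (diagField p) = fun i => (p i : ℂ) * x i := by
  ext j; simp [fieldAt, diagField]

theorem linField_add {N : ℕ} (A B : Matrix (Fin N) (Fin N) ℂ) :
    linField (A + B) = linField A + linField B := by
  ext1 j
  simp [linField, add_mul, Finset.sum_add_distrib]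

theorem linField_smul {N : ℕ} (c : ℂ) (A : Matrix (Fin N) (Fin N) ℂ) :
    linField (c • A) = c • linField A := by
  ext1 j
  simp [linField, Finset.smul_sum, MvPolynomial.smul_eq_C_mul, mul_assoc]

theorem contract_field_add {N k : ℕ} (X Y : VField N) (ω : Form N (k + 1)) :
    contract (X + Y) ω = contract X ω + contract Y ω := by
  simp [contract, add_smul, Finset.sum_add_distrib]

theorem contract_field_smul {N k : ℕ} (c : ℂ) (X : VField N) (ω : Form N (k + 1)) :
    contract (c • X) ω = c • contract X ω := by
  simp only [contract, Finset.smul_sum, Pi.smul_apply]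
  refine Finset.sum_congr rfl fun j _ => ?_
  ext1 v
  simp

/-- The interior product with linear vector fields, as a bilinear map. -/
noncomputable def linContract (N k : ℕ) :
    Form N (k + 1) →ₗ[ℂ] Matrix (Fin N) (Fin N) ℂ →ₗ[ℂ] Form N k :=
  LinearMap.mk₂ ℂ (fun ω B => contract (linField B) ω)
    (fun ω η B => contract_add _ _ _) (fun c ω B => contract_smul _ _ _)
    (fun ω A B => by rw [linField_add, contract_field_add])
    (fun c ω A => by rw [linField_smul, contract_field_smul])

@[simp] theorem linContract_apply {N k : ℕ} (ω : Form N (k + 1)) (B : Matrix (Fin N) (Fin N) ℂ) :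
    linContract N k ω B = contract (linField B) ω := rfl

/-- The algebra of linear vector fields tangent to a form. -/
noncomputable def tangentFields {N k : ℕ} (ω : Form N (k + 1)) :
    Submodule ℂ (Matrix (Fin N) (Fin N) ℂ) :=
  LinearMap.ker (linContract N k ω)

theorem mem_tangentFields {N k : ℕ} {ω : Form N (k + 1)} {B : Matrix (Fin N) (Fin N) ℂ} :
    B ∈ tangentFields ω ↔ contract (linField B) ω = 0 := Iff.rfl

/-- The pull-back of a form under the affine map `y ↦ A y + b`. -/
noncomputable def affPull {M N k : ℕ} (A : Matrix (Fin M) (Fin N) ℂ) (b : Fin M → ℂ)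
    (ω : Form M k) : Form N k :=
  (MvPolynomial.aeval (fun i => (∑ j, C (A i j) * X j) + C (b i)) :
    Poly M →ₐ[ℂ] Poly N).toLinearMap.compAlternatingMap (ω.compLinearMap A.mulVecLin)

theorem affPull_apply {M N k : ℕ} (A : Matrix (Fin M) (Fin N) ℂ) (b : Fin M → ℂ)
    (ω : Form M k) (v : Fin k → Fin N → ℂ) :
    affPull A b ω v = MvPolynomial.aeval (fun i => (∑ j, C (A i j) * X j) + C (b i) : Fin M → Poly N)
      (ω fun i => A.mulVec (v i)) := rfl

theorem formAt_affPull {M N k : ℕ} (A : Matrix (Fin M) (Fin N) ℂ) (b : Fin M → ℂ)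
    (ω : Form M k) (y : Fin N → ℂ) (v : Fin k → Fin N → ℂ) :
    formAt y (affPull A b ω) v = formAt (A.mulVec y + b) ω (fun i => A.mulVec (v i)) := by
  rw [formAt_apply, affPull_apply, formAt_apply, ← MvPolynomial.coe_aeval_eq_eval,
    ← MvPolynomial.coe_aeval_eq_eval]
  simp only [RingHom.coe_coe]
  rw [← AlgHom.comp_apply, MvPolynomial.comp_aeval]
  congr 2
  ext i
  simp [Matrix.mulVec, dotProduct]

theorem affPull_smul {M N k : ℕ} (A : Matrix (Fin M) (Fin N) ℂ) (b : Fin M → ℂ)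
    (c : ℂ) (ω : Form M k) : affPull A b (c • ω) = c • affPull A b ω :=
  form_ext fun x v => by rw [formAt_smul, formAt_affPull, formAt_affPull, formAt_smul]

theorem affPull_sub {M N k : ℕ} (A : Matrix (Fin M) (Fin N) ℂ) (b : Fin M → ℂ)
    (ω η : Form M k) : affPull A b (ω - η) = affPull A b ω - affPull A b η :=
  form_ext fun x v => by
    rw [formAt_sub, formAt_affPull, formAt_affPull, formAt_affPull, formAt_sub]

theorem affPull_zero {M N k : ℕ} (A : Matrix (Fin M) (Fin N) ℂ) (b : Fin M → ℂ) :
    affPull A b (0 : Form M k) = 0 :=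
  form_ext fun x v => by rw [formAt_affPull, formAt_zero, formAt_zero]

theorem contract_affPull {M N k : ℕ} {A : Matrix (Fin M) (Fin N) ℂ} {b : Fin M → ℂ}
    {X : VField N} {Y : VField M}
    (h : ∀ y, A.mulVec (fieldAt y X) = fieldAt (A.mulVec y + b) Y) (ω : Form M (k + 1)) :
    contract X (affPull A b ω) = affPull A b (contract Y ω) := by
  refine form_ext fun y v => ?_
  rw [formAt_contract, formAt_affPull, formAt_affPull, formAt_contract, ← h]
  congr 1
  ext i
  refine Fin.cases ?_ (fun i => ?_) i <;> simp

theorem contract_linField_affPull {N k : ℕ} {A B C : Matrix (Fin N) (Fin N) ℂ}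
    (h : A * B = C * A) (ω : Form N (k + 1)) :
    contract (linField B) (affPull A 0 ω) = affPull A 0 (contract (linField C) ω) := by
  refine contract_affPull (fun y => ?_) ω
  rw [fieldAt_linField, fieldAt_linField, add_zero, Matrix.mulVec_mulVec, Matrix.mulVec_mulVec, h]

theorem affPull_affPull {L M N k : ℕ} (A : Matrix (Fin L) (Fin M) ℂ) (a : Fin L → ℂ)
    (B : Matrix (Fin M) (Fin N) ℂ) (b : Fin M → ℂ) (ω : Form L k) :
    affPull B b (affPull A a ω) = affPull (A * B) (A.mulVec b + a) ω := by
  refine form_ext fun y v => ?_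
  rw [formAt_affPull, formAt_affPull, formAt_affPull, Matrix.mulVec_add, Matrix.mulVec_mulVec,
    add_assoc]
  simp only [Matrix.mulVec_mulVec]

theorem affPull_one {N k : ℕ} (ω : Form N k) : affPull 1 0 ω = ω :=
  form_ext fun y v => by rw [formAt_affPull]; simp

theorem affPull_injective {N k : ℕ} {A B : Matrix (Fin N) (Fin N) ℂ} (h : A * B = 1) :
    Function.Injective (affPull A 0 : Form N k → Form N k) := by
  intro ω η e
  have := congrArg (affPull B 0) e
  simpa [affPull_affPull, h, affPull_one] using this

theorem chartPullback_eq {N k : ℕ} (A : Matrix (Fin (N + 1)) (Fin (N + 1)) ℂ)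
    (ω : Form (N + 1) k) :
    chartPullback A ω =
      affPull (A.submatrix id Fin.castSucc) (fun i => A i (Fin.last N)) ω := rfl

/-- The directional derivative of a polynomial. -/
noncomputable def dirD {N : ℕ} (w : Fin N → ℂ) : Poly N →ₗ[ℂ] Poly N :=
  ∑ j, w j • (pderiv j : Derivation ℂ (Poly N) (Poly N)).toLinearMap

theorem dirD_apply {N : ℕ} (w : Fin N → ℂ) (f : Poly N) :
    dirD w f = ∑ j, w j • pderiv j f := by
  simp [dirD, LinearMap.sum_apply]

theorem dirD_single {N : ℕ} (j : Fin N) (f : Poly N) : dirD (Pi.single j 1) f = pderiv j f := by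
  simp [dirD_apply, Pi.single_apply]

theorem extD_apply {N k : ℕ} (ω : Form N k) (v : Fin (k + 1) → Fin N → ℂ) :
    extD ω v = ∑ i : Fin (k + 1), (-1 : ℤ) ^ (i : ℕ) • dirD (v i) (ω (i.removeNth v)) := by
  rw [extD, AlternatingMap.alternatizeUncurryFin_apply]
  refine Finset.sum_congr rfl fun i _ => ?_
  congr 1
  simp [LinearMap.sum_apply, alternating_sum_apply, dirD_apply]

theorem extD_add {N k : ℕ} (ω η : Form N k) : extD (ω + η) = extD ω + extD η := by
  ext1 v
  simp only [AlternatingMap.add_apply, extD_apply, map_add, smul_add, Finset.sum_add_distrib]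

theorem extD_smul {N k : ℕ} (c : ℂ) (ω : Form N k) : extD (c • ω) = c • extD ω := by
  ext1 v
  simp only [AlternatingMap.smul_apply, extD_apply, map_smul, Finset.smul_sum]
  exact Finset.sum_congr rfl fun i _ => smul_comm _ _ _

theorem extD_zero {N k : ℕ} : extD (0 : Form N k) = 0 := by
  simpa using extD_smul (0 : ℂ) (0 : Form N k)

theorem dirD_aeval_affine {M N : ℕ} (A : Matrix (Fin M) (Fin N) ℂ) (b : Fin M → ℂ)
    (w : Fin N → ℂ) (f : Poly M) :
    dirD w (MvPolynomial.aeval (fun i => (∑ j, C (A i j) * X j) + C (b i) : Fin M → Poly N) f) =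
      MvPolynomial.aeval (fun i => (∑ j, C (A i j) * X j) + C (b i) : Fin M → Poly N)
        (dirD (A.mulVec w) f) := by
  induction f using MvPolynomial.induction_on with
  | C a => simp [dirD_apply]
  | add p q hp hq => simp only [map_add, hp, hq]
  | mul_X p n hp =>
    have key : ∀ {K : ℕ} (u : Fin K → ℂ) (f g : Poly K),
        dirD u (f * g) = dirD u f * g + f * dirD u g := by
      intro K u f g
      simp only [dirD_apply, Derivation.leibniz, smul_add, Finset.sum_add_distrib, Finset.sum_mul,
        Finset.mul_sum, smul_eq_mul]
      rw [add_comm]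
      congr 1 <;> refine Finset.sum_congr rfl fun i _ => ?_ <;>
        simp only [MvPolynomial.smul_eq_C_mul] <;> ring
    rw [map_mul, key, hp, key, map_add, map_mul, map_mul]
    congr 2
    simp [dirD_apply, pderiv_X, Pi.single_apply, Matrix.mulVec, dotProduct,
      MvPolynomial.smul_eq_C_mul, mul_comm]

theorem extD_affPull {M N k : ℕ} (A : Matrix (Fin M) (Fin N) ℂ) (b : Fin M → ℂ) (ω : Form M k) :
    extD (affPull A b ω) = affPull A b (extD ω) := by
  ext1 v
  rw [extD_apply, affPull_apply, extD_apply, map_sum]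
  refine Finset.sum_congr rfl fun i _ => ?_
  rw [map_zsmul, affPull_apply, dirD_aeval_affine]
  rfl


section Pointwise

variable {E : Type*} [AddCommGroup E] [Module ℂ E]

theorem vanish_of_vecCons {k : ℕ} {ω : E [⋀^Fin (k + 1)]→ₗ[ℂ] ℂ} {s : E}
    (h : ∀ v, ω (Matrix.vecCons s v) = 0) (v : Fin (k + 1) → E) (i : Fin (k + 1)) (hi : v i = s) :
    ω v = 0 := by
  have h1 : v = i.insertNth s (i.removeNth v) := by
    rw [← hi, Fin.insertNth_self_removeNth]
  rw [h1, AlternatingMap.map_insertNth, h, smul_zero]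

theorem vanish_of_mem_span {k r : ℕ} {ω : E [⋀^Fin k]→ₗ[ℂ] ℂ} {s : Fin r → E}
    (h : ∀ v i j, v i = s j → ω v = 0) {v : Fin k → E} {i : Fin k}
    (hi : v i ∈ Submodule.span ℂ (Set.range s)) : ω v = 0 := by
  have h1 : Submodule.span ℂ (Set.range s) ≤
      LinearMap.ker (ω.toMultilinearMap.toLinearMap v i) := by
    rw [Submodule.span_le]
    rintro _ ⟨j, rfl⟩
    exact h _ i j (by simp)
  have := h1 hi
  simpa using this

theorem map_eq_map_projection {k r : ℕ} {ω : E [⋀^Fin k]→ₗ[ℂ] ℂ} {s : Fin r → E}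
    (h : ∀ v i j, v i = s j → ω v = 0) {v w : Fin k → E}
    (hvw : ∀ i, v i - w i ∈ Submodule.span ℂ (Set.range s)) : ω v = ω w := by
  classical
  have e : v = (v - w) + w := by simp
  rw [e]
  change ω.toMultilinearMap ((v - w) + w) = _
  rw [MultilinearMap.map_add_univ, Finset.sum_eq_single ∅]
  · simp
  · intro t _ ht
    obtain ⟨i, hi⟩ := Finset.nonempty_iff_ne_empty.2 ht
    exact vanish_of_mem_span h (i := i) (by simpa [hi] using hvw i)
  · simp

variable [FiniteDimensional ℂ E]

theorem eq_zero_of_killed {k r : ℕ} {ω : E [⋀^Fin k]→ₗ[ℂ] ℂ} {s : Fin r → E}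
    (hs : LinearIndependent ℂ s) (h : ∀ v i j, v i = s j → ω v = 0)
    (hkr : Module.finrank ℂ E < k + r) : ω = 0 := by
  obtain ⟨W, hW⟩ := Submodule.exists_isCompl (Submodule.span ℂ (Set.range s))
  have hd := Submodule.finrank_add_eq_of_isCompl hW
  rw [finrank_span_eq_card hs, Fintype.card_fin] at hd
  ext1 v
  have hv : ∀ i, ∃ w : W, v i - w ∈ Submodule.span ℂ (Set.range s) := by
    intro i
    obtain ⟨a, ha, b, hb, hab⟩ := Submodule.mem_sup.1
      (hW.sup_eq_top ▸ Submodule.mem_top : v i ∈ Submodule.span ℂ (Set.range s) ⊔ W)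
    exact ⟨⟨b, hb⟩, by rw [← hab]; simpa using ha⟩
  choose w hw using hv
  rw [map_eq_map_projection h (w := fun i => (w i : E)) hw]
  refine AlternatingMap.map_linearDependent _ _ fun hli => ?_
  have h3 : LinearIndependent ℂ w := LinearIndependent.of_comp W.subtype hli
  have := h3.fintype_card_le_finrank
  simp at this
  omega

theorem proportional_of_killed {k r : ℕ} {ω θ : E [⋀^Fin k]→ₗ[ℂ] ℂ} {s : Fin r → E}
    (hs : LinearIndependent ℂ s) (h : ∀ v i j, v i = s j → ω v = 0)
    (h' : ∀ v i j, v i = s j → θ v = 0)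
    (hkr : Module.finrank ℂ E = k + r) (v v' : Fin k → E) : ω v * θ v' = ω v' * θ v := by
  obtain ⟨W, hW⟩ := Submodule.exists_isCompl (Submodule.span ℂ (Set.range s))
  have hd := Submodule.finrank_add_eq_of_isCompl hW
  rw [finrank_span_eq_card hs, Fintype.card_fin] at hd
  have hv : ∀ v : E, ∃ w : W, v - w ∈ Submodule.span ℂ (Set.range s) := by
    intro v
    obtain ⟨a, ha, b, hb, hab⟩ := Submodule.mem_sup.1
      (hW.sup_eq_top ▸ Submodule.mem_top : v ∈ Submodule.span ℂ (Set.range s) ⊔ W)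
    exact ⟨⟨b, hb⟩, by rw [← hab]; simpa using ha⟩
  choose w hw using hv
  let e : Module.Basis (Fin k) ℂ W := Module.finBasisOfFinrankEq ℂ W (by omega)
  have key : ∀ {η : E [⋀^Fin k]→ₗ[ℂ] ℂ}, (∀ v i j, v i = s j → η v = 0) → ∀ v,
      η v = η (fun i => (e i : E)) * e.det (fun i => w (v i)) := by
    intro η hη v
    rw [map_eq_map_projection hη (w := fun i => (w (v i) : E)) fun i => hw _]
    have := DFunLike.congr_fun (AlternatingMap.eq_smul_basis_det e (η.compLinearMap W.subtype))
      (fun i => w (v i))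
    simpa using this
  rw [key h v, key h v', key h' v, key h' v']
  ring

end Pointwise

theorem vol_apply {N : ℕ} (v : Fin N → Fin N → ℂ) : vol N v = C (Matrix.det v) := by
  simp [vol, MvPolynomial.algebraMap_eq]; rfl

theorem formAt_vol {N : ℕ} (x : Fin N → ℂ) (v : Fin N → Fin N → ℂ) :
    formAt x (vol N) v = Matrix.det v := by
  rw [formAt_apply, vol_apply, MvPolynomial.eval_C]

/-- The form `i_R i_B i_Z vol` for linear vector fields `B` and `Z`. -/
noncomputable def tripleForm {m : ℕ} (B Z : Matrix (Fin (m + 4)) (Fin (m + 4)) ℂ) :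
    Form (m + 4) (m + 1) :=
  contract (radial (m + 4)) (contract (linField B) (contract (linField Z) (vol (m + 4))))

theorem formAt_tripleForm {m : ℕ} (B Z : Matrix (Fin (m + 4)) (Fin (m + 4)) ℂ)
    (x : Fin (m + 4) → ℂ) (v : Fin (m + 1) → Fin (m + 4) → ℂ) :
    formAt x (tripleForm B Z) v = Matrix.det (Matrix.vecCons (Z.mulVec x)
      (Matrix.vecCons (B.mulVec x) (Matrix.vecCons x v))) := by
  rw [tripleForm, formAt_contract, formAt_contract, formAt_contract, formAt_vol, fieldAt_radial,
    fieldAt_linField, fieldAt_linField]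

theorem det_cons_dependent {m : ℕ} {a b c : Fin (m + 4) → ℂ}
    (h : ¬ LinearIndependent ℂ ![a, b, c]) (v : Fin (m + 1) → Fin (m + 4) → ℂ) :
    Matrix.det (Matrix.vecCons a (Matrix.vecCons b (Matrix.vecCons c v))) = 0 := by
  change (Matrix.detRowAlternating : (Fin (m + 4) → ℂ) [⋀^Fin (m + 4)]→ₗ[ℂ] ℂ) _ = 0
  refine AlternatingMap.map_linearDependent _ _ fun hli => h ?_
  have := hli.comp (Fin.castLE (show 3 ≤ m + 4 by omega)) (Fin.castLE_injective _)
  have e : ![a, b, c] = Matrix.vecCons a (Matrix.vecCons b (Matrix.vecCons c v)) ∘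
      Fin.castLE (show 3 ≤ m + 4 by omega) := by
    ext i j
    fin_cases i <;> rfl
  rw [e]
  exact this

theorem dependent_of_det_cons {m : ℕ} {a b c : Fin (m + 4) → ℂ}
    (h : ∀ v : Fin (m + 1) → Fin (m + 4) → ℂ,
      Matrix.det (Matrix.vecCons a (Matrix.vecCons b (Matrix.vecCons c v))) = 0) :
    ¬ LinearIndependent ℂ ![a, b, c] := by
  intro hli
  have hab : LinearIndependent ℂ ![a, b] := by
    have := hli.comp (Fin.castLE (show 2 ≤ 3 by omega)) (Fin.castLE_injective _)
    convert this using 1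
    ext i j
    fin_cases i <;> rfl
  have ha : LinearIndependent ℂ ![a] := by
    have := hli.comp (Fin.castLE (show 1 ≤ 3 by omega)) (Fin.castLE_injective _)
    convert this using 1
    ext i j
    fin_cases i
    rfl
  let D : (Fin (m + 4) → ℂ) [⋀^Fin (m + 3 + 1)]→ₗ[ℂ] ℂ := Matrix.detRowAlternating
  have hD : ∀ v, D v = Matrix.det v := fun v => rfl
  have h1 : ((D.curryLeft a).curryLeft b : (Fin (m + 4) → ℂ) [⋀^Fin (m + 2)]→ₗ[ℂ] ℂ) = 0 := by
    refine eq_zero_of_killed hli ?_ (by simp)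
    intro v i j hj
    refine vanish_of_vecCons (s := ![a, b, c] j) ?_ v i hj
    intro w
    fin_cases j
    · exact D.map_eq_zero_of_eq (i := ⟨0, by omega⟩) (j := ⟨2, by omega⟩) _ rfl
        (by simp [Fin.ext_iff])
    · exact D.map_eq_zero_of_eq (i := ⟨1, by omega⟩) (j := ⟨2, by omega⟩) _ rfl
        (by simp [Fin.ext_iff])
    · exact h w
  have h2 : D.curryLeft a = 0 := by
    refine eq_zero_of_killed hab ?_ (by simp)
    intro v i j hj
    refine vanish_of_vecCons (s := ![a, b] j) ?_ v i hj
    intro w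
    fin_cases j
    · exact D.map_eq_zero_of_eq (i := 0) (j := 1) _ rfl (by simp)
    · exact DFunLike.congr_fun h1 w
  have h3 : D = 0 := by
    refine eq_zero_of_killed ha ?_ (by simp)
    intro v i j hj
    refine vanish_of_vecCons (s := ![a] j) ?_ v i hj
    intro w
    fin_cases j
    exact DFunLike.congr_fun h2 w
  have := DFunLike.congr_fun h3 (1 : Matrix (Fin (m + 4)) (Fin (m + 4)) ℂ)
  have h4 : D (1 : Matrix (Fin (m + 4)) (Fin (m + 4)) ℂ) = 1 := Matrix.det_one
  exact one_ne_zero (h4.symm.trans this)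

/-- A linear vector field that is everywhere dependent on `R` and a diagonal field with distinct
eigenvalues is a linear combination of the two. -/
theorem eq_combination_of_tripleForm_eq_zero {m : ℕ} {q : Fin (m + 4) → ℂ}
    (hq : Function.Injective q) {Z : Matrix (Fin (m + 4)) (Fin (m + 4)) ℂ}
    (h : tripleForm (Matrix.diagonal q) Z = 0) :
    ∃ a b : ℂ, Z = a • (1 : Matrix (Fin (m + 4)) (Fin (m + 4)) ℂ) + b • Matrix.diagonal q := by
  have hdep : ∀ x : Fin (m + 4) → ℂ, ∀ i j, i ≠ j → x i ≠ 0 → x j ≠ 0 →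
      ∃ a b : ℂ, ∀ k, Z.mulVec x k = a * x k + b * (q k * x k) := by
    intro x i j hij hi hj
    have h1 : ¬ LinearIndependent ℂ ![Z.mulVec x, (Matrix.diagonal q).mulVec x, x] := by
      refine dependent_of_det_cons fun v => ?_
      rw [← formAt_tripleForm, h, formAt_zero]
    rw [Fintype.not_linearIndependent_iff] at h1
    obtain ⟨g, hg, n, hn⟩ := h1
    have hk : ∀ k, g 0 * Z.mulVec x k + g 1 * (q k * x k) + g 2 * x k = 0 := by
      intro k
      have := congrFun hg k
      simpa [Fin.sum_univ_three, Matrix.mulVec_diagonal] using this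
    by_cases h0 : g 0 = 0
    · exfalso
      have e1 := hk i
      have e2 := hk j
      rw [h0] at e1 e2
      have e1' : g 1 * q i + g 2 = 0 := by
        apply mul_right_cancel₀ hi; linear_combination e1
      have e2' : g 1 * q j + g 2 = 0 := by
        apply mul_right_cancel₀ hj; linear_combination e2
      have h3 : g 1 * (q i - q j) = 0 := by linear_combination e1' - e2'
      have h4 : g 1 = 0 := by
        rcases mul_eq_zero.1 h3 with h | h
        · exact h
        · exact absurd (hq (sub_eq_zero.1 h)) hij
      have h5 : g 2 = 0 := by simpa [h4] using e1'
      apply hn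
      fin_cases n <;> assumption
    · refine ⟨-(g 2 / g 0), -(g 1 / g 0), fun k => ?_⟩
      have := hk k
      field_simp
      linear_combination this
  have hoff : ∀ i j k, i ≠ j → k ≠ i → k ≠ j → Z k i + Z k j = 0 := by
    intro i j k hij hki hkj
    obtain ⟨a, b, hab⟩ := hdep (Pi.single i 1 + Pi.single j 1) i j hij (by simp [hij])
      (by simp [hij.symm])
    have := hab k
    simpa [Matrix.mulVec_add, hki, hkj] using this
  have hz : ∀ k i, k ≠ i → Z k i = 0 := by
    intro k i hki
    have hc : 2 ≤ (Finset.univ \ {k, i} : Finset (Fin (m + 4))).card := by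
      have := Finset.le_card_sdiff ({k, i} : Finset (Fin (m + 4))) Finset.univ
      have h2 : ({k, i} : Finset (Fin (m + 4))).card ≤ 2 := Finset.card_le_two
      simp only [Finset.card_univ, Fintype.card_fin] at this
      omega
    obtain ⟨j, hj, l, hl, hjl⟩ := Finset.one_lt_card.1 hc
    simp only [Finset.mem_sdiff, Finset.mem_univ, Finset.mem_insert, Finset.mem_singleton,
      true_and, not_or] at hj hl
    have e1 := hoff i j k (Ne.symm hj.2) hki (Ne.symm hj.1)
    have e2 := hoff i l k (Ne.symm hl.2) hki (Ne.symm hl.1)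
    have e3 := hoff j l k hjl (Ne.symm hj.1) (Ne.symm hl.1)
    linear_combination (e1 + e2 - e3) / 2
  obtain ⟨a, b, hab⟩ := hdep (fun _ => 1) 0 1 (by simp) (by simp) (by simp)
  refine ⟨a, b, ?_⟩
  ext k i
  by_cases hki : k = i
  · subst hki
    have := hab k
    rw [Matrix.mulVec, dotProduct, Finset.sum_eq_single k] at this
    · simpa using this
    · intro j _ hj
      simp [hz k j hj.symm]
    · simp
  · simp [hz k i hki, hki]


theorem dvd_of_forall_dvd_mul {R ι : Type*} [CommRing R] [IsDomain R]
    [UniqueFactorizationMonoid R] {c : ι → R} (hc : ∀ q, Prime q → ∃ i, ¬ q ∣ c i)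
    {a : R} (ha : a ≠ 0) : ∀ {b : R}, (∀ i, a ∣ b * c i) → a ∣ b := by
  induction a using UniqueFactorizationMonoid.induction_on_prime with
  | h₁ => exact absurd rfl ha
  | h₂ u hu => intro b _; exact hu.dvd
  | h₃ a q ha' hq ih =>
    intro b hb
    obtain ⟨i, hi⟩ := hc q hq
    obtain ⟨b', rfl⟩ : q ∣ b :=
      (hq.dvd_or_dvd (dvd_trans (dvd_mul_right q a) (hb i))).resolve_right hi
    refine mul_dvd_mul_left q (ih ha' fun j => ?_)
    have := hb j
    rw [mul_assoc] at this
    exact (mul_dvd_mul_iff_left hq.ne_zero).1 this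

theorem SingCodimGeTwo.exists_not_dvd {N k : ℕ} {ω : Form N k} (h : SingCodimGeTwo ω)
    {q : Poly N} (hq : Prime q) : ∃ v, ¬ q ∣ ω v := by
  by_contra! hcon
  have h1 : Ideal.span (Set.range ω) ≤ Ideal.span {q} := by
    rw [Ideal.span_le]
    rintro _ ⟨v, rfl⟩
    exact Ideal.mem_span_singleton.2 (hcon v)
  have h2 := Ideal.height_mono h1
  have h3 := Ideal.height_span_singleton_le_one (x := q) hq.not_isUnit
  have h4 : (2 : ℕ∞) ≤ 1 := le_trans h (h2.trans h3)
  exact absurd h4 (by decide)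

theorem contract_homogeneous {N k a b : ℕ} {X : VField N} {ω : Form N (k + 1)}
    (hX : ∀ j, (X j).IsHomogeneous a) (hω : ∀ v, (ω v).IsHomogeneous b) (v : Fin k → Fin N → ℂ) :
    (contract X ω v).IsHomogeneous (a + b) := by
  rw [contract_apply]
  exact MvPolynomial.IsHomogeneous.sum _ _ _ fun j _ => (hX j).mul (hω _)

theorem linField_homogeneous {N : ℕ} (B : Matrix (Fin N) (Fin N) ℂ) (j : Fin N) :
    (linField B j).IsHomogeneous 1 :=
  MvPolynomial.IsHomogeneous.sum _ _ _ fun k _ => by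
    simpa using (MvPolynomial.isHomogeneous_C _ _).mul (MvPolynomial.isHomogeneous_X ℂ k)

theorem vol_homogeneous {N : ℕ} (v : Fin N → Fin N → ℂ) : (vol N v).IsHomogeneous 0 := by
  rw [vol_apply]; exact MvPolynomial.isHomogeneous_C _ _

theorem tripleForm_homogeneous {m : ℕ} (B Z : Matrix (Fin (m + 4)) (Fin (m + 4)) ℂ)
    (v : Fin (m + 1) → Fin (m + 4) → ℂ) : (tripleForm B Z v).IsHomogeneous 3 := by
  rw [tripleForm, ← linField_one]
  exact contract_homogeneous (linField_homogeneous _) (contract_homogeneous (linField_homogeneous _)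
    (contract_homogeneous (linField_homogeneous _) vol_homogeneous)) v

theorem formAt_vecCons_eq_zero {N k : ℕ} {X : VField N} {ω : Form N (k + 1)}
    (h : contract X ω = 0) (x : Fin N → ℂ) {v : Fin (k + 1) → Fin N → ℂ} {i : Fin (k + 1)}
    (hi : v i = fieldAt x X) : formAt x ω v = 0 := by
  refine vanish_of_vecCons (fun w => ?_) v i hi
  rw [← formAt_contract, h, formAt_zero]

theorem contract_tripleForm_radial {m : ℕ} (B Z : Matrix (Fin (m + 4)) (Fin (m + 4)) ℂ) :
    contract (radial _) (tripleForm B Z) = 0 := contract_contract_self _ _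

theorem contract_neg {N k : ℕ} (X : VField N) (ω : Form N (k + 1)) :
    contract X (-ω) = -contract X ω := by
  have e : -ω = (-1 : ℂ) • ω := by ext1 v; simp
  rw [e, contract_smul]
  ext1 v; simp

theorem contract_tripleForm_left {m : ℕ} (B Z : Matrix (Fin (m + 4)) (Fin (m + 4)) ℂ) :
    contract (linField B) (tripleForm B Z) = 0 := by
  rw [tripleForm, contract_contract_comm, contract_contract_self, ← linField_one, neg_eq_zero]
  simpa using contract_smul (linField 1) 0 (0 : Form (m + 4) (m + 1))

theorem contract_form_zero {N k : ℕ} (X : VField N) : contract X (0 : Form N (k + 1)) = 0 := by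
  simpa using contract_smul X 0 (0 : Form N (k + 1))

theorem contract_tripleForm_right {m : ℕ} (B Z : Matrix (Fin (m + 4)) (Fin (m + 4)) ℂ) :
    contract (linField Z) (tripleForm B Z) = 0 := by
  rw [tripleForm, contract_contract_comm, contract_contract_comm (linField Z) (linField B),
    contract_contract_self, contract_form_zero, neg_zero, contract_form_zero, neg_zero]

/-- If `R`, `B` and `Z` are tangent to a form with codimension two singularities, then
`i_R i_B i_Z vol` is a multiple of the form. -/
theorem tripleForm_eq_smul {m d : ℕ} (hd : 1 ≤ d) {ω : Form (m + 4) (m + 1)} (h0 : ω ≠ 0)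
    (hhom : ∀ v, (ω v).IsHomogeneous (d + 2)) (hsing : SingCodimGeTwo ω)
    (hR : contract (radial _) ω = 0) {B Z : Matrix (Fin (m + 4)) (Fin (m + 4)) ℂ}
    (hB : B ∈ tangentFields ω) (hZ : Z ∈ tangentFields ω) :
    ∃ c : ℂ, tripleForm B Z = c • ω ∧ (c ≠ 0 → d = 1) := by
  by_cases ht : tripleForm B Z = 0
  · exact ⟨0, by simp [ht], fun h => absurd rfl h⟩
  rw [mem_tangentFields] at hB hZ
  have hprop : ∀ v w, ω v * tripleForm B Z w = ω w * tripleForm B Z v := by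
    intro v w
    refine MvPolynomial.funext fun x => ?_
    simp only [map_mul, ← formAt_apply]
    by_cases hli : LinearIndependent ℂ ![Z.mulVec x, B.mulVec x, x]
    · refine proportional_of_killed hli ?_ ?_ (by simp) v w
      · intro v i j hj
        fin_cases j
        · exact formAt_vecCons_eq_zero hZ x (hj.trans (fieldAt_linField x Z).symm)
        · exact formAt_vecCons_eq_zero hB x (hj.trans (fieldAt_linField x B).symm)
        · exact formAt_vecCons_eq_zero hR x (hj.trans (fieldAt_radial x).symm)
      · intro v i j hj
        fin_cases j
        · exact formAt_vecCons_eq_zero (contract_tripleForm_right B Z) x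
            (hj.trans (fieldAt_linField x Z).symm)
        · exact formAt_vecCons_eq_zero (contract_tripleForm_left B Z) x
            (hj.trans (fieldAt_linField x B).symm)
        · exact formAt_vecCons_eq_zero (contract_tripleForm_radial B Z) x
            (hj.trans (fieldAt_radial x).symm)
    · rw [formAt_tripleForm, formAt_tripleForm, det_cons_dependent hli, det_cons_dependent hli,
        mul_zero, mul_zero]
  obtain ⟨w, hw⟩ : ∃ w, tripleForm B Z w ≠ 0 := by
    by_contra! hcon
    exact ht (by ext1 v; simp [hcon v])
  have hωw : ω w ≠ 0 := by
    intro h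
    apply h0
    ext1 v
    have := hprop v w
    rw [h, zero_mul] at this
    exact (mul_eq_zero.1 this).resolve_right hw
  obtain ⟨f, hf⟩ : ω w ∣ tripleForm B Z w :=
    dvd_of_forall_dvd_mul (c := ω) (fun q hq => hsing.exists_not_dvd hq) hωw fun v =>
      ⟨tripleForm B Z v, by rw [mul_comm, hprop]⟩
  have hf0 : f ≠ 0 := by
    rintro rfl
    exact hw (by rw [hf, mul_zero])
  have hdeg : 3 = d + 2 + f.totalDegree := by
    rw [← (tripleForm_homogeneous B Z w).totalDegree hw, hf,
      MvPolynomial.totalDegree_mul_of_isDomain hωw hf0, (hhom w).totalDegree hωw]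
  have hfC : f = C (f.coeff 0) := MvPolynomial.totalDegree_eq_zero_iff_eq_C.1 (by omega)
  refine ⟨f.coeff 0, ?_, fun _ => by omega⟩
  ext1 v
  have := hprop v w
  rw [hf] at this
  apply mul_left_cancel₀ hωw
  rw [AlternatingMap.smul_apply, MvPolynomial.smul_eq_C_mul, ← hfC, ← this]
  ring

theorem tripleForm_add {m : ℕ} (B Z Z' : Matrix (Fin (m + 4)) (Fin (m + 4)) ℂ) :
    tripleForm B (Z + Z') = tripleForm B Z + tripleForm B Z' := by
  simp only [tripleForm, linField_add, contract_field_add, contract_add]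

theorem tripleForm_smul {m : ℕ} (c : ℂ) (B Z : Matrix (Fin (m + 4)) (Fin (m + 4)) ℂ) :
    tripleForm B (c • Z) = c • tripleForm B Z := by
  simp only [tripleForm, linField_smul, contract_field_smul, contract_smul]

theorem tripleForm_sub {m : ℕ} (B Z Z' : Matrix (Fin (m + 4)) (Fin (m + 4)) ℂ) :
    tripleForm B (Z - Z') = tripleForm B Z - tripleForm B Z' := by
  have : Z - Z' = Z + (-1 : ℂ) • Z' := by simp [sub_eq_add_neg]
  rw [this, tripleForm_add, tripleForm_smul]
  ext1 v; simp [sub_eq_add_neg]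


/-- The derivation `∑ pⱼ xⱼ ∂/∂xⱼ`. -/
noncomputable def eulerD {N : ℕ} (p : Fin N → ℤ) : Derivation ℂ (Poly N) (Poly N) :=
  ∑ j, (diagField p j) • pderiv j

theorem eulerD_apply {N : ℕ} (p : Fin N → ℤ) (f : Poly N) :
    eulerD p f = ∑ j, diagField p j * pderiv j f := by
  have : ∀ s : Finset (Fin N), (∑ j ∈ s, (diagField p j) • (pderiv j : Derivation ℂ _ _)) f =
      ∑ j ∈ s, diagField p j * pderiv j f := by
    intro s
    induction s using Finset.induction_on with
    | empty => simp
    | insert a s ha ih => simp [Finset.sum_insert ha, ih]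
  exact this _

theorem eulerD_X {N : ℕ} (p : Fin N → ℤ) (j : Fin N) :
    eulerD p (X j) = (p j : ℂ) • (X j : Poly N) := by
  rw [eulerD_apply, Finset.sum_eq_single j]
  · simp [diagField, MvPolynomial.smul_eq_C_mul]
  · intro i _ hi
    rw [pderiv_X_of_ne hi.symm, mul_zero]
  · simp

theorem coeff_eulerD {N : ℕ} (p : Fin N → ℤ) (f : Poly N) (a : Fin N →₀ ℕ) :
    (eulerD p f).coeff a = (∑ j, (p j : ℂ) * a j) * f.coeff a := by
  rw [eulerD_apply, MvPolynomial.coeff_sum, Finset.sum_mul]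
  refine Finset.sum_congr rfl fun j _ => ?_
  rw [diagField, mul_assoc, MvPolynomial.coeff_C_mul, mul_comm (X j), MvPolynomial.coeff_mul_X']
  by_cases hj : j ∈ a.support
  · rw [if_pos hj, MvPolynomial.coeff_pderiv]
    have h1 : 1 ≤ a j := Nat.one_le_iff_ne_zero.2 (Finsupp.mem_support_iff.1 hj)
    have h2 : a - Finsupp.single j 1 + Finsupp.single j 1 = a :=
      tsub_add_cancel_of_le (Finsupp.single_le_iff.2 h1)
    rw [h2]
    have h3 : (((a - Finsupp.single j 1 : Fin N →₀ ℕ) j : ℕ) : ℂ) + 1 = a j := by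
      have : (a - Finsupp.single j 1 : Fin N →₀ ℕ) j = a j - 1 := by simp
      rw [this]; push_cast [h1]; ring
    rw [h3]; ring
  · rw [if_neg hj]
    simp [Finsupp.notMem_support_iff.1 hj]

/-- A nonzero eigenvector of `∑ pⱼ xⱼ ∂/∂xⱼ` contains a monomial of the given weight. -/
theorem exists_weight_of_eulerD_eq {N : ℕ} {p : Fin N → ℤ} {c : ℂ} {f : Poly N} (hf : f ≠ 0)
    (h : eulerD p f = c • f) : ∃ a : Fin N →₀ ℕ, c = ∑ j, (p j : ℂ) * a j := by
  obtain ⟨a, ha⟩ := MvPolynomial.ne_zero_iff.1 hf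
  refine ⟨a, ?_⟩
  have := congrArg (MvPolynomial.coeff a) h
  rw [coeff_eulerD, MvPolynomial.coeff_smul, smul_eq_mul] at this
  exact (mul_right_cancel₀ ha this).symm

theorem eulerD_pderiv {N : ℕ} (p : Fin N → ℤ) (j : Fin N) (f : Poly N) :
    eulerD p (pderiv j f) = pderiv j (eulerD p f) - (p j : ℂ) • pderiv j f := by
  ext a
  rw [coeff_eulerD, MvPolynomial.coeff_sub, MvPolynomial.coeff_smul, MvPolynomial.coeff_pderiv,
    MvPolynomial.coeff_pderiv, coeff_eulerD]
  have : ∑ i, (p i : ℂ) * ((a + Finsupp.single j 1 : Fin N →₀ ℕ) i : ℕ) =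
      ∑ i, (p i : ℂ) * a i + p j := by
    simp only [Finsupp.add_apply, Nat.cast_add, mul_add, Finset.sum_add_distrib]
    congr 1
    rw [Finset.sum_eq_single j]
    · simp
    · intro i _ hi; simp [hi.symm]
    · simp
  rw [this, smul_eq_mul]; ring

theorem bracket_diagField {N : ℕ} (p : Fin N → ℤ) (X : VField N) (j : Fin N) :
    bracket (diagField p) X j = eulerD p (X j) - (p j : ℂ) • X j := by
  rw [bracket, Finset.sum_sub_distrib, eulerD_apply]
  congr 1
  rw [Finset.sum_eq_single j]
  · simp [diagField, MvPolynomial.smul_eq_C_mul, mul_comm]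
  · intro i _ hi
    rw [diagField, pderiv_C_mul, pderiv_X_of_ne hi.symm]
    simp
  · simp

theorem bracket_eq_smul_iff {N : ℕ} {p : Fin N → ℤ} {X : VField N} {c : ℂ} :
    bracket (diagField p) X = c • X ↔ ∀ j, eulerD p (X j) = (c + p j) • X j := by
  rw [funext_iff]
  refine forall_congr' fun j => ?_
  rw [bracket_diagField, Pi.smul_apply, sub_eq_iff_eq_add, add_smul]

/-- The basis tuple `(e_{I 0}, …, e_{I (k-1)})`. -/
def stdTuple {N k : ℕ} (I : Fin k → Fin N) : Fin k → Fin N → ℂ := fun i => Pi.single (I i) 1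

theorem form_ext_stdTuple {N k : ℕ} {ω η : Form N k}
    (h : ∀ I : Fin k → Fin N, Function.Injective I → ω (stdTuple I) = η (stdTuple I)) : ω = η :=
  Module.Basis.ext_alternating (Pi.basisFun ℂ (Fin N)) fun I hI => by
    simp only [Pi.basisFun_apply]
    exact h I hI

/-- A form on which the Lie derivative along `∑ pⱼ xⱼ ∂/∂xⱼ` acts as the scalar `κ`. -/
def IsWeighted {N k : ℕ} (p : Fin N → ℤ) (κ : ℂ) (ω : Form N k) : Prop :=
  ∀ I : Fin k → Fin N,
    eulerD p (ω (stdTuple I)) = (κ - ∑ i, (p (I i) : ℂ)) • ω (stdTuple I)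

theorem vecCons_stdTuple {N k : ℕ} (j : Fin N) (I : Fin k → Fin N) :
    Matrix.vecCons (Pi.single j 1) (stdTuple I) = stdTuple (Matrix.vecCons j I) := by
  ext i : 1
  refine Fin.cases ?_ (fun i => ?_) i <;> rfl

theorem IsWeighted.contract {N k : ℕ} {p : Fin N → ℤ} {κ a : ℂ} {X : VField N}
    {ω : Form N (k + 1)} (hX : ∀ j, eulerD p (X j) = (a + p j) • X j) (hω : IsWeighted p κ ω) :
    IsWeighted p (a + κ) (contract X ω) := by
  intro I
  rw [contract_apply, map_sum, Finset.smul_sum]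
  refine Finset.sum_congr rfl fun j _ => ?_
  rw [vecCons_stdTuple, Derivation.leibniz, hX, hω, Fin.sum_univ_succ]
  simp only [Matrix.cons_val_zero, Matrix.cons_val_succ, smul_eq_mul, MvPolynomial.smul_eq_C_mul]
  simp only [C_add, C_sub]
  ring

theorem isWeighted_vol {N : ℕ} (p : Fin N → ℤ) : IsWeighted p (∑ j, (p j : ℂ)) (vol N) := by
  intro I
  by_cases hI : Function.Injective I
  · have h1 : ∑ i, (p (I i) : ℂ) = ∑ j, (p j : ℂ) :=
      (Equiv.ofBijective I (Finite.injective_iff_bijective.1 hI)).sum_comp fun j => (p j : ℂ)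
    rw [h1, sub_self, zero_smul, vol_apply]
    exact (eulerD p).map_algebraMap _
  · have : vol N (stdTuple I) = 0 := by
      refine AlternatingMap.map_eq_zero_of_not_injective _ _ fun h => hI fun i j hij => h ?_
      simp [stdTuple, hij]
    rw [this, map_zero, smul_zero]

theorem extD_stdTuple {N k : ℕ} (ω : Form N k) (I : Fin (k + 1) → Fin N) :
    extD ω (stdTuple I) =
      ∑ i : Fin (k + 1), (-1 : ℤ) ^ (i : ℕ) • pderiv (I i) (ω (stdTuple (i.removeNth I))) := by
  rw [extD_apply]
  refine Finset.sum_congr rfl fun i _ => ?_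
  rw [stdTuple, dirD_single]
  rfl

theorem IsWeighted.extD {N k : ℕ} {p : Fin N → ℤ} {κ : ℂ} {ω : Form N k}
    (hω : IsWeighted p κ ω) : IsWeighted p κ (extD ω) := by
  intro I
  rw [extD_stdTuple, map_sum, Finset.smul_sum]
  refine Finset.sum_congr rfl fun i _ => ?_
  rw [map_zsmul, eulerD_pderiv, hω, Fin.sum_univ_succAbove _ i, smul_comm, Derivation.map_smul,
    ← sub_smul]
  congr 2
  simp only [Fin.removeNth_apply]
  ring

theorem diagField_pderiv {N : ℕ} (p : Fin N → ℤ) (i j : Fin N) :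
    pderiv i (diagField p j) = if i = j then C (p j : ℂ) else 0 := by
  rw [diagField, pderiv_C_mul]
  split_ifs with h
  · subst h; simp
  · rw [pderiv_X_of_ne (Ne.symm h), mul_zero]

/-- Cartan's formula for diagonal vector fields, on basis tuples. -/
theorem cartan_stdTuple {N k : ℕ} (p : Fin N → ℤ) (ω : Form N (k + 1)) (I : Fin (k + 1) → Fin N) :
    contract (diagField p) (extD ω) (stdTuple I) =
      eulerD p (ω (stdTuple I)) + (∑ i, (p (I i) : ℂ)) • ω (stdTuple I) -
        extD (contract (diagField p) ω) (stdTuple I) := by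
  have h1 : ∀ j, extD ω (stdTuple (Matrix.vecCons j I)) = pderiv j (ω (stdTuple I)) -
      ∑ i : Fin (k + 1), (-1 : ℤ) ^ (i : ℕ) •
        pderiv (I i) (ω (stdTuple (Matrix.vecCons j (i.removeNth I)))) := by
    intro j
    rw [extD_stdTuple, Fin.sum_univ_succ, sub_eq_add_neg, ← Finset.sum_neg_distrib]
    congr 1
    · simp
    · refine Finset.sum_congr rfl fun i _ => ?_
      rw [Fin.val_succ, pow_succ, mul_neg_one, neg_smul]
      congr 5
      ext t : 1
      refine Fin.cases ?_ (fun t => ?_) t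
      · simp [Fin.removeNth_apply]
      · simp [Fin.removeNth_apply]
  have h2 : ∀ i : Fin (k + 1), (-1 : ℤ) ^ (i : ℕ) •
      ω (stdTuple (Matrix.vecCons (I i) (i.removeNth I))) = ω (stdTuple I) := by
    intro i
    rw [← vecCons_stdTuple, ← AlternatingMap.map_insertNth]
    congr 1
    have : stdTuple (i.removeNth I) = i.removeNth (stdTuple I) := rfl
    rw [this]
    exact Fin.insertNth_self_removeNth i (stdTuple I)
  have h3 : ∀ i : Fin (k + 1), pderiv (I i) (contract (diagField p) ω (stdTuple (i.removeNth I))) =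
      (p (I i) : ℂ) • ω (stdTuple (Matrix.vecCons (I i) (i.removeNth I))) +
        ∑ j, diagField p j * pderiv (I i) (ω (stdTuple (Matrix.vecCons j (i.removeNth I)))) := by
    intro i
    rw [contract_apply, map_sum]
    simp only [vecCons_stdTuple, Derivation.leibniz, diagField_pderiv, smul_eq_mul,
      Finset.sum_add_distrib]
    rw [add_comm]
    congr 1
    rw [Finset.sum_eq_single (I i)]
    · simp [MvPolynomial.smul_eq_C_mul, mul_comm]
    · intro j _ hj
      simp [hj.symm]
    · simp
  have h4 : contract (diagField p) (extD ω) (stdTuple I) = eulerD p (ω (stdTuple I)) -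
      ∑ i : Fin (k + 1), (-1 : ℤ) ^ (i : ℕ) • ∑ j, diagField p j *
        pderiv (I i) (ω (stdTuple (Matrix.vecCons j (i.removeNth I)))) := by
    rw [contract_apply, eulerD_apply]
    simp only [vecCons_stdTuple, h1, mul_sub, Finset.sum_sub_distrib, Finset.mul_sum,
      Finset.smul_sum]
    congr 1
    rw [Finset.sum_comm]
    exact Finset.sum_congr rfl fun i _ => Finset.sum_congr rfl fun j _ => mul_smul_comm _ _ _
  have h5 : extD (contract (diagField p) ω) (stdTuple I) =
      (∑ i, (p (I i) : ℂ)) • ω (stdTuple I) + ∑ i : Fin (k + 1), (-1 : ℤ) ^ (i : ℕ) •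
        ∑ j, diagField p j *
          pderiv (I i) (ω (stdTuple (Matrix.vecCons j (i.removeNth I)))) := by
    rw [extD_stdTuple, Finset.sum_smul, ← Finset.sum_add_distrib]
    refine Finset.sum_congr rfl fun i _ => ?_
    rw [h3, smul_add, smul_comm, h2]
  rw [h4, h5]
  ring

/-- For a form annihilated by a diagonal field, being weighted is expressed by `i_S dω = κ ω`. -/
theorem contract_extD_eq_smul_iff {N k : ℕ} {p : Fin N → ℤ} {κ : ℂ} {ω : Form N (k + 1)}
    (h : contract (diagField p) ω = 0) :
    contract (diagField p) (extD ω) = κ • ω ↔ IsWeighted p κ ω := by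
  have key : ∀ I, contract (diagField p) (extD ω) (stdTuple I) = (κ • ω) (stdTuple I) ↔
      eulerD p (ω (stdTuple I)) = (κ - ∑ i, (p (I i) : ℂ)) • ω (stdTuple I) := by
    intro I
    rw [cartan_stdTuple, h, extD_zero, AlternatingMap.zero_apply, sub_zero,
      AlternatingMap.smul_apply, sub_smul, eq_sub_iff_add_eq]
  constructor
  · intro e I
    exact (key I).1 (by rw [e])
  · intro e
    exact form_ext_stdTuple fun I _ => (key I).2 (e I)

theorem diagField_one {N : ℕ} : diagField (fun _ : Fin N => (1 : ℤ)) = radial N := by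
  ext1 j; simp [diagField, radial]

/-- Euler's identity `i_R dω = (e + k) ω` for homogeneous forms with `i_R ω = 0`. -/
theorem contract_radial_extD {N k e : ℕ} {ω : Form N (k + 1)} (hω : ∀ v, (ω v).IsHomogeneous e)
    (h : contract (radial N) ω = 0) :
    contract (radial N) (extD ω) = ((e : ℂ) + (k + 1)) • ω := by
  rw [← diagField_one] at h ⊢
  rw [contract_extD_eq_smul_iff h]
  intro I
  rw [eulerD_apply, diagField_one]
  have := (hω (stdTuple I)).sum_X_mul_pderiv
  simp only [radial, this]
  simp [← Nat.cast_smul_eq_nsmul ℂ]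

/-- Every `(N-1)`-form is the interior product of the volume form with a vector field. -/
theorem exists_contract_vol {N : ℕ} (η : Form (N + 1) N) :
    contract (fun j => (-1 : ℤ) ^ (j : ℕ) • η (stdTuple j.succAbove)) (vol (N + 1)) = η := by
  refine form_ext_stdTuple fun I hI => ?_
  obtain ⟨j, hj⟩ : ∃ j, ∀ i, I i ≠ j := by
    by_contra! hcon
    have := Fintype.card_le_of_surjective I hcon
    simp at this
  have hex : ∀ i, ∃ i', j.succAbove i' = I i := fun i =>
    Fin.exists_succAbove_eq (hj i)
  choose σ hσ using hex
  have hσi : Function.Injective σ := fun a b hab => hI (by rw [← hσ, ← hσ, hab])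
  let τ : Equiv.Perm (Fin N) := Equiv.ofBijective σ (Finite.injective_iff_bijective.1 hσi)
  have hI' : stdTuple I = stdTuple (j.succAbove) ∘ τ := by
    ext i : 1
    simp only [stdTuple, Function.comp, ← hσ]
    rfl
  rw [hI', AlternatingMap.map_perm, AlternatingMap.map_perm]
  congr 1
  rw [contract_apply, Finset.sum_eq_single j]
  · rw [vol_apply]
    have h1 : Matrix.det (Matrix.vecCons (Pi.single j 1) (stdTuple j.succAbove) :
        Fin (N + 1) → Fin (N + 1) → ℂ) = (-1) ^ (j : ℕ) := by
      have h2 : (j.insertNth (Pi.single j 1) (stdTuple j.succAbove) :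
          Fin (N + 1) → Fin (N + 1) → ℂ) = (1 : Matrix (Fin (N + 1)) (Fin (N + 1)) ℂ) := by
        ext a b
        refine Fin.succAboveCases j ?_ (fun a => ?_) a
        · simp [Pi.single_apply, Matrix.one_apply, eq_comm]
        · simp [stdTuple, Pi.single_apply, Matrix.one_apply, eq_comm]
      have h3 := AlternatingMap.map_insertNth
        (Matrix.detRowAlternating : (Fin (N + 1) → ℂ) [⋀^Fin (N + 1)]→ₗ[ℂ] ℂ) j
        (Pi.single j 1) (stdTuple j.succAbove)
      rw [h2] at h3
      have h4 : (1 : ℂ) = (-1 : ℤ) ^ (j : ℕ) • Matrix.det (Matrix.vecCons (Pi.single j 1)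
        (stdTuple j.succAbove) : Fin (N + 1) → Fin (N + 1) → ℂ) :=
        Matrix.det_one.symm.trans h3
      rcases neg_one_pow_eq_or ℤ (j : ℕ) with h | h <;> rcases neg_one_pow_eq_or ℂ (j : ℕ) with h' | h'
      · rw [h, one_smul] at h4; rw [← h4, h']
      · exfalso
        have := congrArg (Int.cast : ℤ → ℂ) h
        push_cast at this
        rw [h'] at this
        norm_num at this
      · exfalso
        have := congrArg (Int.cast : ℤ → ℂ) h
        push_cast at this
        rw [h'] at this
        norm_num at this
      · rw [h, neg_smul, one_smul] at h4; rw [h']; linear_combination h4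
    rw [h1]
    rcases neg_one_pow_eq_or ℤ (j : ℕ) with h | h
    · have h' : (-1 : ℂ) ^ (j : ℕ) = 1 := by exact_mod_cast congrArg (Int.cast : ℤ → ℂ) h
      rw [h, h']; simp
    · have h' : (-1 : ℂ) ^ (j : ℕ) = -1 := by exact_mod_cast congrArg (Int.cast : ℤ → ℂ) h
      rw [h, h']; simp
  · intro i _ hij
    obtain ⟨i', hi'⟩ := Fin.exists_succAbove_eq hij
    have : vol (N + 1) (Matrix.vecCons (Pi.single i 1) (stdTuple j.succAbove)) = 0 := by
      refine AlternatingMap.map_eq_zero_of_eq _ _ (i := 0) (j := i'.succ) ?_ (Fin.succ_ne_zero _).symm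
      simp [stdTuple, hi']
    rw [this, mul_zero]
  · simp


theorem eval_smul_of_isHomogeneous {σ : Type*} [Fintype σ] {f : MvPolynomial σ ℂ} {e : ℕ}
    (hf : f.IsHomogeneous e) (t : ℂ) (x : σ → ℂ) :
    MvPolynomial.eval (t • x) f = t ^ e * MvPolynomial.eval x f := by
  rw [MvPolynomial.eval_eq', MvPolynomial.eval_eq', Finset.mul_sum]
  refine Finset.sum_congr rfl fun a ha => ?_
  have h1 : ∑ i, a i = e := by
    have := hf (MvPolynomial.mem_support_iff.1 ha)
    rwa [Finsupp.weight_apply, Finsupp.sum_fintype _ _ (by simp), Finset.sum_congr rfl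
      (fun i _ => show a i • (1 : σ → ℕ) i = a i by simp)] at this
  simp only [Pi.smul_apply, smul_eq_mul, mul_pow, Finset.prod_mul_distrib]
  rw [Finset.prod_pow_eq_pow_sum, h1]
  ring

/-- The linear part `y ↦ (y, 0)` of the standard affine chart. -/
noncomputable def chartIncl (N : ℕ) : Matrix (Fin (N + 1)) (Fin N) ℂ :=
  (1 : Matrix (Fin (N + 1)) (Fin (N + 1)) ℂ).submatrix id Fin.castSucc

theorem chartIncl_mulVec {N : ℕ} (y : Fin N → ℂ) :
    (chartIncl N).mulVec y = Fin.snoc (α := fun _ => ℂ) y 0 := by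
  ext i
  refine Fin.lastCases ?_ (fun i => ?_) i
  · rw [Fin.snoc_last]
    change ∑ j, (1 : Matrix (Fin (N + 1)) (Fin (N + 1)) ℂ) (Fin.last N) (Fin.castSucc j) * y j = 0
    refine Finset.sum_eq_zero fun j _ => ?_
    rw [Matrix.one_apply_ne (Fin.castSucc_lt_last j).ne', zero_mul]
  · simp [Matrix.mulVec, dotProduct, chartIncl, Matrix.one_apply, Fin.castSucc_inj]

/-- A homogeneous form annihilated by the radial field vanishes if its restriction to the standard
affine chart does. -/
theorem eq_zero_of_affPull_chartIncl {N k e : ℕ} {Θ : Form (N + 1) k}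
    (hΘ : ∀ v, (Θ v).IsHomogeneous e)
    (hR : ∀ x v i, v i = x → formAt x Θ v = 0)
    (h : affPull (chartIncl N) (Pi.single (Fin.last N) 1) Θ = 0) : Θ = 0 := by
  ext1 v
  have hX : (X (Fin.last N) : Poly (N + 1)) ≠ 0 := MvPolynomial.X_ne_zero _
  refine (mul_eq_zero.1 (?_ : X (Fin.last N) * Θ v = 0)).resolve_left hX
  refine MvPolynomial.funext fun x => ?_
  rw [map_mul, MvPolynomial.eval_X, map_zero]
  by_cases ht : x (Fin.last N) = 0
  · rw [ht, zero_mul]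
  set t := x (Fin.last N) with ht'
  let y : Fin N → ℂ := fun j => x j.castSucc / t
  let x' : Fin (N + 1) → ℂ := (chartIncl N).mulVec y + Pi.single (Fin.last N) 1
  have hx : x = t • x' := by
    ext i
    refine Fin.lastCases ?_ (fun i => ?_) i
    · simp [x', chartIncl_mulVec, ht']
    · simp [x', chartIncl_mulVec, y, (Fin.castSucc_lt_last i).ne]
      field_simp
  rw [hx, eval_smul_of_isHomogeneous (hΘ v), ← formAt_apply]
  let w : Fin k → Fin N → ℂ := fun i j => v i j.castSucc - v i (Fin.last N) * y j
  have hw : formAt x' Θ v = formAt x' Θ (fun i => (chartIncl N).mulVec (w i)) := by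
    refine map_eq_map_projection (s := ![x']) ?_ ?_
    · intro u i j hj
      refine hR x' u i ?_
      fin_cases j
      exact hj
    · intro i
      have : v i - (chartIncl N).mulVec (w i) = v i (Fin.last N) • x' := by
        ext j
        refine Fin.lastCases ?_ (fun j => ?_) j
        · simp [x', chartIncl_mulVec]
        · simp [x', chartIncl_mulVec, w, (Fin.castSucc_lt_last j).ne]
      rw [this]
      exact Submodule.smul_mem _ _ (Submodule.subset_span ⟨0, rfl⟩)
  have h0 : formAt x' Θ (fun i => (chartIncl N).mulVec (w i)) = 0 := by
    rw [← formAt_affPull, h, formAt_zero]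
  rw [hw, h0]
  ring

/-- The weights `(p₁, …, pₙ, 0)` on homogeneous coordinates. -/
def extWeights {N : ℕ} (p : Fin N → ℤ) : Fin (N + 1) → ℤ := Fin.snoc (α := fun _ => ℤ) p 0

theorem diagField_chart {N : ℕ} (p : Fin N → ℤ) (y : Fin N → ℂ) :
    (chartIncl N).mulVec (fieldAt y (diagField p)) =
      fieldAt ((chartIncl N).mulVec y + Pi.single (Fin.last N) 1) (diagField (extWeights p)) := by
  rw [fieldAt_diagField, fieldAt_diagField, chartIncl_mulVec, chartIncl_mulVec]
  ext i
  refine Fin.lastCases ?_ (fun i => ?_) i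
  · simp [extWeights]
  · simp [extWeights, (Fin.castSucc_lt_last i).ne]

theorem chartPullback_eq_affPull {N k : ℕ} (A : Matrix (Fin (N + 1)) (Fin (N + 1)) ℂ)
    (ω : Form (N + 1) k) : chartPullback A ω =
      affPull (chartIncl N) (Pi.single (Fin.last N) 1) (affPull A 0 ω) := by
  rw [affPull_affPull, chartPullback_eq, add_zero]
  congr 1
  · ext i j
    simp [chartIncl, Matrix.mul_apply, Matrix.one_apply]
  · ext i
    simp

theorem affPull_homogeneous {N k e : ℕ} (A : Matrix (Fin N) (Fin N) ℂ) {ω : Form N k}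
    (hω : ∀ v, (ω v).IsHomogeneous e) (v : Fin k → Fin N → ℂ) :
    (affPull A 0 ω v).IsHomogeneous e := by
  rw [affPull_apply]
  have := (hω fun i => A.mulVec (v i)).aeval
    (fun i => (∑ j, C (A i j) * X j) + C ((0 : Fin N → ℂ) i) : Fin N → Poly N) (n := 1) (fun i => by
      simpa [linField] using linField_homogeneous A i)
  rwa [one_mul] at this

theorem extD_homogeneous {N k e : ℕ} {ω : Form N k} (hω : ∀ v, (ω v).IsHomogeneous e)
    (v : Fin (k + 1) → Fin N → ℂ) : (extD ω v).IsHomogeneous (e - 1) := by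
  rw [extD_apply]
  refine MvPolynomial.IsHomogeneous.sum _ _ _ fun i _ => ?_
  refine (MvPolynomial.homogeneousSubmodule (Fin N) ℂ (e - 1)).toAddSubgroup.zsmul_mem ?_ _
  rw [dirD_apply]
  refine (MvPolynomial.homogeneousSubmodule (Fin N) ℂ (e - 1)).sum_mem fun j _ => ?_
  exact Submodule.smul_mem _ _ (hω _).pderiv

theorem contract_radial_affPull {N k : ℕ} (A : Matrix (Fin N) (Fin N) ℂ) {ω : Form N (k + 1)}
    (h : contract (radial N) ω = 0) : contract (radial N) (affPull A 0 ω) = 0 := by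
  rw [← linField_one] at h ⊢
  rw [contract_linField_affPull (C := 1) (by simp), h, affPull_zero]

/-- `A` is an adapted frame for a form of weight `κ` with respect to the tuple `p`: in the
coordinates given by `A` the form is annihilated by `S = ∑ pⱼ xⱼ ∂/∂xⱼ`, and `L_S ω = κ ω`. -/
structure IsAdapted {m : ℕ} (A : Matrix (Fin (m + 4)) (Fin (m + 4)) ℂ) (p : Fin (m + 3) → ℤ)
    (κ : ℂ) (ω : Form (m + 4) (m + 1)) : Prop where
  contract_eq_zero : contract (diagField (extWeights p)) (affPull A 0 ω) = 0
  contract_extD : contract (diagField (extWeights p)) (extD (affPull A 0 ω)) = κ • affPull A 0 ω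

/-- The weight of the foliations in `ℱ(𝔓, λ, D)` as homogeneous forms. -/
def formWeight {m : ℕ} (p : Fin (m + 3) → ℤ) (lam : ℤ) : ℤ := lam + ∑ i, p i

theorem sum_extWeights {N : ℕ} (p : Fin N → ℤ) : ∑ i, extWeights p i = ∑ i, p i := by
  rw [Fin.sum_univ_castSucc]
  simp [extWeights]

theorem isAdapted_of_chart {m e : ℕ} {p : Fin (m + 3) → ℤ} {lam : ℤ}
    {A : Matrix (Fin (m + 4)) (Fin (m + 4)) ℂ} {ω : Form (m + 4) (m + 1)}
    (hω : ∀ v, (ω v).IsHomogeneous (e + 1)) (hR : contract (radial _) ω = 0)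
    {Y : VField (m + 3)} (hY : bracket (diagField p) Y = (lam : ℂ) • Y)
    (h : chartPullback A ω = contract (diagField p) (contract Y (vol (m + 3)))) :
    IsAdapted A p (formWeight p lam) ω := by
  set Ω := affPull A 0 ω with hΩ
  have hΩh : ∀ v, (Ω v).IsHomogeneous (e + 1) := affPull_homogeneous A hω
  have hΩR : contract (radial _) Ω = 0 := contract_radial_affPull A hR
  rw [chartPullback_eq_affPull, ← hΩ] at h
  set η := affPull (chartIncl (m + 3)) (Pi.single (Fin.last (m + 3)) 1) Ω with hη
  have h1 : contract (diagField p) η = 0 := by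
    rw [h]; exact contract_contract_self _ _
  have h2 : contract (diagField p) (extD η) = (formWeight p lam : ℂ) • η := by
    rw [contract_extD_eq_smul_iff h1, h]
    have hd : ∀ j, eulerD p (diagField p j) = (0 + p j : ℂ) • diagField p j := by
      intro j
      rw [diagField, ← MvPolynomial.smul_eq_C_mul, Derivation.map_smul, eulerD_X, zero_add]
    have := ((isWeighted_vol p).contract (bracket_eq_smul_iff.1 hY)).contract hd
    convert this using 1
    simp [formWeight]
  have hD := diagField_chart p
  have hdh : ∀ j, (diagField (extWeights p) j).IsHomogeneous 1 := by
    rw [← linField_diagonal]; exact linField_homogeneous _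
  have e1 : contract (diagField (extWeights p)) Ω = 0 := by
    refine eq_zero_of_affPull_chartIncl (contract_homogeneous hdh hΩh) ?_ ?_
    · intro x v i hi
      rw [formAt_contract]
      exact formAt_vecCons_eq_zero hΩR x (i := i.succ) (by simp [hi, fieldAt_radial])
    · rw [← contract_affPull hD, h1]
  refine ⟨e1, ?_⟩
  rw [← sub_eq_zero]
  refine eq_zero_of_affPull_chartIncl (e := e + 1) ?_ ?_ ?_
  · intro v
    have a1 := contract_homogeneous hdh (extD_homogeneous hΩh) v
    rw [Nat.add_sub_cancel, add_comm 1 e] at a1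
    exact (MvPolynomial.homogeneousSubmodule (Fin (m + 4)) ℂ (e + 1)).sub_mem a1
      (Submodule.smul_mem _ _ (hΩh v))
  · intro x v i hi
    refine formAt_vecCons_eq_zero (X := radial (m + 4)) ?_ x (i := i) (by rw [hi, fieldAt_radial])
    have a1 : contract (radial (m + 4)) (contract (diagField (extWeights p)) (extD Ω)) = 0 := by
      rw [contract_contract_comm, contract_radial_extD hΩh hΩR, contract_smul, e1]
      ext1 v; simp
    rw [sub_eq_add_neg, contract_add, contract_neg, a1, contract_smul, ← hΩ, hΩR]
    ext1 v; simp
  · rw [affPull_sub, affPull_smul, ← contract_affPull hD, ← extD_affPull, ← hΩ, ← hη, h2, sub_self]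

theorem exists_chart_of_isAdapted {m e : ℕ} {p : Fin (m + 3) → ℤ} (hp : ∀ i, 0 < p i) {lam : ℤ}
    {A : Matrix (Fin (m + 4)) (Fin (m + 4)) ℂ} {B : Matrix (Fin (m + 4)) (Fin (m + 4)) ℂ}
    (hAB : A * B = 1) {ω : Form (m + 4) (m + 1)} (h0 : ω ≠ 0)
    (hω : ∀ v, (ω v).IsHomogeneous e) (hR : contract (radial _) ω = 0)
    (h : IsAdapted A p (formWeight p lam) ω) :
    ∃ Y : VField (m + 3), bracket (diagField p) Y = (lam : ℂ) • Y ∧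
      chartPullback A ω = contract (diagField p) (contract Y (vol (m + 3))) := by
  obtain ⟨h1, h2⟩ := h
  set Ω := affPull A 0 ω with hΩ
  have hΩh : ∀ v, (Ω v).IsHomogeneous e := affPull_homogeneous A hω
  have hΩR : contract (radial _) Ω = 0 := contract_radial_affPull A hR
  have hΩ0 : Ω ≠ 0 := fun h => h0 (affPull_injective hAB (h.trans (affPull_zero A 0).symm))
  rw [chartPullback_eq_affPull, ← hΩ]
  set η := affPull (chartIncl (m + 3)) (Pi.single (Fin.last (m + 3)) 1) Ω with hη
  have hD := diagField_chart p
  have g1 : contract (diagField p) η = 0 := by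
    rw [hη, contract_affPull hD, h1, affPull_zero]
  have g2 : contract (diagField p) (extD η) = (formWeight p lam : ℂ) • η := by
    rw [hη, extD_affPull, contract_affPull hD, h2, affPull_smul]
  have hη0 : η ≠ 0 := by
    intro h
    refine hΩ0 (eq_zero_of_affPull_chartIncl hΩh ?_ h)
    intro x v i hi
    exact formAt_vecCons_eq_zero hΩR x (i := i) (by rw [hi, fieldAt_radial])
  have hw : IsWeighted p (formWeight p lam) η := (contract_extD_eq_smul_iff g1).1 g2
  have hκ : (formWeight p lam : ℂ) ≠ 0 := by
    have : ∃ I : Fin (m + 1) → Fin (m + 3), η (stdTuple I) ≠ 0 := by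
      by_contra! hcon
      exact hη0 (form_ext_stdTuple fun I _ => by simpa using hcon I)
    obtain ⟨I, hI⟩ := this
    obtain ⟨a, ha⟩ := exists_weight_of_eulerD_eq hI (hw I)
    have h3 : formWeight p lam = ∑ j, p j * a j + ∑ i, p (I i) := by
      have : (formWeight p lam : ℂ) = ((∑ j, p j * a j + ∑ i, p (I i) : ℤ) : ℂ) := by
        push_cast
        rw [← ha]; ring
      exact_mod_cast this
    have h4 : 0 ≤ ∑ j, p j * (a j : ℤ) :=
      Finset.sum_nonneg fun j _ => mul_nonneg (hp j).le (Int.natCast_nonneg _)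
    have h5 : 0 < ∑ i, p (I i) := Finset.sum_pos (fun i _ => hp _) ⟨0, Finset.mem_univ _⟩
    have h6 : formWeight p lam ≠ 0 := by omega
    exact_mod_cast h6
  set θ : Form (m + 3) (m + 2) := ((formWeight p lam : ℂ)⁻¹) • extD η with hθ
  refine ⟨fun j => (-1 : ℤ) ^ (j : ℕ) • θ (stdTuple j.succAbove), ?_, ?_⟩
  · rw [bracket_eq_smul_iff]
    intro j
    have h3 := hw.extD (I := j.succAbove)
    have h4 : ∑ i, (p i : ℂ) = p j + ∑ i : Fin (m + 2), (p (j.succAbove i) : ℂ) :=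
      Fin.sum_univ_succAbove (fun i => (p i : ℂ)) j
    rw [map_zsmul, hθ, AlternatingMap.smul_apply, Derivation.map_smul, h3, smul_comm _ ((-1 : ℤ) ^ _),
      smul_comm (_ : ℂ) ((formWeight p lam : ℂ)⁻¹)]
    congr 3
    rw [formWeight]
    push_cast
    rw [h4]
    ring
  · have h3 := exists_contract_vol θ
    rw [h3, hθ, contract_smul, g2, smul_smul, inv_mul_cancel₀ hκ, one_smul]


theorem mem_AffFoliations_iff {m D : ℕ} {p : Fin (m + 3) → ℤ} (hp : ∀ i, 0 < p i) {lam : ℤ}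
    {F : ℙ ℂ (projForms m (D + 1))} :
    F ∈ AffFoliations m p lam D ↔ F ∈ Foliations m D ∧ ∃ A : GL (Fin (m + 4)) ℂ,
      IsAdapted (A : Matrix (Fin (m + 4)) (Fin (m + 4)) ℂ) p (formWeight p lam)
        (F.rep : Form (m + 4) (m + 1)) := by
  have hmem := F.rep.2
  constructor
  · rintro ⟨hF, A, Y, hY, h⟩
    exact ⟨hF, A, isAdapted_of_chart hmem.1 hmem.2 hY h⟩
  · rintro ⟨hF, A, hA⟩
    refine ⟨hF, A, exists_chart_of_isAdapted (B := ((A⁻¹ : GL (Fin (m + 4)) ℂ) :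
      Matrix (Fin (m + 4)) (Fin (m + 4)) ℂ)) hp ?_ ?_ hmem.1 hmem.2 hA⟩
    · rw [← Units.val_mul, mul_inv_cancel, Units.val_one]
    · exact fun h => F.rep_nonzero (Subtype.ext h)

@[simp] theorem extWeights_last {N : ℕ} (p : Fin N → ℤ) : extWeights p (Fin.last N) = 0 := by
  simp [extWeights]

@[simp] theorem extWeights_castSucc {N : ℕ} (p : Fin N → ℤ) (i : Fin N) :
    extWeights p i.castSucc = p i := by
  simp [extWeights]

theorem extWeights_zero {m : ℕ} (p : Fin (m + 3) → ℤ) : extWeights p 0 = p 0 :=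
  extWeights_castSucc p 0

theorem extWeights_strictAnti {N : ℕ} {p : Fin N → ℤ} (h : StrictAnti p) (hp : ∀ i, 0 < p i) :
    StrictAnti (extWeights p) := by
  intro i j hij
  induction j using Fin.lastCases with
  | last =>
    induction i using Fin.lastCases with
    | last => exact absurd hij (lt_irrefl _)
    | cast i => simpa using hp i
  | cast j =>
    induction i using Fin.lastCases with
    | last => exact absurd hij (not_lt.2 (Fin.le_last _))
    | cast i => simpa using h (Fin.castSucc_lt_castSucc_iff.1 hij)

theorem extWeights_conjTuple {m : ℕ} (p : Fin (m + 3) → ℤ) (i : Fin (m + 4)) :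
    extWeights (conjTuple p) i = p 0 - extWeights p i.rev := by
  induction i using Fin.lastCases with
  | last => rw [extWeights_last, Fin.rev_last, extWeights_zero, sub_self]
  | cast i => rw [extWeights_castSucc]; rfl

theorem sum_conjTuple {m : ℕ} (p : Fin (m + 3) → ℤ) :
    ∑ i, conjTuple p i = (m + 4) * p 0 - ∑ i, p i := by
  rw [← sum_extWeights, ← sum_extWeights p]
  simp only [extWeights_conjTuple, Finset.sum_sub_distrib]
  rw [← Equiv.sum_comp Fin.revPerm (extWeights p)]
  simp [add_assoc]

theorem conjTuple_zero {m : ℕ} (p : Fin (m + 3) → ℤ) : conjTuple p 0 = p 0 := by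
  have := extWeights_conjTuple p 0
  rwa [Fin.rev_zero, extWeights_last, sub_zero, extWeights_zero] at this

theorem conjTuple_conjTuple {m : ℕ} (p : Fin (m + 3) → ℤ) : conjTuple (conjTuple p) = p := by
  ext i
  rw [← extWeights_castSucc (conjTuple (conjTuple p)), extWeights_conjTuple, extWeights_conjTuple,
    conjTuple_zero, Fin.rev_rev, extWeights_castSucc]
  ring

theorem conjWeight_conjWeight {m : ℕ} (p : Fin (m + 3) → ℤ) (lam : ℤ) (d : ℕ) :
    conjWeight (conjTuple p) (conjWeight p lam d) d = lam := by
  simp [conjWeight, conjTuple_zero]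

theorem IsWeightTuple.strictAnti_extWeights {m : ℕ} {p : Fin (m + 3) → ℤ} (hp : IsWeightTuple p) :
    StrictAnti (extWeights p) :=
  extWeights_strictAnti hp.strictAnti hp.pos

theorem IsWeightTuple.conjTuple {m : ℕ} {p : Fin (m + 3) → ℤ} (hp : IsWeightTuple p) :
    IsWeightTuple (conjTuple p) := by
  have hs := hp.strictAnti_extWeights
  refine ⟨fun i j hij => ?_, fun i => ?_, ?_⟩
  · rw [← extWeights_castSucc (AffFoliation.conjTuple p), ← extWeights_castSucc
      (AffFoliation.conjTuple p), extWeights_conjTuple, extWeights_conjTuple]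
    have : extWeights p i.castSucc.rev < extWeights p j.castSucc.rev :=
      hs (Fin.rev_lt_rev.2 (Fin.castSucc_lt_castSucc_iff.2 hij))
    linarith
  · rw [← extWeights_castSucc (AffFoliation.conjTuple p), extWeights_conjTuple,
      ← extWeights_zero p, sub_pos]
    refine hs (Fin.pos_iff_ne_zero.2 fun h => ?_)
    rw [← Fin.rev_last, Fin.rev_inj] at h
    exact (Fin.castSucc_lt_last i).ne h
  · have h1 : ∀ i, Finset.univ.gcd (AffFoliation.conjTuple p) ∣ p 0 - extWeights p i := by
      intro i
      have := extWeights_conjTuple p i.rev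
      rw [Fin.rev_rev] at this
      rw [← this]
      induction i.rev using Fin.lastCases with
      | last => rw [extWeights_last]; exact dvd_zero _
      | cast i => rw [extWeights_castSucc]; exact Finset.gcd_dvd (Finset.mem_univ i)
    have h2 : Finset.univ.gcd (AffFoliation.conjTuple p) ∣ p 0 := by simpa using h1 (Fin.last _)
    have h3 : Finset.univ.gcd (AffFoliation.conjTuple p) ∣ 1 := by
      rw [← hp.gcd_eq_one]
      refine Finset.dvd_gcd fun i _ => ?_
      have := h1 i.castSucc
      rw [extWeights_castSucc] at this
      exact (dvd_sub_right h2).1 this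
    rw [← Finset.normalize_gcd]
    exact normalize_eq_one.2 (isUnit_of_dvd_one h3)

/-- The matrix reversing the coordinates. -/
noncomputable def revMatrix (N : ℕ) : Matrix (Fin N) (Fin N) ℂ :=
  (1 : Matrix (Fin N) (Fin N) ℂ).submatrix Fin.rev id

theorem revMatrix_mul_self (N : ℕ) : revMatrix N * revMatrix N = 1 := by
  ext i j
  rw [Matrix.mul_apply, Finset.sum_eq_single i.rev]
  · simp [revMatrix, Matrix.one_apply]
  · intro k _ hk
    simp [revMatrix, hk.symm]
  · simp

theorem formWeight_conj {m : ℕ} (p : Fin (m + 3) → ℤ) (lam : ℤ) (d : ℕ) :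
    formWeight (conjTuple p) (conjWeight p lam d) = p 0 * (d + m + 3) - formWeight p lam := by
  rw [formWeight, formWeight, sum_conjTuple, conjWeight]
  ring

theorem IsAdapted.conj {m d : ℕ} {p : Fin (m + 3) → ℤ} {lam : ℤ}
    {A : Matrix (Fin (m + 4)) (Fin (m + 4)) ℂ} {ω : Form (m + 4) (m + 1)}
    (hω : ∀ v, (ω v).IsHomogeneous (d + 2)) (hR : contract (radial _) ω = 0)
    (h : IsAdapted A p (formWeight p lam) ω) :
    IsAdapted (A * revMatrix (m + 4)) (conjTuple p)
      (formWeight (conjTuple p) (conjWeight p lam d)) ω := by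
  obtain ⟨h1, h2⟩ := h
  have e : affPull (A * revMatrix (m + 4)) 0 ω = affPull (revMatrix (m + 4)) 0 (affPull A 0 ω) := by
    rw [affPull_affPull, Matrix.mulVec_zero, zero_add]
  set Ω := affPull A 0 ω with hΩ
  have hΩh : ∀ v, (Ω v).IsHomogeneous (d + 2) := affPull_homogeneous A hω
  have hΩR : contract (radial _) Ω = 0 := contract_radial_affPull A hR
  have hC : linField ((p 0 : ℂ) • (1 : Matrix (Fin (m + 4)) (Fin (m + 4)) ℂ) +
      (-1 : ℂ) • Matrix.diagonal fun i => (extWeights p i : ℂ)) =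
      (p 0 : ℂ) • radial (m + 4) + (-1 : ℂ) • diagField (extWeights p) := by
    rw [linField_add, linField_smul, linField_smul, linField_one, linField_diagonal]
  have hJ : revMatrix (m + 4) * Matrix.diagonal (fun i => (extWeights (conjTuple p) i : ℂ)) =
      ((p 0 : ℂ) • (1 : Matrix (Fin (m + 4)) (Fin (m + 4)) ℂ) +
        (-1 : ℂ) • Matrix.diagonal fun i => (extWeights p i : ℂ)) * revMatrix (m + 4) := by
    ext i j
    rw [Matrix.mul_diagonal, add_mul, smul_mul_assoc, smul_mul_assoc, one_mul, Matrix.add_apply,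
      Matrix.smul_apply, Matrix.smul_apply, Matrix.diagonal_mul, extWeights_conjTuple]
    by_cases hij : i.rev = j
    · subst hij
      simp [revMatrix]
      ring
    · simp [revMatrix, hij]
  constructor
  · rw [e, ← linField_diagonal, contract_linField_affPull hJ, hC, contract_field_add,
      contract_field_smul, contract_field_smul, hΩR, h1, smul_zero, smul_zero, add_zero,
      affPull_zero]
  · rw [e, extD_affPull, ← linField_diagonal, contract_linField_affPull hJ, hC, contract_field_add,
      contract_field_smul, contract_field_smul, contract_radial_extD hΩh hΩR, h2, formWeight_conj]
    refine Eq.trans (congrArg (affPull _ 0) ?_) (affPull_smul _ _ _ _)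
    ext1 v
    simp only [AlternatingMap.smul_apply, smul_smul, ← add_smul]
    refine congrArg (fun c : ℂ => c • Ω v) ?_
    push_cast
    ring

theorem AffFoliations_conj_subset {m d : ℕ} {p : Fin (m + 3) → ℤ} (hp : IsWeightTuple p)
    (lam : ℤ) : AffFoliations m p lam (d + 1) ⊆
      AffFoliations m (conjTuple p) (conjWeight p lam d) (d + 1) := by
  intro F hF
  rw [mem_AffFoliations_iff hp.pos] at hF
  rw [mem_AffFoliations_iff hp.conjTuple.pos]
  obtain ⟨hF, A, hA⟩ := hF
  refine ⟨hF, A * ⟨revMatrix _, revMatrix _, revMatrix_mul_self _, revMatrix_mul_self _⟩, ?_⟩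
  exact hA.conj F.rep.2.1 F.rep.2.2

theorem AffFoliations_conj {m d : ℕ} {p : Fin (m + 3) → ℤ} (hp : IsWeightTuple p) (lam : ℤ) :
    AffFoliations m (conjTuple p) (conjWeight p lam d) (d + 1) =
      AffFoliations m p lam (d + 1) := by
  refine Set.Subset.antisymm ?_ (AffFoliations_conj_subset hp lam)
  have := AffFoliations_conj_subset (d := d) hp.conjTuple (conjWeight p lam d)
  rwa [conjTuple_conjTuple, conjWeight_conjWeight] at this


/-- Homogeneous forms that define foliations on `ℙⁿ`, without the integrability condition. -/
structure IsFoliationForm {m : ℕ} (d : ℕ) (ω : Form (m + 4) (m + 1)) : Prop where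
  ne_zero : ω ≠ 0
  homogeneous : ∀ v, (ω v).IsHomogeneous (d + 2)
  contract_radial : contract (radial _) ω = 0
  sing : SingCodimGeTwo ω

/-- The diagonal matrix with entries `(p₁, …, pₙ, 0)`. -/
noncomputable def weightMatrix {m : ℕ} (p : Fin (m + 3) → ℤ) :
    Matrix (Fin (m + 4)) (Fin (m + 4)) ℂ :=
  Matrix.diagonal fun i => (extWeights p i : ℂ)

theorem linField_weightMatrix {m : ℕ} (p : Fin (m + 3) → ℤ) :
    linField (weightMatrix p) = diagField (extWeights p) := linField_diagonal _

theorem IsWeightTuple.cast_injective {m : ℕ} {p : Fin (m + 3) → ℤ} (hp : IsWeightTuple p) :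
    Function.Injective fun i => (extWeights p i : ℂ) := fun _ _ hij =>
  hp.strictAnti_extWeights.injective (Int.cast_injective (α := ℂ) hij)

theorem affPull_tripleForm {m : ℕ} {A C Z D Y : Matrix (Fin (m + 4)) (Fin (m + 4)) ℂ}
    (hC : A * D = C * A) (hZ : A * Y = Z * A) :
    affPull A 0 (tripleForm C Z) = A.det • tripleForm D Y := by
  refine form_ext fun x v => ?_
  have key : ∀ M : Matrix (Fin (m + 4)) (Fin (m + 4)) ℂ,
      Matrix.det (fun i => A.mulVec (M i)) = A.det * M.det := fun M => by
    rw [mul_comm, ← Matrix.det_transpose A, ← Matrix.det_mul]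
    congr 1
    ext i j
    simp [Matrix.mul_apply, Matrix.mulVec, dotProduct, mul_comm]
  rw [formAt_smul, formAt_affPull, formAt_tripleForm, formAt_tripleForm, add_zero,
    Matrix.mulVec_mulVec, Matrix.mulVec_mulVec, ← hC, ← hZ, ← Matrix.mulVec_mulVec,
    ← Matrix.mulVec_mulVec]
  refine Eq.trans (congrArg Matrix.det ?_) (key _)
  ext i j
  refine Fin.cases ?_ (fun i => Fin.cases ?_ (fun i => Fin.cases ?_ (fun i => ?_) i) i) i <;> rfl

theorem eulerD_C_mul_X {N : ℕ} (p : Fin N → ℤ) (c : ℂ) (t : Fin N) :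
    eulerD p (C c * X t) = C c * (C (p t : ℂ) * X t) := by
  rw [← MvPolynomial.smul_eq_C_mul, Derivation.map_smul, eulerD_X, MvPolynomial.smul_eq_C_mul,
    MvPolynomial.smul_eq_C_mul]

/-- The Lie derivative of the interior product with a linear field. -/
theorem eulerD_contract_linField {N k : ℕ} {p : Fin N → ℤ} {κ : ℂ} {ω : Form N (k + 1)}
    (hω : IsWeighted p κ ω) (Z : Matrix (Fin N) (Fin N) ℂ) (I : Fin k → Fin N) :
    eulerD p (contract (linField Z) ω (stdTuple I)) =
      (κ - ∑ i, (p (I i) : ℂ)) • contract (linField Z) ω (stdTuple I) +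
        contract (linField (Z * Matrix.diagonal (fun i => (p i : ℂ)) -
          Matrix.diagonal (fun i => (p i : ℂ)) * Z)) ω (stdTuple I) := by
  simp only [contract_apply, map_sum, Finset.smul_sum]
  rw [← Finset.sum_add_distrib]
  refine Finset.sum_congr rfl fun j _ => ?_
  rw [vecCons_stdTuple, Derivation.leibniz, hω, Fin.sum_univ_succ]
  simp only [linField, map_sum, Matrix.cons_val_zero, Matrix.cons_val_succ, smul_eq_mul,
    MvPolynomial.smul_eq_C_mul, Matrix.sub_apply, Matrix.mul_diagonal, Matrix.diagonal_mul,
    Finset.mul_sum, Finset.sum_mul]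
  rw [← Finset.sum_add_distrib, ← Finset.sum_add_distrib]
  refine Finset.sum_congr rfl fun t _ => ?_
  rw [eulerD_C_mul_X]
  simp only [C_add, C_sub, C_mul]
  ring

theorem eulerD_contract {N k : ℕ} {p : Fin N → ℤ} {κ : ℂ} {ω η : Form N (k + 1)}
    (hω : ∀ I : Fin (k + 1) → Fin N, eulerD p (ω (stdTuple I)) =
      (κ - ∑ i, (p (I i) : ℂ)) • ω (stdTuple I) + η (stdTuple I))
    {Y : VField N} (hY : ∀ j, eulerD p (Y j) = (p j : ℂ) • Y j) (I : Fin k → Fin N) :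
    eulerD p (contract Y ω (stdTuple I)) =
      (κ - ∑ i, (p (I i) : ℂ)) • contract Y ω (stdTuple I) + contract Y η (stdTuple I) := by
  simp only [contract_apply, map_sum, Finset.smul_sum]
  rw [← Finset.sum_add_distrib]
  refine Finset.sum_congr rfl fun j _ => ?_
  rw [vecCons_stdTuple, Derivation.leibniz, hω, hY, Fin.sum_univ_succ]
  simp only [Matrix.cons_val_zero, Matrix.cons_val_succ, smul_eq_mul,
    MvPolynomial.smul_eq_C_mul, C_add, C_sub]
  ring

theorem eulerD_tripleForm {m : ℕ} (p : Fin (m + 3) → ℤ)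
    (Z : Matrix (Fin (m + 4)) (Fin (m + 4)) ℂ) (I : Fin (m + 1) → Fin (m + 4)) :
    eulerD (extWeights p) (tripleForm (weightMatrix p) Z (stdTuple I)) =
      (∑ i, (extWeights p i : ℂ) - ∑ i, (extWeights p (I i) : ℂ)) •
        tripleForm (weightMatrix p) Z (stdTuple I) +
      tripleForm (weightMatrix p) (Z * weightMatrix p - weightMatrix p * Z) (stdTuple I) := by
  have hR : ∀ j, eulerD (extWeights p) (radial (m + 4) j) = (extWeights p j : ℂ) • radial _ j :=
    fun j => eulerD_X _ _
  have hD : ∀ j, eulerD (extWeights p) (linField (weightMatrix p) j) =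
      (extWeights p j : ℂ) • linField (weightMatrix p) j := by
    intro j
    rw [linField_weightMatrix, diagField, ← MvPolynomial.smul_eq_C_mul, Derivation.map_smul,
      eulerD_X]
  exact eulerD_contract (eulerD_contract
    (eulerD_contract_linField (isWeighted_vol (extWeights p)) Z) hD) hR I

variable {m d : ℕ} {p : Fin (m + 3) → ℤ} {lam : ℤ} {ω : Form (m + 4) (m + 1)}
  {A B : Matrix (Fin (m + 4)) (Fin (m + 4)) ℂ}

theorem mul_weightMatrix_mul (hBA : B * A = 1) :
    A * weightMatrix p = A * weightMatrix p * B * A := by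
  rw [mul_assoc (A * _), hBA, mul_one]

theorem conj_mul_self (hAB : A * B = 1) (Z : Matrix (Fin (m + 4)) (Fin (m + 4)) ℂ) :
    A * (B * Z * A) = Z * A := by
  rw [← mul_assoc, ← mul_assoc, hAB, one_mul]

theorem IsAdapted.mem_tangentFields {κ : ℂ} (hAB : A * B = 1) (hBA : B * A = 1)
    (h : IsAdapted A p κ ω) : A * weightMatrix p * B ∈ tangentFields ω := by
  rw [AffFoliation.mem_tangentFields]
  apply affPull_injective hAB
  rw [affPull_zero, ← contract_linField_affPull (mul_weightMatrix_mul hBA), linField_weightMatrix]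
  exact h.contract_eq_zero

theorem IsAdapted.contract_extD_conj {κ : ℂ} (hAB : A * B = 1) (hBA : B * A = 1)
    (h : IsAdapted A p κ ω) : contract (linField (A * weightMatrix p * B)) (extD ω) = κ • ω := by
  apply affPull_injective hAB
  rw [affPull_smul, ← contract_linField_affPull (mul_weightMatrix_mul hBA), linField_weightMatrix,
    ← extD_affPull]
  exact h.contract_extD

theorem IsFoliationForm.one_mem (h : IsFoliationForm d ω) :
    (1 : Matrix (Fin (m + 4)) (Fin (m + 4)) ℂ) ∈ tangentFields ω := by
  rw [AffFoliation.mem_tangentFields, linField_one]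
  exact h.contract_radial

theorem eq_combination_of_conj (hAB : A * B = 1)
    {Z W : Matrix (Fin (m + 4)) (Fin (m + 4)) ℂ} {a b : ℂ}
    (h : B * Z * A = a • (1 : Matrix (Fin (m + 4)) (Fin (m + 4)) ℂ) + b • W) :
    Z = a • (1 : Matrix (Fin (m + 4)) (Fin (m + 4)) ℂ) + b • (A * W * B) := by
  have h1 : A * (B * Z * A) * B = Z := by rw [conj_mul_self hAB, mul_assoc, hAB, mul_one]
  rw [← h1, h]
  simp [mul_add, add_mul, hAB]

theorem eq_combination_of_tripleForm_conj (hp : IsWeightTuple p) (hAB : A * B = 1)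
    (hBA : B * A = 1) {Z : Matrix (Fin (m + 4)) (Fin (m + 4)) ℂ}
    (h : tripleForm (A * weightMatrix p * B) Z = 0) :
    ∃ a b : ℂ, Z = a • (1 : Matrix (Fin (m + 4)) (Fin (m + 4)) ℂ) +
      b • (A * weightMatrix p * B) := by
  have h1 := affPull_tripleForm (mul_weightMatrix_mul (p := p) hBA) (conj_mul_self hAB Z)
  have hdet : A.det ≠ 0 := by
    intro h0
    have := congrArg Matrix.det hAB
    rw [Matrix.det_mul, h0, zero_mul, Matrix.det_one] at this
    exact zero_ne_one this
  rw [h, affPull_zero] at h1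
  have h2 : tripleForm (weightMatrix p) (B * Z * A) = 0 := by
    have := congrArg (fun η => A.det⁻¹ • η) h1.symm
    simpa [smul_smul, inv_mul_cancel₀ hdet] using this
  obtain ⟨a, b, hab⟩ := eq_combination_of_tripleForm_eq_zero hp.cast_injective h2
  exact ⟨a, b, eq_combination_of_conj hAB hab⟩

/-- The tangent algebra is normalized by the adapted field. -/
theorem IsAdapted.commutator (hd : 1 ≤ d) (hω : IsFoliationForm d ω) (hp : IsWeightTuple p)
    (hAB : A * B = 1) (hBA : B * A = 1) (h : IsAdapted A p (formWeight p lam) ω)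
    {Z : Matrix (Fin (m + 4)) (Fin (m + 4)) ℂ} (hZ : Z ∈ tangentFields ω) :
    ∃ a b : ℂ, B * Z * A * weightMatrix p - weightMatrix p * (B * Z * A) - (lam : ℂ) • (B * Z * A) =
      a • (1 : Matrix (Fin (m + 4)) (Fin (m + 4)) ℂ) + b • weightMatrix p := by
  obtain ⟨c, hc, -⟩ := tripleForm_eq_smul hd hω.ne_zero hω.homogeneous hω.sing hω.contract_radial
    (h.mem_tangentFields hAB hBA) hZ
  have h1 := affPull_tripleForm (mul_weightMatrix_mul (p := p) hBA) (conj_mul_self hAB Z)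
  have hdet : A.det ≠ 0 := by
    intro h0
    have := congrArg Matrix.det hAB
    rw [Matrix.det_mul, h0, zero_mul, Matrix.det_one] at this
    exact zero_ne_one this
  rw [hc, affPull_smul] at h1
  have h2 : tripleForm (weightMatrix p) (B * Z * A) = (A.det⁻¹ * c) • affPull A 0 ω := by
    rw [← smul_smul, h1, smul_smul, inv_mul_cancel₀ hdet, one_smul]
  have h3 : IsWeighted (extWeights p) (formWeight p lam) (affPull A 0 ω) :=
    (contract_extD_eq_smul_iff h.contract_eq_zero).1 h.contract_extD
  set Y := B * Z * A
  refine eq_combination_of_tripleForm_eq_zero hp.cast_injective ?_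
  change tripleForm (weightMatrix p) _ = 0
  rw [tripleForm_sub, tripleForm_smul]
  refine form_ext_stdTuple fun I _ => ?_
  have h4 := eulerD_tripleForm p Y I
  have h5 : eulerD (extWeights p) (tripleForm (weightMatrix p) Y (stdTuple I)) =
      (formWeight p lam - ∑ i, (extWeights p (I i) : ℂ)) •
        tripleForm (weightMatrix p) Y (stdTuple I) := by
    rw [h2, AlternatingMap.smul_apply, Derivation.map_smul, h3 I, smul_comm]
  rw [h5] at h4
  have h6 : (formWeight p lam : ℂ) = lam + ∑ i, (extWeights p i : ℂ) := by
    rw [formWeight, ← sum_extWeights]; push_cast; rfl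
  rw [h6] at h4
  rw [AlternatingMap.sub_apply, AlternatingMap.smul_apply, AlternatingMap.zero_apply]
  simp only [sub_smul, add_smul] at h4
  rw [sub_eq_zero]
  linear_combination -h4

theorem linearIndependent_one_conj (hp : IsWeightTuple p) (hBA : B * A = 1) :
    LinearIndependent ℂ ![(1 : Matrix (Fin (m + 4)) (Fin (m + 4)) ℂ), A * weightMatrix p * B] := by
  rw [LinearIndependent.pair_iff]
  intro s t hst
  have h1 : s • (1 : Matrix (Fin (m + 4)) (Fin (m + 4)) ℂ) + t • weightMatrix p = 0 := by
    have := congrArg (fun M => B * M * A) hst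
    simp only [mul_add, add_mul, Matrix.mul_smul, Matrix.smul_mul, mul_one, hBA, mul_zero,
      zero_mul] at this
    rw [← this]
    congr 2
    rw [mul_assoc, mul_assoc, mul_assoc, hBA, mul_one, ← mul_assoc, hBA, one_mul]
  have h2 : ∀ i, s + t * (extWeights p i : ℂ) = 0 := by
    intro i
    have := congrFun (congrFun h1 i) i
    simpa [weightMatrix] using this
  have h3 : t * ((extWeights p 0 : ℂ) - extWeights p 1) = 0 := by
    linear_combination h2 0 - h2 1
  have h4 : (extWeights p 0 : ℂ) - extWeights p 1 ≠ 0 :=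
    sub_ne_zero.2 fun h => absurd (hp.cast_injective h) (by simp)
  have h5 : t = 0 := (mul_eq_zero.1 h3).resolve_right h4
  refine ⟨?_, h5⟩
  simpa [h5] using h2 0

/-- The tangent algebra of an element of `ℱ(𝔓, λ)` has dimension two or three. -/
theorem IsAdapted.tangentFields_cases (hd : 1 ≤ d) (hω : IsFoliationForm d ω)
    (hp : IsWeightTuple p) (hAB : A * B = 1) (hBA : B * A = 1) {κ : ℂ} (h : IsAdapted A p κ ω) :
    (Module.finrank ℂ (tangentFields ω) = 2 ∧ ∀ Z ∈ tangentFields ω,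
      ∃ a b : ℂ, Z = a • (1 : Matrix (Fin (m + 4)) (Fin (m + 4)) ℂ) +
        b • (A * weightMatrix p * B)) ∨
    (Module.finrank ℂ (tangentFields ω) = 3 ∧ d = 1 ∧ ∃ Y ∈ tangentFields ω,
      (∀ a b : ℂ, Y ≠ a • (1 : Matrix (Fin (m + 4)) (Fin (m + 4)) ℂ) +
        b • (A * weightMatrix p * B)) ∧ ∀ Z ∈ tangentFields ω,
      ∃ a b c : ℂ, Z = a • (1 : Matrix (Fin (m + 4)) (Fin (m + 4)) ℂ) +
        b • (A * weightMatrix p * B) + c • Y) := by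
  set C := A * weightMatrix p * B with hC
  have hCm : C ∈ tangentFields ω := h.mem_tangentFields hAB hBA
  have h1m : (1 : Matrix (Fin (m + 4)) (Fin (m + 4)) ℂ) ∈ tangentFields ω := hω.one_mem
  have hli := linearIndependent_one_conj (A := A) hp hBA
  rw [← hC] at hli
  by_cases hall : ∀ Z ∈ tangentFields ω,
      ∃ a b : ℂ, Z = a • (1 : Matrix (Fin (m + 4)) (Fin (m + 4)) ℂ) + b • C
  · left
    refine ⟨?_, hall⟩
    have : tangentFields ω = Submodule.span ℂ (Set.range ![1, C]) := by
      refine le_antisymm (fun Z hZ => ?_) ?_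
      · obtain ⟨a, b, rfl⟩ := hall Z hZ
        exact Submodule.add_mem _ (Submodule.smul_mem _ _ (Submodule.subset_span ⟨0, rfl⟩))
          (Submodule.smul_mem _ _ (Submodule.subset_span ⟨1, rfl⟩))
      · rw [Submodule.span_le]
        rintro _ ⟨i, rfl⟩
        fin_cases i
        · exact h1m
        · exact hCm
    rw [this, finrank_span_eq_card hli, Fintype.card_fin]
  · right
    push Not at hall
    obtain ⟨Y, hY, hYne⟩ := hall
    have htr : ∀ Z ∈ tangentFields ω, ∃ c : ℂ, tripleForm C Z = c • ω ∧ (c ≠ 0 → d = 1) :=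
      fun Z hZ => tripleForm_eq_smul hd hω.ne_zero hω.homogeneous hω.sing hω.contract_radial
        hCm hZ
    obtain ⟨y, hy, hyd⟩ := htr Y hY
    have hy0 : y ≠ 0 := by
      rintro rfl
      obtain ⟨a, b, hab⟩ := eq_combination_of_tripleForm_conj hp hAB hBA
        (hy.trans (zero_smul ℂ ω))
      exact hYne a b hab
    have hspan : ∀ Z ∈ tangentFields ω, ∃ a b c : ℂ,
        Z = a • (1 : Matrix (Fin (m + 4)) (Fin (m + 4)) ℂ) + b • C + c • Y := by
      intro Z hZ
      obtain ⟨c, hc, -⟩ := htr Z hZ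
      have h0 : tripleForm C (Z - (c / y) • Y) = 0 := by
        rw [tripleForm_sub, tripleForm_smul, hc, hy, smul_smul, div_mul_cancel₀ _ hy0, sub_self]
      obtain ⟨a, b, hab⟩ := eq_combination_of_tripleForm_conj hp hAB hBA h0
      exact ⟨a, b, c / y, by rw [← hab, sub_add_cancel]⟩
    refine ⟨?_, hyd hy0, Y, hY, hYne, hspan⟩
    have hli3 : LinearIndependent ℂ ![Y, 1, C] := by
      refine linearIndependent_finCons.2 ⟨hli, fun hmem => ?_⟩
      rw [Matrix.range_cons, Matrix.range_cons, Matrix.range_empty, Set.union_empty,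
        Set.singleton_union, Submodule.mem_span_pair] at hmem
      obtain ⟨a, b, hab⟩ := hmem
      exact hYne a b hab.symm
    have : tangentFields ω = Submodule.span ℂ (Set.range ![Y, 1, C]) := by
      refine le_antisymm (fun Z hZ => ?_) ?_
      · obtain ⟨a, b, c, rfl⟩ := hspan Z hZ
        exact Submodule.add_mem _ (Submodule.add_mem _
          (Submodule.smul_mem _ _ (Submodule.subset_span ⟨1, rfl⟩))
          (Submodule.smul_mem _ _ (Submodule.subset_span ⟨2, rfl⟩)))
          (Submodule.smul_mem _ _ (Submodule.subset_span ⟨0, rfl⟩))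
      · rw [Submodule.span_le]
        rintro _ ⟨i, rfl⟩
        fin_cases i
        · exact hY
        · exact h1m
        · exact hCm
    rw [this, finrank_span_eq_card hli3, Fintype.card_fin]

end AffFoliation

namespace AffFoliation

section Invariants

open Polynomial

variable {n : Type*} [Fintype n] [DecidableEq n] {R S : Type*} [CommRing R] [CommRing S]

/-- A multiple of the traceless part of a matrix. -/
def traceless (x : Matrix n n R) : Matrix n n R := (Fintype.card n : R) • x - x.trace • 1

/-- The coefficients of the characteristic polynomial of the traceless part. -/
noncomputable def specCoeff (i : ℕ) (x : Matrix n n R) : R := (traceless x).charpolyRev.coeff i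

/-- The trace form of the traceless part. -/
noncomputable def traceSq (x : Matrix n n R) : R := (traceless x * traceless x).trace

theorem traceless_map (f : R →+* S) (x : Matrix n n R) :
    traceless (x.map f) = (traceless x).map f := by
  ext i j
  simp [traceless, Matrix.trace, Matrix.one_apply, apply_ite f]

theorem charpolyRev_map (f : R →+* S) (x : Matrix n n R) :
    (x.map f).charpolyRev = x.charpolyRev.map f := by
  rw [Matrix.charpolyRev, Matrix.charpolyRev, ← Polynomial.coe_mapRingHom, RingHom.map_det]
  congr 1
  ext i j : 1
  simp [Matrix.one_apply, apply_ite (Polynomial.map f)]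

theorem specCoeff_map (f : R →+* S) (i : ℕ) (x : Matrix n n R) :
    specCoeff i (x.map f) = f (specCoeff i x) := by
  rw [specCoeff, traceless_map, charpolyRev_map, Polynomial.coeff_map]; rfl

theorem traceSq_map (f : R →+* S) (x : Matrix n n R) : traceSq (x.map f) = f (traceSq x) := by
  rw [traceSq, traceless_map, ← Matrix.map_mul, traceSq, AddMonoidHom.map_trace]

theorem charpolyRev_smul (b : R) (x : Matrix n n R) :
    (b • x).charpolyRev = x.charpolyRev.comp (C b * X) := by
  rw [Matrix.charpolyRev, Matrix.charpolyRev, ← Polynomial.coe_compRingHom_apply,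
    RingHom.map_det]
  congr 1
  ext i j : 1
  simp only [Matrix.sub_apply, Matrix.smul_apply, Matrix.map_apply, RingHom.mapMatrix_apply,
    smul_eq_mul, map_sub, map_mul, Polynomial.coe_compRingHom_apply, Polynomial.X_comp,
    Polynomial.C_comp, Matrix.one_apply]
  split_ifs <;> simp only [Polynomial.one_comp, Polynomial.zero_comp] <;> ring

theorem traceless_add_smul (a b : R) (x : Matrix n n R) :
    traceless (a • (1 : Matrix n n R) + b • x) = b • traceless x := by
  ext i j
  simp [traceless, Matrix.trace_add, Matrix.trace_smul, Matrix.one_apply]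
  split_ifs <;> ring

theorem specCoeff_add_smul (a b : R) (x : Matrix n n R) (i : ℕ) :
    specCoeff i (a • (1 : Matrix n n R) + b • x) = b ^ i * specCoeff i x := by
  rw [specCoeff, traceless_add_smul, charpolyRev_smul, Polynomial.comp_C_mul_X_coeff, specCoeff,
    mul_comm]

theorem traceSq_add_smul (a b : R) (x : Matrix n n R) :
    traceSq (a • (1 : Matrix n n R) + b • x) = b ^ 2 * traceSq x := by
  rw [traceSq, traceless_add_smul, smul_mul_smul_comm, Matrix.trace_smul, smul_eq_mul, traceSq, sq]

theorem specCoeff_zero (x : Matrix n n R) : specCoeff 0 x = 1 := by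
  rw [specCoeff, Polynomial.coeff_zero_eq_eval_zero, Matrix.eval_charpolyRev]

theorem specCoeff_one (x : Matrix n n R) : specCoeff 1 x = 0 := by
  rw [specCoeff, Matrix.coeff_charpolyRev_eq_neg_trace]
  simp [traceless, mul_comm]

theorem traceless_conj {A B : Matrix n n R} (hAB : A * B = 1) (x : Matrix n n R) :
    traceless (A * x * B) = A * traceless x * B := by
  have : (A * x * B).trace = x.trace := by
    rw [Matrix.trace_mul_comm, ← mul_assoc, mul_eq_one_comm.1 hAB, one_mul]
  rw [traceless, traceless, this, mul_sub, sub_mul]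
  simp [hAB]

theorem charpoly_conj {A B : Matrix n n R} (hAB : A * B = 1) (x : Matrix n n R) :
    (A * x * B).charpoly = x.charpoly := by
  rw [mul_assoc, Matrix.charpoly_mul_comm, mul_assoc, mul_eq_one_comm.1 hAB, mul_one]

theorem specCoeff_conj {A B : Matrix n n R} (hAB : A * B = 1) (x : Matrix n n R) (i : ℕ) :
    specCoeff i (A * x * B) = specCoeff i x := by
  rw [specCoeff, traceless_conj hAB, ← Matrix.reverse_charpoly, charpoly_conj hAB,
    Matrix.reverse_charpoly, specCoeff]

theorem traceSq_conj {A B : Matrix n n R} (hAB : A * B = 1) (x : Matrix n n R) :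
    traceSq (A * x * B) = traceSq x := by
  have hBA := mul_eq_one_comm.1 hAB
  rw [traceSq, traceless_conj hAB, traceSq]
  have : A * traceless x * B * (A * traceless x * B) = A * (traceless x * traceless x * B) := by
    rw [mul_assoc (A * traceless x), ← mul_assoc B, ← mul_assoc B, hBA, one_mul]
    simp only [mul_assoc]
  rw [this, Matrix.trace_mul_comm, mul_assoc, hBA, mul_one]

theorem charpoly_eq_of_charpolyRev_eq [Nontrivial R] {x y : Matrix n n R}
    (h : x.charpolyRev = y.charpolyRev) : x.charpoly = y.charpoly := by
  rw [← Matrix.reverse_charpoly, ← Matrix.reverse_charpoly, Polynomial.reverse, Polynomial.reverse,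
    Matrix.charpoly_natDegree_eq_dim, Matrix.charpoly_natDegree_eq_dim] at h
  have := congrArg (Polynomial.reflect (Fintype.card n)) h
  rwa [Polynomial.reflect_reflect, Polynomial.reflect_reflect] at this

theorem exists_perm_of_map_eq {ι α : Type*} [Fintype ι] [DecidableEq α] {f g : ι → α}
    (h : Finset.univ.val.map f = Finset.univ.val.map g) : ∃ σ : Equiv.Perm ι, ∀ i, f i = g (σ i) := by
  have hc : ∀ y, Nonempty ({i // f i = y} ≃ {i // g i = y}) := by
    intro y
    refine ⟨Fintype.equivOfCardEq ?_⟩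
    have := congrArg (Multiset.count y) h
    rw [Multiset.count_map, Multiset.count_map] at this
    rw [Fintype.card_subtype, Fintype.card_subtype]
    simpa [Finset.card, Finset.filter_val, eq_comm] using this
  let e : ∀ y, {i // f i = y} ≃ {i // g i = y} := fun y => (hc y).some
  refine ⟨(Equiv.sigmaFiberEquiv f).symm.trans
    ((Equiv.sigmaCongrRight e).trans (Equiv.sigmaFiberEquiv g)), fun i => ?_⟩
  exact (e (f i) ⟨i, rfl⟩).2.symm

theorem traceless_diagonal (x : n → R) :
    traceless (Matrix.diagonal x) =
      Matrix.diagonal fun i => (Fintype.card n : R) * x i - ∑ j, x j := by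
  ext i j
  by_cases h : i = j
  · subst h; simp [traceless, Matrix.trace]
  · simp [traceless, h]

/-- Diagonal matrices with proportional invariants have proportional traceless parts up to a
permutation. -/
theorem exists_perm_of_specCoeff {x y : n → ℂ} {t : ℂ}
    (h : ∀ i, specCoeff i (Matrix.diagonal x) = t ^ i * specCoeff i (Matrix.diagonal y)) :
    ∃ σ : Equiv.Perm n, ∀ i, (Fintype.card n : ℂ) * x i - ∑ j, x j =
      t * ((Fintype.card n : ℂ) * y (σ i) - ∑ j, y j) := by
  classical
  have h1 : (traceless (Matrix.diagonal x)).charpolyRev =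
      (t • traceless (Matrix.diagonal y)).charpolyRev := by
    ext i
    rw [charpolyRev_smul, Polynomial.comp_C_mul_X_coeff, mul_comm]
    exact h i
  have h2 := charpoly_eq_of_charpolyRev_eq h1
  rw [traceless_diagonal, traceless_diagonal, ← Matrix.diagonal_smul, Matrix.charpoly_diagonal,
    Matrix.charpoly_diagonal] at h2
  have h3 := congrArg Polynomial.roots h2
  have h4 : ∀ f : n → ℂ, (∏ i, (X - C (f i))).roots = Finset.univ.val.map f := by
    intro f
    rw [← Polynomial.roots_multiset_prod_X_sub_C (Finset.univ.val.map f), Multiset.map_map]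
    rfl
  rw [h4, h4] at h3
  exact exists_perm_of_map_eq h3

end Invariants

section Ray

/-- If the quadratic relations between homogeneous invariants hold, then the invariants lie on a
common ray. -/
theorem exists_ray {u γ : ℕ → ℂ} {e q qL : ℂ} (he : e ≠ 0) (hqL : qL ≠ 0) (hu : u 0 = e)
    (hγ : γ 0 = 1)
    (h : ∀ i j, Even (i + j) →
      u i * u j * qL ^ ((i + j) / 2) = γ i * γ j * e ^ 2 * q ^ ((i + j) / 2)) :
    ∃ t : ℂ, ∀ i, u i = e * (t ^ i * γ i) := by
  obtain ⟨s, hs⟩ := IsAlgClosed.exists_pow_nat_eq (q / qL) (n := 2) (by norm_num)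
  have h' : ∀ i j, Even (i + j) → u i * u j = (e * (s ^ i * γ i)) * (e * (s ^ j * γ j)) := by
    intro i j hij
    have h1 := h i j hij
    have h2 : s ^ (i + j) = (q / qL) ^ ((i + j) / 2) := by
      rw [← hs, ← pow_mul, Nat.mul_div_cancel' hij.two_dvd]
    rw [div_pow] at h2
    have h3 : qL ^ ((i + j) / 2) ≠ 0 := pow_ne_zero _ hqL
    have h4 : u i * u j = γ i * γ j * e ^ 2 * (q ^ ((i + j) / 2) / qL ^ ((i + j) / 2)) := by
      field_simp
      linear_combination h1
    rw [h4, ← h2, pow_add]; ring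
  have heven : ∀ i, Even i → u i = e * (s ^ i * γ i) := by
    intro i hi
    have := h' i 0 (by simpa using hi)
    rw [hu, hγ] at this
    apply mul_right_cancel₀ he
    rw [this]; ring
  by_cases hodd : ∀ j, Odd j → u j = e * (s ^ j * γ j)
  · exact ⟨s, fun i => (Nat.even_or_odd i).elim (heven i) (hodd i)⟩
  · push Not at hodd
    obtain ⟨j, hj, hne⟩ := hodd
    have h1 : u j = -(e * (s ^ j * γ j)) := by
      have := h' j j ⟨j, rfl⟩
      exact (mul_self_eq_mul_self_iff.1 this).resolve_left hne
    have h2 : u j ≠ 0 := by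
      intro h0
      rw [h0] at h1 hne
      exact hne (neg_eq_zero.1 h1.symm).symm
    refine ⟨-s, fun i => ?_⟩
    rcases Nat.even_or_odd i with hi | hi
    · rw [hi.neg_pow, heven i hi]
    · rw [hi.neg_pow]
      have := h' i j (hi.add_odd hj)
      apply mul_right_cancel₀ h2
      linear_combination this + (e * (s ^ i * γ i)) * h1

end Ray

section Weights

variable {m : ℕ}

theorem eq_of_proportional {p l : Fin (m + 3) → ℤ} (hp : IsWeightTuple p) (hl : IsWeightTuple l)
    {α β : ℤ} (hα : 0 < α) (hβ : 0 < β) (σ : Equiv.Perm (Fin (m + 4)))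
    (h : ∀ i j, β * (extWeights p i - extWeights p j) =
      α * (extWeights l (σ i) - extWeights l (σ j))) : l = p ∧ α = β := by
  have hmono : StrictMono σ := by
    intro i j hij
    have h1 := hp.strictAnti_extWeights hij
    have h2 := h i j
    have h3 : extWeights l (σ j) < extWeights l (σ i) := by
      have : 0 < α * (extWeights l (σ i) - extWeights l (σ j)) := by
        rw [← h2]; exact mul_pos hβ (sub_pos.2 h1)
      exact sub_pos.1 (pos_of_mul_pos_right this hα.le)
    exact hl.strictAnti_extWeights.lt_iff_gt.1 h3
  have hσ : ∀ i, σ i = i := by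
    let e : Fin (m + 4) ≃o Fin (m + 4) := StrictMono.orderIsoOfSurjective σ hmono σ.surjective
    have : e = OrderIso.refl _ := Subsingleton.elim _ _
    exact fun i => DFunLike.congr_fun this i
  have h1 : ∀ i, β * p i = α * l i := by
    intro i
    have := h i.castSucc (Fin.last _)
    simpa [hσ] using this
  have h2 : Finset.univ.gcd (fun i => β * p i) = Finset.univ.gcd (fun i => α * l i) := by
    simp only [h1]
  rw [Finset.gcd_mul_left, Finset.gcd_mul_left, hp.gcd_eq_one, hl.gcd_eq_one, mul_one, mul_one,
    Int.normalize_of_nonneg hβ.le, Int.normalize_of_nonneg hα.le] at h2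
  refine ⟨funext fun i => ?_, h2.symm⟩
  have := h1 i
  rw [h2] at this
  exact (mul_left_cancel₀ hα.ne' this).symm

theorem eq_or_eq_conj_of_perm {p l : Fin (m + 3) → ℤ} (hp : IsWeightTuple p)
    (hl : IsWeightTuple l) {t : ℂ} (σ : Equiv.Perm (Fin (m + 4)))
    (h : ∀ i j, (extWeights p i - extWeights p j : ℂ) =
      t * (extWeights l (σ i) - extWeights l (σ j))) :
    (l = p ∧ t = 1) ∨ (l = conjTuple p ∧ t = -1) := by
  set α : ℤ := extWeights p 0 - extWeights p 1 with hα'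
  set β : ℤ := extWeights l (σ 0) - extWeights l (σ 1) with hβ'
  have hα : 0 < α := sub_pos.2 (hp.strictAnti_extWeights (by simp))
  have h0 : (α : ℂ) = t * β := by
    rw [hα', hβ']; push_cast; exact h 0 1
  have hβ : β ≠ 0 := by
    intro h1
    rw [h1] at h0
    simp at h0
    omega
  have key : ∀ i j, β * (extWeights p i - extWeights p j) =
      α * (extWeights l (σ i) - extWeights l (σ j)) := by
    intro i j
    have : ((β * (extWeights p i - extWeights p j) : ℤ) : ℂ) =
        ((α * (extWeights l (σ i) - extWeights l (σ j)) : ℤ) : ℂ) := by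
      push_cast
      rw [h0, h i j]; ring
    exact_mod_cast this
  have hβc : (β : ℂ) ≠ 0 := by exact_mod_cast hβ
  rcases lt_or_gt_of_ne hβ with hneg | hpos
  · right
    have h1 := eq_of_proportional (α := α) (β := -β) hp.conjTuple hl hα (by omega)
      (Fin.revPerm.trans σ) (by
        intro i j
        have := key i.rev j.rev
        simp only [extWeights_conjTuple, Equiv.trans_apply, Fin.revPerm_apply]
        linear_combination this)
    refine ⟨h1.1, ?_⟩
    apply mul_right_cancel₀ hβc
    rw [← h0, h1.2]; push_cast; ring
  · left
    have h1 := eq_of_proportional hp hl hα hpos σ key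
    refine ⟨h1.1, ?_⟩
    apply mul_right_cancel₀ hβc
    rw [← h0, h1.2]; ring

/-- The weight of the Lie derivative along the traceless part of `S`. -/
def tracelessWeight (p : Fin (m + 3) → ℤ) (lam : ℤ) (d : ℕ) : ℤ :=
  (m + 4) * lam + (1 - d) * ∑ i, p i

theorem weights_eq_of_ray {p l : Fin (m + 3) → ℤ} (hp : IsWeightTuple p) (hl : IsWeightTuple l)
    {lam mu : ℤ} {d : ℕ} {t : ℂ}
    (h : ∀ i, specCoeff i (weightMatrix p) = t ^ i * specCoeff i (weightMatrix l))
    (hκ : (tracelessWeight p lam d : ℂ) = t * tracelessWeight l mu d) :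
    (l = p ∧ mu = lam) ∨ (l = conjTuple p ∧ mu = conjWeight p lam d) := by
  obtain ⟨σ, hσ⟩ := exists_perm_of_specCoeff h
  have hN : ((Fintype.card (Fin (m + 4)) : ℕ) : ℂ) ≠ 0 := by
    rw [Fintype.card_fin]; exact_mod_cast (by omega : m + 4 ≠ 0)
  have h1 := eq_or_eq_conj_of_perm hp hl (t := t) σ (by
    intro i j
    apply mul_left_cancel₀ hN
    linear_combination hσ i - hσ j)
  have hm : (m + 4 : ℤ) ≠ 0 := by omega
  rcases h1 with ⟨rfl, rfl⟩ | ⟨rfl, rfl⟩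
  · left
    refine ⟨rfl, ?_⟩
    rw [one_mul] at hκ
    have hκ' : tracelessWeight l lam d = tracelessWeight l mu d := by exact_mod_cast hκ
    apply mul_left_cancel₀ hm
    rw [tracelessWeight, tracelessWeight] at hκ'
    linarith
  · right
    refine ⟨rfl, ?_⟩
    have hκ' : tracelessWeight p lam d = -tracelessWeight (conjTuple p) mu d := by
      have : (tracelessWeight p lam d : ℂ) = ((-tracelessWeight (conjTuple p) mu d : ℤ) : ℂ) := by
        rw [hκ]; push_cast; ring
      exact_mod_cast this
    apply mul_left_cancel₀ hm
    rw [tracelessWeight, tracelessWeight, sum_conjTuple] at hκ'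
    rw [conjWeight]
    linear_combination hκ'

theorem traceSq_weightMatrix_ne_zero {p : Fin (m + 3) → ℤ} (hp : IsWeightTuple p) :
    traceSq (weightMatrix p) ≠ 0 := by
  rw [traceSq, weightMatrix, traceless_diagonal, Matrix.diagonal_mul_diagonal,
    Matrix.trace_diagonal]
  set x : Fin (m + 4) → ℤ := fun i => (m + 4) * extWeights p i - ∑ j, extWeights p j with hx
  have h1 : (∑ i, ((Fintype.card (Fin (m + 4)) : ℕ) * (extWeights p i : ℂ) -
      ∑ j, (extWeights p j : ℂ)) * ((Fintype.card (Fin (m + 4)) : ℕ) * (extWeights p i : ℂ) -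
      ∑ j, (extWeights p j : ℂ))) = ((∑ i, x i * x i : ℤ) : ℂ) := by
    simp [hx]
  rw [h1]
  have h2 : ∑ i, x i * x i ≠ 0 := by
    intro h
    rw [Finset.sum_eq_zero_iff_of_nonneg fun i _ => mul_self_nonneg _] at h
    have h3 : x 0 = x 1 := by
      rw [mul_self_eq_zero.1 (h 0 (Finset.mem_univ _)), mul_self_eq_zero.1 (h 1 (Finset.mem_univ _))]
    have h4 := hp.strictAnti_extWeights (show (0 : Fin (m + 4)) < 1 by simp)
    have h5 : ((m : ℤ) + 4) * (extWeights p 0 - extWeights p 1) = 0 := by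
      simp only [hx] at h3; linear_combination h3
    have h6 : 0 < ((m : ℤ) + 4) * (extWeights p 0 - extWeights p 1) :=
      mul_pos (by omega) (sub_pos.2 h4)
    omega
  exact_mod_cast h2

end Weights

section Zariski

variable {V : Type*} [AddCommGroup V] [Module ℂ V]

/-- The ring of formal polynomial functions on a vector space. -/
abbrev PolyFun (V : Type*) [AddCommGroup V] [Module ℂ V] : Type _ :=
  MvPolynomial (Module.Dual ℂ V) ℂ

/-- Evaluation of a formal polynomial function at a vector. -/
noncomputable def evalVec (v : V) : PolyFun V →+* ℂ := MvPolynomial.eval fun φ => φ v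

@[simp] theorem evalVec_C (v : V) (c : ℂ) : evalVec v (MvPolynomial.C c) = c := by
  simp [evalVec]

@[simp] theorem evalVec_X (v : V) (φ : Module.Dual ℂ V) : evalVec v (MvPolynomial.X φ) = φ v := by
  simp [evalVec]

theorem evalVec_smul {F : PolyFun V} {k : ℕ} (hF : F.IsHomogeneous k) (c : ℂ) (v : V) :
    evalVec (c • v) F = c ^ k * evalVec v F := by
  rw [evalVec, evalVec, MvPolynomial.eval_eq, MvPolynomial.eval_eq, Finset.mul_sum]
  refine Finset.sum_congr rfl fun a ha => ?_
  have h1 : ∑ i ∈ a.support, a i = k := by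
    have := hF (MvPolynomial.mem_support_iff.1 ha)
    rwa [Finsupp.weight_apply, Finsupp.sum, Finset.sum_congr rfl
      (fun i _ => show a i • (1 : Module.Dual ℂ V → ℕ) i = a i by simp)] at this
  simp only [map_smul, smul_eq_mul, mul_pow, Finset.prod_mul_distrib]
  rw [Finset.prod_pow_eq_pow_sum, h1]
  ring

/-- A polynomial function, homogeneous or not, that vanishes on the cone over a set vanishes on the
Zariski closure. -/
theorem evalVec_eq_zero_of_mem_zariskiClosure {Z : Set (ℙ ℂ V)} {x : ℙ ℂ V}
    (hx : x ∈ zariskiClosure Z) {F : PolyFun V}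
    (hF : ∀ z ∈ Z, ∀ c : ℂ, c ≠ 0 → evalVec (c • z.rep) F = 0) : evalVec x.rep F = 0 := by
  have hcomp : ∀ k, evalVec x.rep (MvPolynomial.homogeneousComponent k F) = 0 := by
    intro k
    refine hx k _ (MvPolynomial.homogeneousComponent_isHomogeneous k F) fun z hz => ?_
    let P : Polynomial ℂ := ∑ i ∈ Finset.range (F.totalDegree + 1),
      Polynomial.C (evalVec z.rep (MvPolynomial.homogeneousComponent i F)) * Polynomial.X ^ i
    have hP : P = 0 := by
      refine Polynomial.eq_zero_of_infinite_isRoot P ?_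
      refine Set.Infinite.mono (s := {0}ᶜ) (fun c hc => ?_) (Set.finite_singleton _).infinite_compl
      have h1 := hF z hz c hc
      rw [← MvPolynomial.sum_homogeneousComponent F, map_sum] at h1
      change Polynomial.eval c P = 0
      rw [Polynomial.eval_finsetSum, ← h1]
      refine Finset.sum_congr rfl fun i _ => ?_
      rw [evalVec_smul (MvPolynomial.homogeneousComponent_isHomogeneous i F)]
      rw [Polynomial.eval_mul, Polynomial.eval_C, Polynomial.eval_pow, Polynomial.eval_X, mul_comm]
    by_cases hk : k < F.totalDegree + 1
    · have h2 := congrArg (fun Q => Polynomial.coeff Q k) hP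
      simp only [P, Polynomial.finsetSum_coeff, Polynomial.coeff_C_mul_X_pow,
        Polynomial.coeff_zero] at h2
      rw [Finset.sum_ite_eq, if_pos (Finset.mem_range.2 hk)] at h2
      exact h2
    · rw [MvPolynomial.homogeneousComponent_eq_zero _ _ (by omega), map_zero]
  rw [← MvPolynomial.sum_homogeneousComponent F, map_sum]
  exact Finset.sum_eq_zero fun i _ => hcomp i

end Zariski

section Transfer

variable {V H n : Type*} [AddCommGroup V] [Module ℂ V] [AddCommGroup H] [Module ℂ H] [Fintype n]

/-- Kernels of a linear family of maps depend polynomially on the parameter, near a point where the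
kernel has minimal dimension. -/
theorem exists_kernel_parametrization (Φ : V →ₗ[ℂ] Matrix n n ℂ →ₗ[ℂ] H) (v₀ : V) :
    ∃ (δ : PolyFun V) (ξ : Matrix n n ℂ → Matrix n n (PolyFun V))
      (L : V → Matrix n n ℂ →ₗ[ℂ] Matrix n n ℂ),
      (∀ v k, (ξ k).map (evalVec v) = L v k) ∧ evalVec v₀ δ = 1 ∧
      (∀ v, ∀ k ∈ LinearMap.ker (Φ v), L v k = evalVec v δ • k) ∧
      ∀ v, evalVec v δ ≠ 0 → Module.finrank ℂ (LinearMap.ker (Φ v₀)) ≤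
          Module.finrank ℂ (LinearMap.ker (Φ v)) →
        Module.finrank ℂ (LinearMap.ker (Φ v)) = Module.finrank ℂ (LinearMap.ker (Φ v₀)) ∧
        (∀ k ∈ LinearMap.ker (Φ v₀), L v k ∈ LinearMap.ker (Φ v)) ∧
        ∀ x ∈ LinearMap.ker (Φ v), ∃ k ∈ LinearMap.ker (Φ v₀), L v k = x := by
  set K := LinearMap.ker (Φ v₀) with hK
  obtain ⟨W, hW⟩ := Submodule.exists_isCompl K
  have hdim := Submodule.finrank_add_eq_of_isCompl hW
  obtain ⟨r, ⟨b⟩⟩ : ∃ r, Nonempty (Module.Basis (Fin r) ℂ W) :=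
    ⟨_, ⟨Module.finBasis ℂ W⟩⟩
  have hinj : LinearMap.ker ((Φ v₀).comp W.subtype) = ⊥ := by
    rw [LinearMap.ker_eq_bot']
    intro w hw
    have h1 : (w : Matrix n n ℂ) ∈ K ⊓ W := ⟨hw, w.2⟩
    rw [hW.inf_eq_bot] at h1
    exact Subtype.ext ((Submodule.mem_bot ℂ).1 h1)
  obtain ⟨π, hπ⟩ := LinearMap.exists_leftInverse_of_injective _ hinj
  have hπ' : ∀ w : W, π (Φ v₀ w) = w := fun w => LinearMap.congr_fun hπ w
  -- the coordinates of `π ∘ Φ v`, as linear functionals of `v`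
  let φ : Matrix n n ℂ → Fin r → Module.Dual ℂ V := fun k i =>
    (b.coord i).comp (π.comp (Φ.flip k))
  have hφ : ∀ k i v, φ k i v = b.repr (π (Φ v k)) i := fun k i v => rfl
  let M : Matrix (Fin r) (Fin r) (PolyFun V) := Matrix.of fun i j =>
    MvPolynomial.X (φ (b j : Matrix n n ℂ) i)
  let c : Matrix n n ℂ → Fin r → PolyFun V := fun k i => MvPolynomial.X (φ k i)
  let Mv : V → Matrix (Fin r) (Fin r) ℂ := fun v => Matrix.of fun i j =>
    φ (b j : Matrix n n ℂ) i v
  have hMv : ∀ v, M.map (evalVec v) = Mv v := by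
    intro v; ext i j; simp [M, Mv]
  let cL : V → Matrix n n ℂ →ₗ[ℂ] (Fin r → ℂ) := fun v =>
    b.equivFun.toLinearMap.comp (π.comp (Φ v))
  have hcL : ∀ v k i, cL v k i = φ k i v := fun v k i => rfl
  let L : V → Matrix n n ℂ →ₗ[ℂ] Matrix n n ℂ := fun v =>
    (Mv v).det • LinearMap.id - W.subtype.comp
      (b.equivFun.symm.toLinearMap.comp ((Mv v).adjugate.mulVecLin.comp (cL v)))
  have hL : ∀ v k, L v k = (Mv v).det • k - ∑ j, ((Mv v).adjugate.mulVec (cL v k)) j •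
      (b j : Matrix n n ℂ) := by
    intro v k
    simp [L, Module.Basis.equivFun_symm_apply]
  refine ⟨M.det, fun k => M.det • k.map MvPolynomial.C -
    ∑ j, (M.adjugate.mulVec (c k)) j • (b j : Matrix n n ℂ).map MvPolynomial.C, L, ?_, ?_, ?_, ?_⟩
  · intro v k
    have hdet : evalVec v M.det = (Mv v).det := by
      rw [RingHom.map_det, RingHom.mapMatrix_apply, hMv]
    have hadj : ∀ j, evalVec v ((M.adjugate.mulVec (c k)) j) =
        ((Mv v).adjugate.mulVec (cL v k)) j := by
      intro j
      rw [Matrix.mulVec, Matrix.mulVec, dotProduct, dotProduct, map_sum]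
      refine Finset.sum_congr rfl fun i _ => ?_
      rw [map_mul, ← hMv, ← RingHom.mapMatrix_apply, ← RingHom.map_adjugate, hcL]
      simp [c]
    rw [hL]
    ext i j
    simp only [Matrix.map_apply, Matrix.sub_apply, Matrix.smul_apply, Matrix.sum_apply, map_sub,
      map_sum, smul_eq_mul, map_mul, hdet, hadj, evalVec_C]
  · rw [RingHom.map_det, RingHom.mapMatrix_apply, hMv]
    have : Mv v₀ = 1 := by
      ext i j
      simp only [Mv, Matrix.of_apply, hφ, hπ']
      simp [Matrix.one_apply, Finsupp.single_apply, eq_comm]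
    rw [this, Matrix.det_one]
  · intro v k hk
    have hc : cL v k = 0 := by
      ext i
      rw [hcL, hφ, LinearMap.mem_ker.1 hk]
      simp
    rw [hL, hc, RingHom.map_det, RingHom.mapMatrix_apply, hMv]
    simp
  · intro v hv hfin
    have hdet : (Mv v).det ≠ 0 := by
      rwa [RingHom.map_det, RingHom.mapMatrix_apply, hMv] at hv
    -- the kernel of `π ∘ Φ v`
    have hle : LinearMap.ker (Φ v) ≤ LinearMap.ker (cL v) := by
      intro x hx
      rw [LinearMap.mem_ker] at hx ⊢
      simp [cL, hx]
    have hcb : ∀ y : Fin r → ℂ, cL v (∑ j, y j • (b j : Matrix n n ℂ)) = (Mv v).mulVec y := by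
      intro y
      ext i
      rw [map_sum, Finset.sum_apply, Matrix.mulVec, dotProduct]
      refine Finset.sum_congr rfl fun j _ => ?_
      rw [map_smul, Pi.smul_apply, smul_eq_mul, hcL, mul_comm]
      rfl
    have hsurj : LinearMap.range (cL v) = ⊤ := by
      rw [LinearMap.range_eq_top]
      intro y
      refine ⟨∑ j, ((Mv v)⁻¹.mulVec y) j • (b j : Matrix n n ℂ), ?_⟩
      rw [hcb, Matrix.mulVec_mulVec, Matrix.mul_nonsing_inv _ (isUnit_iff_ne_zero.2 hdet),
        Matrix.one_mulVec]
    have hrank := LinearMap.finrank_range_add_finrank_ker (cL v)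
    rw [hsurj, finrank_top, Module.finrank_fin_fun] at hrank
    have hWr : Module.finrank ℂ W = r := by
      rw [Module.finrank_eq_card_basis b, Fintype.card_fin]
    have hfle := Submodule.finrank_mono hle
    have hker : LinearMap.ker (Φ v) = LinearMap.ker (cL v) :=
      Submodule.eq_of_le_of_finrank_le hle (by omega)
    have hfeq : Module.finrank ℂ (LinearMap.ker (Φ v)) = Module.finrank ℂ K := by omega
    have hmem : ∀ k ∈ K, L v k ∈ LinearMap.ker (Φ v) := by
      intro k _
      rw [hker, LinearMap.mem_ker, hL, map_sub, map_smul, hcb, Matrix.mulVec_mulVec,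
        Matrix.mul_adjugate, Matrix.smul_mulVec, Matrix.one_mulVec, sub_self]
    refine ⟨hfeq, hmem, ?_⟩
    let L' : K →ₗ[ℂ] LinearMap.ker (Φ v) := (L v).restrict hmem
    have hL'inj : Function.Injective L' := by
      rw [← LinearMap.ker_eq_bot, LinearMap.ker_eq_bot']
      intro k hk
      have h1 : L v k = 0 := congrArg Subtype.val hk
      rw [hL, sub_eq_zero] at h1
      have h2 : (Mv v).det • (k : Matrix n n ℂ) ∈ K ⊓ W := by
        refine ⟨K.smul_mem _ k.2, ?_⟩
        rw [h1]
        exact W.sum_mem fun j _ => W.smul_mem _ (b j).2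
      rw [hW.inf_eq_bot, Submodule.mem_bot, smul_eq_zero] at h2
      exact Subtype.ext (h2.resolve_left hdet)
    have hL'surj : Function.Surjective L' :=
      (LinearMap.injective_iff_surjective_of_finrank_eq_finrank hfeq.symm).1 hL'inj
    intro x hx
    obtain ⟨k, hk⟩ := hL'surj ⟨x, hx⟩
    exact ⟨k, k.2, congrArg Subtype.val hk⟩

end Transfer

section Relation

variable {R S : Type*} [CommRing R] [CommRing S] [Algebra ℂ R] [Algebra ℂ S]

/-- The quadratic relations between the homogeneous invariants `uᵢ` of degree `i` of a point on the
ray through a point with invariants `γᵢ`, where `e` is the scale and `q`, `qL` are the values of an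
invariant of degree two. -/
noncomputable def rayRel (γ : ℕ → ℂ) (qL : ℂ) (u : ℕ → R) (e q : R) (ij : ℕ × ℕ) : R :=
  if Even (ij.1 + ij.2) then
    u ij.1 * u ij.2 * algebraMap ℂ R (qL ^ ((ij.1 + ij.2) / 2)) -
      algebraMap ℂ R (γ ij.1 * γ ij.2) * e ^ 2 * q ^ ((ij.1 + ij.2) / 2)
  else 0

theorem map_rayRel (f : R →+* S) (hf : ∀ c, f (algebraMap ℂ R c) = algebraMap ℂ S c) (γ : ℕ → ℂ)
    (qL : ℂ) (u : ℕ → R) (e q : R) (ij : ℕ × ℕ) :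
    f (rayRel γ qL u e q ij) = rayRel γ qL (fun i => f (u i)) (f e) (f q) ij := by
  rw [rayRel, rayRel]
  split_ifs
  · rw [map_sub, map_mul, map_mul, map_mul, map_mul, hf, hf, map_pow f e, map_pow f q]
  · exact map_zero f

theorem rayRel_eq_zero {γ u : ℕ → ℂ} {qL e q b : ℂ} (hu : ∀ i, u i = e * (b ^ i * γ i))
    (hq : q = b ^ 2 * qL) (ij : ℕ × ℕ) : rayRel γ qL u e q ij = 0 := by
  obtain ⟨i, j⟩ := ij
  rw [rayRel]
  split_ifs with h
  · have h1 : b ^ i * b ^ j = (b ^ 2) ^ ((i + j) / 2) := by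
      rw [← pow_add, ← pow_mul, Nat.mul_div_cancel' h.two_dvd]
    simp only [Algebra.algebraMap_self, RingHom.id_apply, hu, hq, mul_pow _ qL, ← h1]
    ring
  · rfl

theorem exists_ray_of_rayRel {γ u : ℕ → ℂ} {qL e q : ℂ} (he : e ≠ 0) (hqL : qL ≠ 0) (hu : u 0 = e)
    (hγ : γ 0 = 1) (h : ∀ ij, rayRel γ qL u e q ij = 0) : ∃ t : ℂ, ∀ i, u i = e * (t ^ i * γ i) :=
  exists_ray he hqL hu hγ fun i j hij => by
    have := h (i, j)
    rw [rayRel, if_pos hij] at this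
    simpa [sub_eq_zero] using this

end Relation

section BilinearPolyFun

variable {V n : Type*} [AddCommGroup V] [Module ℂ V] [Fintype n] [DecidableEq n]

theorem evalVec_algebraMap (v : V) (c : ℂ) :
    evalVec v (algebraMap ℂ (PolyFun V) c) = algebraMap ℂ ℂ c := by
  rw [MvPolynomial.algebraMap_eq, evalVec_C]; rfl

/-- The polynomial function `β(v, x)`, for a matrix `x` of polynomial functions. -/
noncomputable def bilinPoly (β : V →ₗ[ℂ] Matrix n n ℂ →ₗ[ℂ] ℂ) (x : Matrix n n (PolyFun V)) :
    PolyFun V :=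
  ∑ i, ∑ j, x i j * MvPolynomial.X (β.flip (Matrix.single i j 1))

theorem evalVec_bilinPoly (β : V →ₗ[ℂ] Matrix n n ℂ →ₗ[ℂ] ℂ) (x : Matrix n n (PolyFun V)) (v : V) :
    evalVec v (bilinPoly β x) = β v (x.map (evalVec v)) := by
  conv_rhs => rw [Matrix.matrix_eq_sum_single (x.map (evalVec v))]
  simp only [bilinPoly, map_sum, map_mul, evalVec_X, Matrix.map_apply]
  refine Finset.sum_congr rfl fun i _ => Finset.sum_congr rfl fun j _ => ?_
  have : Matrix.single i j (evalVec v (x i j)) =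
      evalVec v (x i j) • Matrix.single i j (1 : ℂ) := by
    rw [Matrix.smul_single, smul_eq_mul, mul_one]
  rw [this, map_smul]
  rfl

end BilinearPolyFun

section Members

variable {m d : ℕ} {p l : Fin (m + 3) → ℤ} {lam mu : ℤ} {ω : Form (m + 4) (m + 1)}
  {A B : Matrix (Fin (m + 4)) (Fin (m + 4)) ℂ}

/-- A foliation form of weight `λ` for the tuple `p`, with an adapted frame `A` with inverse `B`. -/
structure IsAffForm (d : ℕ) (p : Fin (m + 3) → ℤ) (lam : ℤ) (ω : Form (m + 4) (m + 1))
    (A B : Matrix (Fin (m + 4)) (Fin (m + 4)) ℂ) : Prop where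
  form : IsFoliationForm d ω
  mul_eq_one : A * B = 1
  adapted : IsAdapted A p (formWeight p lam) ω

theorem IsAffForm.mul_eq_one' (h : IsAffForm d p lam ω A B) : B * A = 1 :=
  mul_eq_one_comm.1 h.mul_eq_one

theorem contract_extD_smul {N k : ℕ} (X : VField N) (c : ℂ) (ω : Form N (k + 1)) :
    contract X (extD (c • ω)) = c • contract X (extD ω) := by
  rw [extD_smul, contract_smul]

theorem tangentFields_smul {N k : ℕ} {c : ℂ} (hc : c ≠ 0) (ω : Form N (k + 1)) :
    tangentFields (c • ω) = tangentFields ω := by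
  ext Z
  rw [mem_tangentFields, mem_tangentFields, contract_smul, smul_eq_zero, or_iff_right hc]

theorem SingCodimGeTwo.smul {N k : ℕ} {ω : Form N k} {c : ℂ} (hc : c ≠ 0) (h : SingCodimGeTwo ω) :
    SingCodimGeTwo (c • ω) := by
  refine h.trans (Ideal.height_mono ?_)
  rw [Ideal.span_le]
  rintro _ ⟨v, rfl⟩
  have : ω v = MvPolynomial.C c⁻¹ * (c • ω) v := by
    rw [AlternatingMap.smul_apply, MvPolynomial.smul_eq_C_mul, ← mul_assoc, ← MvPolynomial.C_mul,
      inv_mul_cancel₀ hc, MvPolynomial.C_1, one_mul]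
  rw [SetLike.mem_coe, this]
  exact Ideal.mul_mem_left _ _ (Ideal.subset_span ⟨v, rfl⟩)

theorem IsAffForm.smul {c : ℂ} (hc : c ≠ 0) (h : IsAffForm d p lam ω A B) :
    IsAffForm d p lam (c • ω) A B where
  form :=
    { ne_zero := smul_ne_zero hc h.form.ne_zero
      homogeneous := fun v => (MvPolynomial.homogeneousSubmodule (Fin (m + 4)) ℂ _).smul_mem c
        (h.form.homogeneous v)
      contract_radial := by rw [contract_smul, h.form.contract_radial, smul_zero]
      sing := h.form.sing.smul hc }
  mul_eq_one := h.mul_eq_one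
  adapted :=
    { contract_eq_zero := by
        rw [affPull_smul, contract_smul, h.adapted.contract_eq_zero, smul_zero]
      contract_extD := by
        rw [affPull_smul, contract_extD_smul, h.adapted.contract_extD, smul_comm] }

theorem exists_isAffForm (hp : IsWeightTuple p) {F : ℙ ℂ (projForms m (d + 1 + 1))}
    (hF : F ∈ AffFoliations m p lam (d + 1)) :
    ∃ A B, IsAffForm d p lam (F.rep : Form (m + 4) (m + 1)) A B := by
  obtain ⟨⟨-, hs⟩, A, hA⟩ := (mem_AffFoliations_iff hp.pos).1 hF
  refine ⟨A, (A⁻¹ : GL (Fin (m + 4)) ℂ), ⟨?_, F.rep.2.1, F.rep.2.2, hs⟩, ?_, hA⟩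
  · exact fun h => F.rep_nonzero (Subtype.ext h)
  · rw [← Units.val_mul, mul_inv_cancel, Units.val_one]

/-- A polynomial function that vanishes on all foliation forms of the given weight vanishes on the
Zariski closure. -/
theorem evalVec_eq_zero_of_forall_isAffForm (hl : IsWeightTuple l) {r : ℕ}
    (hr : ∀ F ∈ AffFoliations m l mu (d + 1),
      r ≤ Module.finrank ℂ (tangentFields (F.rep : Form (m + 4) (m + 1))))
    {x : ℙ ℂ (projForms m (d + 1 + 1))} (hx : x ∈ zariskiClosure (AffFoliations m l mu (d + 1)))
    {G : PolyFun (projForms m (d + 1 + 1))}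
    (hG : ∀ (v : projForms m (d + 1 + 1)) (A B : Matrix (Fin (m + 4)) (Fin (m + 4)) ℂ),
      IsAffForm d l mu (v : Form (m + 4) (m + 1)) A B →
      r ≤ Module.finrank ℂ (tangentFields (v : Form (m + 4) (m + 1))) → evalVec v G = 0) :
    evalVec x.rep G = 0 := by
  refine evalVec_eq_zero_of_mem_zariskiClosure hx fun z hz c hc => ?_
  obtain ⟨A, B, h⟩ := exists_isAffForm hl hz
  refine hG _ A B (h.smul hc) ?_
  rw [Submodule.coe_smul, tangentFields_smul hc]
  exact hr z hz

theorem specCoeff_conj_weightMatrix (h : IsAffForm d p lam ω A B) (i : ℕ) :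
    specCoeff i (A * weightMatrix p * B) = specCoeff i (weightMatrix p) :=
  specCoeff_conj h.mul_eq_one _ _

/-- The Lie derivative along the traceless part of the adapted field. -/
theorem IsAffForm.contract_traceless (h : IsAffForm d p lam ω A B) :
    contract (linField (traceless (A * weightMatrix p * B))) (extD ω) =
      (tracelessWeight p lam d : ℂ) • ω := by
  have h1 := h.adapted.contract_extD_conj h.mul_eq_one h.mul_eq_one'
  have h2 := contract_radial_extD h.form.homogeneous h.form.contract_radial
  have htr : (A * weightMatrix p * B).trace = ∑ i, (p i : ℂ) := by
    rw [Matrix.trace_mul_comm, ← mul_assoc, h.mul_eq_one', one_mul, weightMatrix,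
      Matrix.trace_diagonal]
    exact_mod_cast congrArg (Int.cast : ℤ → ℂ) (sum_extWeights p)
  change linContract _ _ (extD ω) (traceless (A * weightMatrix p * B)) = _
  rw [traceless, map_sub, map_smul, map_smul, linContract_apply, linContract_apply, h1, linField_one,
    h2, htr, smul_smul, smul_smul, ← sub_smul]
  congr 1
  rw [tracelessWeight, formWeight, Fintype.card_fin]
  push_cast
  ring

/-- The invariants of an adapted field, the vanishing first coefficient replaced by the weight. -/
noncomputable def fullInvariants (p : Fin (m + 3) → ℤ) (lam : ℤ) (d i : ℕ) : ℂ :=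
  if i = 1 then tracelessWeight p lam d else specCoeff i (weightMatrix p)

theorem eq_or_conj_of_fullInvariants (hp : IsWeightTuple p) (hl : IsWeightTuple l) {e t : ℂ}
    (he : e ≠ 0) (h : ∀ i, e * fullInvariants p lam d i = e * (t ^ i * fullInvariants l mu d i)) :
    (l = p ∧ mu = lam) ∨ (l = conjTuple p ∧ mu = conjWeight p lam d) := by
  refine weights_eq_of_ray hp hl (t := t) (fun i => ?_) ?_
  · by_cases hi : i = 1
    · subst hi; rw [specCoeff_one, specCoeff_one, mul_zero]
    · have := mul_left_cancel₀ he (h i)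
      rwa [fullInvariants, fullInvariants, if_neg hi, if_neg hi] at this
  · have := mul_left_cancel₀ he (h 1)
    rwa [fullInvariants, fullInvariants, if_pos rfl, if_pos rfl, pow_one] at this

/-- The contraction of a projective form with linear vector fields. -/
noncomputable def tangentPairing (m e : ℕ) :
    projForms m e →ₗ[ℂ] Matrix (Fin (m + 4)) (Fin (m + 4)) ℂ →ₗ[ℂ] Form (m + 4) m :=
  (linContract (m + 4) m).comp (projForms m e).subtype

theorem ker_tangentPairing {e : ℕ} (v : projForms m e) :
    LinearMap.ker (tangentPairing m e v) = tangentFields (v : Form (m + 4) (m + 1)) := rfl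

/-- A coefficient, at a point, of the contraction of `dω` with a linear field. -/
noncomputable def derivPairing {e : ℕ} (x : Fin (m + 4) → ℂ) (w : Fin (m + 1) → Fin (m + 4) → ℂ) :
    projForms m e →ₗ[ℂ] Matrix (Fin (m + 4)) (Fin (m + 4)) ℂ →ₗ[ℂ] ℂ :=
  LinearMap.mk₂ ℂ (fun v Z => formAt x (linContract (m + 4) (m + 1) (extD (v : Form _ _)) Z) w)
    (fun v v' Z => by
      rw [Submodule.coe_add, extD_add, map_add, LinearMap.add_apply, formAt_apply,
        AlternatingMap.add_apply, map_add, ← formAt_apply, ← formAt_apply])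
    (fun c v Z => by
      rw [Submodule.coe_smul, extD_smul, map_smul, LinearMap.smul_apply, formAt_smul]; rfl)
    (fun v Z Z' => by
      rw [map_add, formAt_apply, AlternatingMap.add_apply, map_add, ← formAt_apply, ← formAt_apply])
    (fun c v Z => by rw [map_smul, formAt_smul]; rfl)

/-- A coefficient of a form at a point. -/
noncomputable def coeffAt {e : ℕ} (x : Fin (m + 4) → ℂ) (w : Fin (m + 1) → Fin (m + 4) → ℂ) :
    Module.Dual ℂ (projForms m e) where
  toFun v := formAt x (v : Form (m + 4) (m + 1)) w
  map_add' v v' := by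
    rw [Submodule.coe_add, formAt_apply, AlternatingMap.add_apply, map_add, ← formAt_apply,
      ← formAt_apply]
  map_smul' c v := by rw [Submodule.coe_smul, formAt_smul]; rfl

/-- If an element of `ℱ(𝔓, λ)` with two-dimensional tangent algebra lies in the closure of
`ℱ(𝔏, μ)`, then the weights are the same up to conjugation. -/
theorem weights_of_finrank_eq_two (hd : 1 ≤ d) (hp : IsWeightTuple p) (hl : IsWeightTuple l)
    {F : ℙ ℂ (projForms m (d + 1 + 1))} (hF : F ∈ AffFoliations m p lam (d + 1))
    (h2 : Module.finrank ℂ (tangentFields (F.rep : Form (m + 4) (m + 1))) = 2)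
    (hcl : F ∈ zariskiClosure (AffFoliations m l mu (d + 1))) :
    (l = p ∧ mu = lam) ∨ (l = conjTuple p ∧ mu = conjWeight p lam d) := by
  obtain ⟨A, B, h⟩ := exists_isAffForm hp hF
  set v₀ := F.rep with hv₀
  obtain ⟨δ, ξ, L, hξ, hδ, hL, hpar⟩ := exists_kernel_parametrization (tangentPairing m (d + 1 + 1)) v₀
  obtain ⟨z, w, hzw⟩ : ∃ z w, formAt z (v₀ : Form (m + 4) (m + 1)) w ≠ 0 := by
    by_contra! hcon
    exact h.form.ne_zero (form_ext fun x v => by rw [hcon, formAt_zero])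
  set C := A * weightMatrix p * B with hC
  have hCm : C ∈ tangentFields (v₀ : Form (m + 4) (m + 1)) :=
    h.adapted.mem_tangentFields h.mul_eq_one h.mul_eq_one'
  let e : PolyFun (projForms m (d + 1 + 1)) := MvPolynomial.X (coeffAt z w)
  let u : ℕ → PolyFun (projForms m (d + 1 + 1)) := fun i =>
    if i = 1 then bilinPoly (derivPairing z w) (traceless (ξ C)) else e * specCoeff i (ξ C)
  have heval : ∀ v, evalVec v e = formAt z (v : Form (m + 4) (m + 1)) w := fun v => evalVec_X _ _
  have hueval : ∀ v i, evalVec v (u i) =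
      if i = 1 then formAt z (contract (linField (traceless (L v C))) (extD (v : Form _ _))) w
      else formAt z (v : Form (m + 4) (m + 1)) w * specCoeff i (L v C) := by
    intro v i
    simp only [u]
    split_ifs
    · rw [evalVec_bilinPoly, ← traceless_map, hξ]; rfl
    · rw [map_mul, heval, ← specCoeff_map, hξ]
  have hray : ∀ (v : projForms m (d + 1 + 1)) (p' : Fin (m + 3) → ℤ) (lam' : ℤ)
      (A' B' : Matrix (Fin (m + 4)) (Fin (m + 4)) ℂ),
      IsAffForm d p' lam' (v : Form (m + 4) (m + 1)) A' B' → ∀ a b : ℂ,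
      L v C = a • (1 : Matrix (Fin (m + 4)) (Fin (m + 4)) ℂ) + b • (A' * weightMatrix p' * B') →
      ∀ i, evalVec v (u i) = formAt z (v : Form (m + 4) (m + 1)) w *
        (b ^ i * fullInvariants p' lam' d i) := by
    intro v p' lam' A' B' h' a b hab i
    rw [hueval, hab, fullInvariants]
    split_ifs with hi
    · change formAt z (linContract _ _ (extD (v : Form (m + 4) (m + 1))) _) w = _
      rw [traceless_add_smul, map_smul, formAt_smul, linContract_apply, h'.contract_traceless,
        formAt_smul, hi]
      ring
    · rw [specCoeff_add_smul, specCoeff_conj_weightMatrix h']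
  have key : ∀ ij, rayRel (fullInvariants l mu d) (traceSq (weightMatrix l))
      (fun i => evalVec v₀ (u i)) (evalVec v₀ e) (evalVec v₀ (traceSq (ξ C))) ij = 0 := by
    intro ij
    have := evalVec_eq_zero_of_forall_isAffForm hl (r := 0) (fun _ _ => Nat.zero_le _) hcl
      (G := δ * rayRel (fullInvariants l mu d) (traceSq (weightMatrix l)) u e (traceSq (ξ C)) ij) ?_
    · rwa [map_mul, ← hv₀, hδ, one_mul, map_rayRel (evalVec v₀) (evalVec_algebraMap v₀)] at this
    · intro v A' B' h' _
      rw [map_mul]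
      by_cases hδv : evalVec v δ = 0
      · rw [hδv, zero_mul]
      rw [map_rayRel (evalVec v) (evalVec_algebraMap v)]
      have hcases := h'.adapted.tangentFields_cases hd h'.form hl h'.mul_eq_one h'.mul_eq_one'
      obtain ⟨hfin, hmem, -⟩ := hpar v hδv (by
        rw [ker_tangentPairing, ker_tangentPairing, h2]
        rcases hcases with h3 | h3 <;> omega)
      rw [ker_tangentPairing, ker_tangentPairing, h2] at hfin
      obtain ⟨-, hcases⟩ := hcases.resolve_right (by rintro ⟨h3, -⟩; omega)
      obtain ⟨a, b, hab⟩ := hcases _ (hmem C hCm)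
      rw [rayRel_eq_zero (b := b), mul_zero]
      · intro i
        rw [heval]
        exact hray v l mu A' B' h' a b hab i
      · rw [← traceSq_map, hξ, hab, traceSq_add_smul, traceSq_conj h'.mul_eq_one]
  have hC0 : L v₀ C = (0 : ℂ) • (1 : Matrix (Fin (m + 4)) (Fin (m + 4)) ℂ) +
      (1 : ℂ) • (A * weightMatrix p * B) := by
    rw [hL v₀ C hCm, hδ, ← hC]; simp
  have hu0 := hray v₀ p lam A B h 0 1 hC0
  have he0 : evalVec v₀ e ≠ 0 := by rwa [heval]
  obtain ⟨t, ht⟩ := exists_ray_of_rayRel he0 (traceSq_weightMatrix_ne_zero hl)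
    (by rw [hu0, heval]; simp [fullInvariants, specCoeff_zero])
    (by simp [fullInvariants, specCoeff_zero]) key
  refine eq_or_conj_of_fullInvariants hp hl he0 (t := t) fun i => ?_
  rw [← ht i, hu0, heval, one_pow, one_mul]

end Members

section Triangular

variable {n : ℕ} {x : Matrix (Fin n) (Fin n) ℂ}

/-- Upper or lower triangular matrices. -/
def IsTriangular (x : Matrix (Fin n) (Fin n) ℂ) : Prop :=
  (∀ i j, i < j → x i j = 0) ∨ ∀ i j, j < i → x i j = 0

theorem IsTriangular.charpolyRev (h : IsTriangular x) :
    x.charpolyRev = ∏ i, (1 - Polynomial.X * Polynomial.C (x i i)) := by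
  rw [Matrix.charpolyRev]
  rcases h with h | h
  · rw [Matrix.det_of_isLowerTriangular]
    · simp
    · intro i j hij
      have hij : i < j := hij
      simp [h i j hij, hij.ne]
  · rw [Matrix.det_of_isUpperTriangular]
    · simp
    · intro i j hij
      have hij : j < i := hij
      simp [h i j hij, hij.ne']

theorem IsTriangular.trace_mul_self (h : IsTriangular x) : (x * x).trace = ∑ i, x i i * x i i := by
  rw [Matrix.trace]
  refine Finset.sum_congr rfl fun i _ => ?_
  rw [Matrix.diag_apply, Matrix.mul_apply]
  refine Finset.sum_eq_single i (fun j _ hj => ?_) (by simp)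
  rcases h with h | h <;> rcases lt_or_gt_of_ne hj with hij | hij
  · rw [h _ _ hij, mul_zero]
  · rw [h _ _ hij, zero_mul]
  · rw [h _ _ hij, zero_mul]
  · rw [h _ _ hij, mul_zero]

theorem IsTriangular.traceless (h : IsTriangular x) : IsTriangular (traceless x) := by
  refine h.imp (fun h i j hij => ?_) fun h i j hij => ?_
  · simp [AffFoliation.traceless, h i j hij, hij.ne]
  · simp [AffFoliation.traceless, h i j hij, hij.ne']

theorem isTriangular_diagonal (f : Fin n → ℂ) : IsTriangular (Matrix.diagonal f) :=
  Or.inl fun _ _ hij => Matrix.diagonal_apply_ne _ hij.ne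

theorem traceless_diag (x : Matrix (Fin n) (Fin n) ℂ) (i : Fin n) :
    traceless x i i = traceless (Matrix.diagonal x.diag) i i := by
  simp [traceless, Matrix.trace]

theorem IsTriangular.specCoeff (h : IsTriangular x) (i : ℕ) :
    specCoeff i x = specCoeff i (Matrix.diagonal x.diag) := by
  rw [AffFoliation.specCoeff, AffFoliation.specCoeff, h.traceless.charpolyRev,
    (isTriangular_diagonal _).traceless.charpolyRev]
  simp only [traceless_diag x]

theorem IsTriangular.traceSq (h : IsTriangular x) :
    traceSq x = traceSq (Matrix.diagonal x.diag) := by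
  rw [AffFoliation.traceSq, AffFoliation.traceSq, h.traceless.trace_mul_self,
    (isTriangular_diagonal _).traceless.trace_mul_self]
  simp only [traceless_diag x]

end Triangular

section Eigenmatrix

variable {m : ℕ} {p l : Fin (m + 3) → ℤ} {lam mu : ℤ} {ω : Form (m + 4) (m + 1)}
  {A B U : Matrix (Fin (m + 4)) (Fin (m + 4)) ℂ}

theorem isTriangular_of_eigen (hl : IsWeightTuple l) (hmu : mu ≠ 0)
    (hU : U * weightMatrix l - weightMatrix l * U = (mu : ℂ) • U) (a b c : ℂ) :
    IsTriangular (a • (1 : Matrix (Fin (m + 4)) (Fin (m + 4)) ℂ) + b • weightMatrix l + c • U) ∧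
    (a • (1 : Matrix (Fin (m + 4)) (Fin (m + 4)) ℂ) + b • weightMatrix l + c • U).diag =
      (a • (1 : Matrix (Fin (m + 4)) (Fin (m + 4)) ℂ) + b • weightMatrix l).diag := by
  have h1 : ∀ i j, extWeights l j - extWeights l i ≠ mu → U i j = 0 := by
    intro i j hij
    have h2 := congrFun (congrFun hU i) j
    simp only [weightMatrix, Matrix.sub_apply, Matrix.mul_diagonal, Matrix.diagonal_mul,
      Matrix.smul_apply, smul_eq_mul] at h2
    have h3 : U i j * ((extWeights l j - extWeights l i - mu : ℤ) : ℂ) = 0 := by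
      push_cast; linear_combination h2
    refine (mul_eq_zero.1 h3).resolve_right ?_
    exact_mod_cast sub_ne_zero.2 hij
  have h0 : ∀ i, U i i = 0 := fun i => h1 i i (by simpa using hmu.symm)
  refine ⟨?_, ?_⟩
  · rcases lt_or_gt_of_ne hmu with hneg | hpos
    · right
      intro i j hij
      have := hl.strictAnti_extWeights hij
      simp [h1 i j (by omega), weightMatrix, hij.ne']
    · left
      intro i j hij
      have := hl.strictAnti_extWeights hij
      simp [h1 i j (by omega), weightMatrix, hij.ne]
  · ext i
    simp [h0]

theorem diagonal_diag_weightMatrix (l : Fin (m + 3) → ℤ) (a b : ℂ) :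
    Matrix.diagonal (a • (1 : Matrix (Fin (m + 4)) (Fin (m + 4)) ℂ) + b • weightMatrix l).diag =
      a • (1 : Matrix (Fin (m + 4)) (Fin (m + 4)) ℂ) + b • weightMatrix l := by
  ext i j
  by_cases h : i = j
  · subst h; simp
  · simp [weightMatrix, h]

theorem specCoeff_add_eigen (hl : IsWeightTuple l) (hmu : mu ≠ 0)
    (hU : U * weightMatrix l - weightMatrix l * U = (mu : ℂ) • U) (a b c : ℂ) (i : ℕ) :
    specCoeff i (a • (1 : Matrix (Fin (m + 4)) (Fin (m + 4)) ℂ) + b • weightMatrix l + c • U) =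
      b ^ i * specCoeff i (weightMatrix l) := by
  obtain ⟨h1, h2⟩ := isTriangular_of_eigen hl hmu hU a b c
  rw [h1.specCoeff, h2, diagonal_diag_weightMatrix, specCoeff_add_smul]

theorem traceSq_add_eigen (hl : IsWeightTuple l) (hmu : mu ≠ 0)
    (hU : U * weightMatrix l - weightMatrix l * U = (mu : ℂ) • U) (a b c : ℂ) :
    traceSq (a • (1 : Matrix (Fin (m + 4)) (Fin (m + 4)) ℂ) + b • weightMatrix l + c • U) =
      b ^ 2 * traceSq (weightMatrix l) := by
  obtain ⟨h1, h2⟩ := isTriangular_of_eigen hl hmu hU a b c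
  rw [h1.traceSq, h2, diagonal_diag_weightMatrix, traceSq_add_smul]

/-- A three-dimensional tangent algebra of nonzero weight is spanned, in an adapted frame, by `1`,
the adapted field and an eigenvector of the adapted field. -/
theorem IsAffForm.exists_eigen (hl : IsWeightTuple l) (hmu : mu ≠ 0)
    (h : IsAffForm 1 l mu ω A B) (h3 : Module.finrank ℂ (tangentFields ω) = 3) :
    ∃ U, U ≠ 0 ∧ A * U * B ∈ tangentFields ω ∧
      U * weightMatrix l - weightMatrix l * U = (mu : ℂ) • U ∧
      ∀ Z ∈ tangentFields ω, ∃ a b c : ℂ, Z = A * (a • (1 : Matrix (Fin (m + 4)) (Fin (m + 4)) ℂ) +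
        b • weightMatrix l + c • U) * B := by
  have hAB := h.mul_eq_one
  have hBA := h.mul_eq_one'
  obtain ⟨-, -, Y, hY, hne, hspan⟩ := (h.adapted.tangentFields_cases le_rfl h.form hl hAB
    hBA).resolve_left (by rintro ⟨h2, -⟩; omega)
  obtain ⟨α, β, hαβ⟩ := h.adapted.commutator le_rfl h.form hl hAB hBA hY
  have hmu' : (mu : ℂ) ≠ 0 := by exact_mod_cast hmu
  set W := weightMatrix l
  set V := α • (1 : Matrix (Fin (m + 4)) (Fin (m + 4)) ℂ) + β • W with hV
  set Y' := B * Y * A with hY'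
  have hVW : V * W = W * V := by rw [hV]; simp [add_mul, mul_add]
  have hYV : A * Y' * B = Y := by rw [hY', conj_mul_self hAB, mul_assoc, hAB, mul_one]
  have hAV : A * V * B = α • (1 : Matrix (Fin (m + 4)) (Fin (m + 4)) ℂ) + β • (A * W * B) := by
    rw [hV]; simp [add_mul, mul_add, hAB]
  clear_value V
  refine ⟨Y' + (mu : ℂ)⁻¹ • V, fun h0 => ?_, ?_, ?_, ?_⟩
  · have : Y' = (-(mu : ℂ)⁻¹ * α) • (1 : Matrix (Fin (m + 4)) (Fin (m + 4)) ℂ) +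
        (-(mu : ℂ)⁻¹ * β) • W := by
      rw [eq_neg_of_add_eq_zero_left h0, hV, smul_add, smul_smul, smul_smul, neg_add, neg_mul,
        neg_mul, neg_smul, neg_smul]
    exact hne _ _ (eq_combination_of_conj hAB this)
  · rw [mul_add, add_mul, hYV, Matrix.mul_smul, Matrix.smul_mul, hAV]
    exact Submodule.add_mem _ hY (Submodule.smul_mem _ _ (Submodule.add_mem _
      (Submodule.smul_mem _ _ h.form.one_mem)
      (Submodule.smul_mem _ _ (h.adapted.mem_tangentFields hAB hBA))))
  · have : (mu : ℂ) • Y' + V = Y' * W - W * Y' := by rw [← hαβ]; abel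
    rw [smul_add, smul_inv_smul₀ hmu', this, add_mul, mul_add, Matrix.smul_mul, Matrix.mul_smul,
      hVW]
    abel
  · intro Z hZ
    obtain ⟨a, b, c, rfl⟩ := hspan Z hZ
    refine ⟨a - c * (mu : ℂ)⁻¹ * α, b - c * (mu : ℂ)⁻¹ * β, c, ?_⟩
    have : A * (a • (1 : Matrix (Fin (m + 4)) (Fin (m + 4)) ℂ) + b • W + c • Y') * B =
        a • (1 : Matrix (Fin (m + 4)) (Fin (m + 4)) ℂ) + b • (A * W * B) + c • Y := by
      rw [mul_add, add_mul, mul_add, add_mul]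
      simp only [Matrix.mul_smul, Matrix.smul_mul, hYV, mul_one, hAB]
    rw [← this, hV]
    congr 2
    module

/-- The commutator of matrices. -/
def matComm {n R : Type*} [Fintype n] [CommRing R] (x y : Matrix n n R) : Matrix n n R :=
  x * y - y * x

theorem matComm_map {n R S : Type*} [Fintype n] [CommRing R] [CommRing S] (f : R →+* S)
    (x y : Matrix n n R) : matComm (x.map f) (y.map f) = (matComm x y).map f := by
  rw [matComm, matComm, Matrix.map_sub _ (map_sub f), Matrix.map_mul, Matrix.map_mul]

theorem matComm_conj (hBA : B * A = 1) (x y : Matrix (Fin (m + 4)) (Fin (m + 4)) ℂ) :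
    matComm (A * x * B) (A * y * B) = A * matComm x y * B := by
  have : ∀ x y, A * x * B * (A * y * B) = A * (x * y) * B := fun x y => by
    rw [mul_assoc (A * x), ← mul_assoc B, ← mul_assoc B, hBA, one_mul]
    simp only [mul_assoc]
  rw [matComm, this, this, matComm, mul_sub, sub_mul]

theorem matComm_eigen (hU : U * weightMatrix l - weightMatrix l * U = (mu : ℂ) • U)
    (a b c a' b' c' : ℂ) :
    matComm (a • (1 : Matrix (Fin (m + 4)) (Fin (m + 4)) ℂ) + b • weightMatrix l + c • U)
      (a' • (1 : Matrix (Fin (m + 4)) (Fin (m + 4)) ℂ) + b' • weightMatrix l + c' • U) =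
      ((c * b' - b * c') * mu) • U := by
  rw [mul_smul, ← hU, matComm]
  simp only [add_mul, mul_add, Matrix.smul_mul, Matrix.mul_smul, one_mul, mul_one]
  module

theorem matComm_traceless_eigen (hU : U * weightMatrix l - weightMatrix l * U = (mu : ℂ) • U)
    (a b c k : ℂ) :
    matComm (k • U)
      (traceless (a • (1 : Matrix (Fin (m + 4)) (Fin (m + 4)) ℂ) + b • weightMatrix l + c • U)) =
      (b * tracelessWeight l mu 1) • k • U := by
  have : ((tracelessWeight l mu 1 : ℤ) : ℂ) = (m + 4) * mu := by
    rw [tracelessWeight]; push_cast; ring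
  rw [this, mul_smul, mul_smul, smul_comm (mu : ℂ), ← hU, matComm, traceless, Fintype.card_fin]
  simp only [add_mul, mul_add, Matrix.smul_mul, Matrix.mul_smul, one_mul, mul_one, sub_mul, mul_sub,
    smul_add, smul_sub]
  push_cast
  module

/-- The case of three-dimensional tangent algebras of nonzero weights. -/
theorem weights_of_ne_zero (hp : IsWeightTuple p) (hl : IsWeightTuple l) (hlam : lam ≠ 0)
    (hmu : mu ≠ 0) {F : ℙ ℂ (projForms m (1 + 1 + 1))} (hF : F ∈ AffFoliations m p lam (1 + 1))
    (h3 : Module.finrank ℂ (tangentFields (F.rep : Form (m + 4) (m + 1))) = 3)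
    (hl3 : ∀ F ∈ AffFoliations m l mu (1 + 1),
      3 ≤ Module.finrank ℂ (tangentFields (F.rep : Form (m + 4) (m + 1))))
    (hcl : F ∈ zariskiClosure (AffFoliations m l mu (1 + 1))) :
    (l = p ∧ mu = lam) ∨ (l = conjTuple p ∧ mu = conjWeight p lam 1) := by
  obtain ⟨A, B, h⟩ := exists_isAffForm hp hF
  set v₀ := F.rep with hv₀
  obtain ⟨δ, ξ, L, hξ, hδ, hL, hpar⟩ := exists_kernel_parametrization (tangentPairing m (1 + 1 + 1)) v₀
  obtain ⟨U, hU0, hUm, hU, -⟩ := h.exists_eigen hp hlam h3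
  set C := A * weightMatrix p * B with hC
  set D := A * U * B with hD
  have hCm : C ∈ tangentFields (v₀ : Form (m + 4) (m + 1)) :=
    h.adapted.mem_tangentFields h.mul_eq_one h.mul_eq_one'
  have hD0 : D ≠ 0 := by
    intro h0
    apply hU0
    have : B * D * A = U := by
      rw [hD, mul_assoc A, ← mul_assoc B, h.mul_eq_one', one_mul, mul_assoc, h.mul_eq_one', mul_one]
    rw [← this, h0, mul_zero, zero_mul]
  obtain ⟨r, s, hrs⟩ : ∃ r s, D r s ≠ 0 := by
    by_contra! hcon
    exact hD0 (Matrix.ext hcon)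
  let e : PolyFun (projForms m (1 + 1 + 1)) := matComm (ξ C) (ξ D) r s
  let u : ℕ → PolyFun (projForms m (1 + 1 + 1)) := fun i =>
    if i = 1 then matComm (matComm (ξ C) (ξ D)) (traceless (ξ C)) r s else e * specCoeff i (ξ C)
  have heval : ∀ v, evalVec v e = matComm (L v C) (L v D) r s := by
    intro v
    rw [← hξ, ← hξ, matComm_map]; rfl
  have hueval : ∀ v i, evalVec v (u i) =
      if i = 1 then matComm (matComm (L v C) (L v D)) (traceless (L v C)) r s
      else evalVec v e * specCoeff i (L v C) := by
    intro v i
    simp only [u]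
    split_ifs
    · rw [← hξ, ← hξ, matComm_map, traceless_map, matComm_map]; rfl
    · rw [map_mul, ← specCoeff_map, hξ]
  have hray : ∀ (v : projForms m (1 + 1 + 1)) (p' : Fin (m + 3) → ℤ) (lam' : ℤ)
      (A' B' U' : Matrix (Fin (m + 4)) (Fin (m + 4)) ℂ), IsWeightTuple p' → lam' ≠ 0 →
      IsAffForm 1 p' lam' (v : Form (m + 4) (m + 1)) A' B' →
      U' * weightMatrix p' - weightMatrix p' * U' = (lam' : ℂ) • U' → ∀ a b c a' b' c' : ℂ,
      L v C = A' * (a • (1 : Matrix (Fin (m + 4)) (Fin (m + 4)) ℂ) + b • weightMatrix p' +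
        c • U') * B' →
      L v D = A' * (a' • (1 : Matrix (Fin (m + 4)) (Fin (m + 4)) ℂ) + b' • weightMatrix p' +
        c' • U') * B' →
      ∀ i, evalVec v (u i) = evalVec v e * (b ^ i * fullInvariants p' lam' 1 i) := by
    intro v p' lam' A' B' U' hp' hlam' h' hU' a b c a' b' c' hx hy i
    rw [hueval, heval, fullInvariants]
    split_ifs with hi
    · rw [hx, hy, matComm_conj h'.mul_eq_one', traceless_conj h'.mul_eq_one,
        matComm_conj h'.mul_eq_one', matComm_eigen hU', matComm_traceless_eigen hU', hi]
      simp only [Matrix.mul_smul, Matrix.smul_mul, Matrix.smul_apply, smul_eq_mul]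
      ring
    · rw [hx, specCoeff_conj h'.mul_eq_one, specCoeff_add_eigen hp' hlam' hU']
  have key : ∀ ij, rayRel (fullInvariants l mu 1) (traceSq (weightMatrix l))
      (fun i => evalVec v₀ (u i)) (evalVec v₀ e) (evalVec v₀ (traceSq (ξ C))) ij = 0 := by
    intro ij
    have := evalVec_eq_zero_of_forall_isAffForm hl hl3 hcl
      (G := δ * rayRel (fullInvariants l mu 1) (traceSq (weightMatrix l)) u e (traceSq (ξ C)) ij) ?_
    · rwa [map_mul, ← hv₀, hδ, one_mul, map_rayRel (evalVec v₀) (evalVec_algebraMap v₀)] at this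
    · intro v A' B' h' h3'
      rw [map_mul]
      by_cases hδv : evalVec v δ = 0
      · rw [hδv, zero_mul]
      rw [map_rayRel (evalVec v) (evalVec_algebraMap v)]
      obtain ⟨hfin, hmem, -⟩ := hpar v hδv (by rwa [ker_tangentPairing, ker_tangentPairing, h3])
      rw [ker_tangentPairing, ker_tangentPairing, h3] at hfin
      obtain ⟨U', -, -, hU', hspan⟩ := h'.exists_eigen hl hmu hfin
      obtain ⟨a, b, c, hx⟩ := hspan _ (hmem C hCm)
      obtain ⟨a', b', c', hy⟩ := hspan _ (hmem D hUm)
      rw [rayRel_eq_zero (b := b), mul_zero]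
      · exact hray v l mu A' B' U' hl hmu h' hU' a b c a' b' c' hx hy
      · rw [← traceSq_map, hξ, hx, traceSq_conj h'.mul_eq_one, traceSq_add_eigen hl hmu hU']
  have hC0 : L v₀ C = A * ((0 : ℂ) • (1 : Matrix (Fin (m + 4)) (Fin (m + 4)) ℂ) +
      (1 : ℂ) • weightMatrix p + (0 : ℂ) • U) * B := by
    rw [hL v₀ C hCm, hδ, hC]; simp
  have hD0 : L v₀ D = A * ((0 : ℂ) • (1 : Matrix (Fin (m + 4)) (Fin (m + 4)) ℂ) +
      (0 : ℂ) • weightMatrix p + (1 : ℂ) • U) * B := by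
    rw [hL v₀ D hUm, hδ, hD]; simp
  have hu0 := hray v₀ p lam A B U hp hlam h hU _ _ _ _ _ _ hC0 hD0
  have he0 : evalVec v₀ e ≠ 0 := by
    rw [heval, hC0, hD0, matComm_conj h.mul_eq_one', matComm_eigen hU, Matrix.mul_smul,
      Matrix.smul_mul, Matrix.smul_apply, smul_eq_mul]
    refine mul_ne_zero ?_ hrs
    simpa using hlam
  obtain ⟨t, ht⟩ := exists_ray_of_rayRel he0 (traceSq_weightMatrix_ne_zero hl)
    (by rw [hu0]; simp [fullInvariants, specCoeff_zero])
    (by simp [fullInvariants, specCoeff_zero]) key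
  refine eq_or_conj_of_fullInvariants hp hl he0 (t := t) fun i => ?_
  rw [← ht i, hu0, one_pow, one_mul]

end Eigenmatrix

section Elimination

open Polynomial

theorem coeff_of_eval_inv {F h : ℂ[X]} {e : ℕ} (H : ∀ s : ℂ, s ≠ 0 → F.eval s = s ^ e * h.eval s⁻¹) :
    F.natDegree ≤ e ∧ F.coeff e = h.coeff 0 := by
  set K := h.natDegree with hK
  have h1 : F * X ^ K = X ^ e * h.reflect K := by
    have h2 : F * X ^ K - X ^ e * h.reflect K = 0 := by
      refine Polynomial.eq_zero_of_infinite_isRoot _ ?_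
      refine Set.Infinite.mono (s := {0}ᶜ) (fun s hs => ?_) (Set.finite_singleton _).infinite_compl
      have hs : s ≠ 0 := hs
      have h3 : (h.reflect K).eval s = s ^ K * h.eval s⁻¹ := by
        let _ : Invertible s⁻¹ := invertibleOfNonzero (inv_ne_zero hs)
        have := Polynomial.eval₂_reflect_mul_pow (RingHom.id ℂ) s⁻¹ K h le_rfl
        rw [invOf_eq_inv, inv_inv] at this
        change eval s (h.reflect K) * s⁻¹ ^ K = eval s⁻¹ h at this
        rw [← this, inv_pow]
        field_simp
      rw [Set.mem_ofPred_eq, IsRoot, eval_sub, eval_mul, eval_mul, eval_pow, eval_pow, eval_X, H s hs,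
        h3]
      ring
    exact sub_eq_zero.1 h2
  have h4 : ∀ n, F.coeff (n + e) = (h.reflect K).coeff (n + K) := by
    intro n
    have := congrArg (fun G => G.coeff (n + e + K)) h1
    simp only [coeff_mul_X_pow] at this
    rw [this, show n + e + K = n + K + e by ring, coeff_X_pow_mul]
  refine ⟨Polynomial.natDegree_le_iff_coeff_eq_zero.2 fun n hn => ?_, ?_⟩
  · have := h4 (n - e)
    rw [Nat.sub_add_cancel hn.le] at this
    rw [this, coeff_reflect, revAt_eq_self_of_lt (by omega)]
    exact coeff_eq_zero_of_natDegree_lt (by omega)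
  · have := h4 0
    rw [zero_add, zero_add] at this
    rw [this, coeff_reflect, revAt_le le_rfl, Nat.sub_self]

variable {V : Type*} [AddCommGroup V] [Module ℂ V]

/-- Elimination of a common root of a family of polynomials with coefficients depending on a
parameter. -/
theorem exists_elimination {ι : Type*} (f : ι → (PolyFun V)[X]) (i₀ : ι) (v₀ : V) (e : ℕ)
    (hdeg : ∀ v, ((f i₀).map (evalVec v)).natDegree ≤ e)
    (hlead : ((f i₀).map (evalVec v₀)).coeff e ≠ 0)
    (hroot : ∀ s, ∃ i, ((f i).map (evalVec v₀)).eval s ≠ 0) :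
    ∃ G : PolyFun V, evalVec v₀ G ≠ 0 ∧ ∀ v s, (∀ i, ((f i).map (evalVec v)).eval s = 0) →
      ((f i₀).map (evalVec v)).coeff e ≠ 0 → evalVec v G = 0 := by
  have htop : Ideal.span (Set.range fun i => (f i).map (evalVec v₀)) = ⊤ := by
    set I := Ideal.span (Set.range fun i => (f i).map (evalVec v₀))
    have hI := Ideal.span_singleton_generator I
    set g := Submodule.IsPrincipal.generator I
    rw [← hI, Ideal.span_singleton_eq_top]
    by_contra hg
    obtain ⟨s, hs⟩ : ∃ s, g.eval s = 0 := by
      by_cases hg0 : g = 0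
      · exact ⟨0, by rw [hg0, eval_zero]⟩
      · exact IsAlgClosed.exists_root g fun h => hg (isUnit_iff_degree_eq_zero.2 h)
    obtain ⟨i, hi⟩ := hroot s
    have hmem : (f i).map (evalVec v₀) ∈ I := Ideal.subset_span ⟨i, rfl⟩
    rw [← hI, Ideal.mem_span_singleton] at hmem
    obtain ⟨r, hr⟩ := hmem
    exact hi (by rw [hr, eval_mul, hs, zero_mul])
  obtain ⟨c, hc⟩ := (Finsupp.mem_ideal_span_range_iff_exists_finsupp).1
    (htop ▸ Submodule.mem_top : (1 : ℂ[X]) ∈ Ideal.span (Set.range fun i => (f i).map (evalVec v₀)))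
  let g : (PolyFun V)[X] := c.sum fun i a => a.map MvPolynomial.C * f i
  have hg : ∀ v, g.map (evalVec v) = c.sum fun i a => a * (f i).map (evalVec v) := by
    intro v
    simp only [g, Finsupp.sum, Polynomial.map_sum, Polynomial.map_mul, Polynomial.map_map]
    refine Finset.sum_congr rfl fun i _ => ?_
    have : (evalVec v).comp MvPolynomial.C = RingHom.id ℂ := by
      ext x; exact evalVec_C v x
    rw [this, Polynomial.map_id]
  have hg0 : g.map (evalVec v₀) = 1 := by rw [hg, hc]
  refine ⟨resultant (f i₀) g e g.natDegree, ?_, fun v s hs hv => ?_⟩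
  · rw [← resultant_map_map, hg0, resultant_one_right]
    exact pow_ne_zero _ hlead
  · rw [← resultant_map_map]
    have hgs : (g.map (evalVec v)).eval s = 0 := by
      rw [hg, Finsupp.sum, eval_finsetSum]
      exact Finset.sum_eq_zero fun i _ => by rw [eval_mul, hs, mul_zero]
    have he : e ≠ 0 := by
      rintro rfl
      apply hv
      have h1 := eq_C_of_natDegree_le_zero (hdeg v)
      have h2 := hs i₀
      rw [h1, eval_C] at h2
      exact h2
    obtain ⟨p, q, -, -, hpq⟩ := exists_mul_add_mul_eq_C_resultant ((f i₀).map (evalVec v))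
      (g.map (evalVec v)) (hdeg v) (natDegree_map_le (p := g)) (Or.inl he)
    have := congrArg (Polynomial.eval s) hpq
    rw [eval_add, eval_mul, eval_mul, hs, hgs, zero_mul, zero_mul, add_zero, eval_C] at this
    exact this.symm

end Elimination

section SpectralRelations

open Polynomial

variable {m : ℕ} {p l : Fin (m + 3) → ℤ} {R S : Type*} [CommRing R] [CommRing S] [Algebra ℂ R]
  [Algebra ℂ S]

/-- The relations satisfied by the spectral invariants of matrices `t • W`, where `W` has the
spectrum `(l₁, …, lₙ, 0)`. -/
noncomputable def specRel (l : Fin (m + 3) → ℤ) (ij : ℕ × ℕ)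
    (x : Matrix (Fin (m + 4)) (Fin (m + 4)) R) : R :=
  rayRel (fun i => specCoeff i (weightMatrix l)) (traceSq (weightMatrix l))
    (fun i => specCoeff i x) 1 (traceSq x) ij

theorem specRel_map (f : R →+* S) (hf : ∀ c, f (algebraMap ℂ R c) = algebraMap ℂ S c) (ij : ℕ × ℕ)
    (x : Matrix (Fin (m + 4)) (Fin (m + 4)) R) : specRel l ij (x.map f) = f (specRel l ij x) := by
  rw [specRel, specRel, map_rayRel f hf]
  simp only [specCoeff_map, traceSq_map, map_one]

theorem specRel_add_smul (a b : R) (x : Matrix (Fin (m + 4)) (Fin (m + 4)) R) (ij : ℕ × ℕ) :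
    specRel l ij (a • (1 : Matrix (Fin (m + 4)) (Fin (m + 4)) R) + b • x) =
      b ^ (ij.1 + ij.2) * specRel l ij x := by
  rw [specRel, specRel, rayRel, rayRel]
  split_ifs with h
  · have h1 : b ^ (ij.1 + ij.2) = (b ^ 2) ^ ((ij.1 + ij.2) / 2) := by
      rw [← pow_mul, Nat.mul_div_cancel' h.two_dvd]
    have h2 : b ^ ij.1 * b ^ ij.2 = (b ^ 2) ^ ((ij.1 + ij.2) / 2) := by rw [← pow_add, h1]
    simp only [specCoeff_add_smul, traceSq_add_smul, h1, mul_pow]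
    linear_combination (specCoeff ij.1 x * specCoeff ij.2 x *
      algebraMap ℂ R (traceSq (weightMatrix l) ^ ((ij.1 + ij.2) / 2))) * h2
  · rw [mul_zero]

theorem specRel_smul (b : R) (x : Matrix (Fin (m + 4)) (Fin (m + 4)) R) (ij : ℕ × ℕ) :
    specRel l ij (b • x) = b ^ (ij.1 + ij.2) * specRel l ij x := by
  have := specRel_add_smul (l := l) 0 b x ij
  rwa [zero_smul, zero_add] at this

theorem specRel_eq_zero {b : ℂ} {x : Matrix (Fin (m + 4)) (Fin (m + 4)) ℂ}
    (h : ∀ i, specCoeff i x = b ^ i * specCoeff i (weightMatrix l))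
    (h' : traceSq x = b ^ 2 * traceSq (weightMatrix l)) (ij : ℕ × ℕ) : specRel l ij x = 0 :=
  rayRel_eq_zero (b := b) (fun i => by rw [h, one_mul]) h' ij

theorem exists_ray_of_specRel (hl : IsWeightTuple l) {x : Matrix (Fin (m + 4)) (Fin (m + 4)) ℂ}
    (h : ∀ ij, specRel l ij x = 0) :
    ∃ t : ℂ, ∀ i, specCoeff i x = t ^ i * specCoeff i (weightMatrix l) := by
  obtain ⟨t, ht⟩ := exists_ray_of_rayRel one_ne_zero (traceSq_weightMatrix_ne_zero hl)
    (u := fun i => specCoeff i x) (γ := fun i => specCoeff i (weightMatrix l))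
    (specCoeff_zero x) (specCoeff_zero _) h
  exact ⟨t, fun i => by rw [ht, one_mul]⟩

/-- The generic element of a pencil of matrices. -/
noncomputable def pencil (x y : Matrix (Fin (m + 4)) (Fin (m + 4)) R) :
    Matrix (Fin (m + 4)) (Fin (m + 4)) R[X] := (X : R[X]) • x.map C + y.map C

theorem pencil_map {R S : Type*} [CommRing R] [CommRing S] (f : R →+* S)
    (x y : Matrix (Fin (m + 4)) (Fin (m + 4)) R) :
    (pencil x y).map (mapRingHom f) = pencil (x.map f) (y.map f) := by
  ext i j : 2
  simp [pencil]

theorem specRel_pencil_map (f : R →+* S) (hf : ∀ c, f (algebraMap ℂ R c) = algebraMap ℂ S c)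
    (x y : Matrix (Fin (m + 4)) (Fin (m + 4)) R) (ij : ℕ × ℕ) :
    (specRel l ij (pencil x y)).map f = specRel l ij (pencil (x.map f) (y.map f)) := by
  rw [← pencil_map, specRel_map]
  · rfl
  · intro c
    rw [Polynomial.algebraMap_apply, Polynomial.algebraMap_apply, coe_mapRingHom, map_C, hf]

theorem eval_specRel_pencil (x y : Matrix (Fin (m + 4)) (Fin (m + 4)) ℂ) (ij : ℕ × ℕ) (s : ℂ) :
    (specRel l ij (pencil x y)).eval s = specRel l ij (s • x + y) := by
  rw [← coe_evalRingHom, ← specRel_map]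
  · congr 1
    ext i j
    simp only [pencil, Matrix.map_apply, Matrix.add_apply, Matrix.smul_apply, smul_eq_mul,
      coe_evalRingHom, eval_add, eval_mul, eval_X, eval_C]
  · intro c
    rw [coe_evalRingHom, Polynomial.algebraMap_apply, eval_C]

theorem specRel_pencil_coeff (x y : Matrix (Fin (m + 4)) (Fin (m + 4)) ℂ) (ij : ℕ × ℕ) :
    (specRel l ij (pencil x y)).natDegree ≤ ij.1 + ij.2 ∧
      (specRel l ij (pencil x y)).coeff (ij.1 + ij.2) = specRel l ij x := by
  have h := coeff_of_eval_inv (F := specRel l ij (pencil x y)) (h := specRel l ij (pencil y x))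
    (e := ij.1 + ij.2) fun s hs => by
      rw [eval_specRel_pencil, eval_specRel_pencil, ← specRel_smul, smul_add, smul_smul,
        mul_inv_cancel₀ hs, one_smul, add_comm]
  refine ⟨h.1, h.2.trans ?_⟩
  rw [coeff_zero_eq_eval_zero, eval_specRel_pencil, zero_smul, zero_add]

/-- The case of a foliation of weight zero whose tangent algebra is spanned by `1`, the adapted
field and a generic field `y`. -/
theorem weights_of_generic (hp : IsWeightTuple p) (hl : IsWeightTuple l) {mu : ℤ}
    {F : ℙ ℂ (projForms m (1 + 1 + 1))} {x y : Matrix (Fin (m + 4)) (Fin (m + 4)) ℂ}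
    (hx : x ∈ tangentFields (F.rep : Form (m + 4) (m + 1)))
    (hxp : ∀ i, specCoeff i x = specCoeff i (weightMatrix p))
    (hy : y ∈ tangentFields (F.rep : Form (m + 4) (m + 1)))
    (h3 : Module.finrank ℂ (tangentFields (F.rep : Form (m + 4) (m + 1))) = 3)
    (hspan : ∀ Z ∈ tangentFields (F.rep : Form (m + 4) (m + 1)), ∃ a b c : ℂ,
      Z = a • (1 : Matrix (Fin (m + 4)) (Fin (m + 4)) ℂ) + b • x + c • y)
    (hgen : ∀ s t : ℂ, ¬ ∀ i, specCoeff i (s • x + y) = t ^ i * specCoeff i (weightMatrix l))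
    (hl3 : ∀ F ∈ AffFoliations m l mu (1 + 1),
      3 ≤ Module.finrank ℂ (tangentFields (F.rep : Form (m + 4) (m + 1))))
    (hcl : F ∈ zariskiClosure (AffFoliations m l mu (1 + 1))) :
    (l = p ∧ mu = 0) ∨ (l = conjTuple p ∧ mu = conjWeight p 0 1) := by
  set v₀ := F.rep with hv₀
  obtain ⟨δ, ξ, L, hξ, hδ, hL, hpar⟩ := exists_kernel_parametrization (tangentPairing m (1 + 1 + 1)) v₀
  have hL₀ : ∀ k ∈ tangentFields (v₀ : Form (m + 4) (m + 1)), L v₀ k = k := fun k hk => by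
    rw [hL v₀ k hk, hδ, one_smul]
  by_cases hmu : mu = 0
  · subst hmu
    by_cases hrel : ∀ ij, specRel l ij x = 0
    · obtain ⟨t, ht⟩ := exists_ray_of_specRel hl hrel
      exact weights_eq_of_ray (lam := 0) (d := 1) hp hl (t := t) (fun i => by rw [← hxp, ht])
        (by simp [tracelessWeight])
    exfalso
    push Not at hrel
    obtain ⟨ij, hij⟩ := hrel
    let f : ℕ × ℕ → (PolyFun (projForms m (1 + 1 + 1)))[X] := fun ij =>
      specRel l ij (pencil (ξ x) (ξ y))
    have hf : ∀ ij v, (f ij).map (evalVec v) = specRel l ij (pencil (L v x) (L v y)) := by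
      intro ij v
      rw [specRel_pencil_map _ (evalVec_algebraMap v), hξ, hξ]
    obtain ⟨G, hG0, hG⟩ := exists_elimination f ij v₀ (ij.1 + ij.2)
      (fun v => by rw [hf]; exact (specRel_pencil_coeff _ _ _).1)
      (by rwa [hf, (specRel_pencil_coeff _ _ _).2, hL₀ x hx])
      (fun s => by
        by_contra! hcon
        obtain ⟨t, ht⟩ := exists_ray_of_specRel hl (x := s • x + y) fun ij => by
          rw [← eval_specRel_pencil, ← hcon ij, hf, hL₀ x hx, hL₀ y hy]
        exact hgen s t ht)
    have := evalVec_eq_zero_of_forall_isAffForm hl hl3 hcl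
      (G := δ * specRel l ij (ξ x) * G) ?_
    · rw [← hv₀, map_mul, map_mul, hδ, one_mul, ← specRel_map _ (evalVec_algebraMap v₀), hξ,
        hL₀ x hx] at this
      exact mul_ne_zero hij hG0 this
    · intro v A B h h3'
      rw [map_mul, map_mul, ← specRel_map _ (evalVec_algebraMap v), hξ]
      by_cases hδv : evalVec v δ = 0
      · rw [hδv, zero_mul, zero_mul]
      by_cases hlead : specRel l ij (L v x) = 0
      · rw [hlead, mul_zero, zero_mul]
      set W := A * weightMatrix l * B with hW
      have hWm : W ∈ tangentFields (v : Form (m + 4) (m + 1)) :=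
        h.adapted.mem_tangentFields h.mul_eq_one h.mul_eq_one'
      have hWrel : ∀ ij, specRel l ij W = 0 := specRel_eq_zero (b := 1)
        (fun i => by rw [one_pow, one_mul, hW, specCoeff_conj h.mul_eq_one])
        (by rw [one_pow, one_mul, hW, traceSq_conj h.mul_eq_one])
      obtain ⟨-, -, hsurj⟩ := hpar v hδv (by rwa [ker_tangentPairing, ker_tangentPairing, h3])
      obtain ⟨k, hk, hkW⟩ := hsurj W hWm
      obtain ⟨a, b, c, rfl⟩ := hspan k hk
      rw [map_add, map_add, map_smul, map_smul, map_smul, hL v 1 h.form.one_mem, smul_smul] at hkW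
      by_cases hc : c = 0
      · rw [hc, zero_smul, add_zero] at hkW
        have h1 := hWrel ij
        rw [← hkW, specRel_add_smul] at h1
        have hb : b ≠ 0 := by
          rintro rfl
          rw [zero_smul, add_zero] at hkW
          have h2 := (LinearIndependent.pair_iff.1
            (linearIndependent_one_conj (A := A) hl h.mul_eq_one')) (a * evalVec v δ) (-1)
            (by rw [← hW, ← hkW]; module)
          exact neg_ne_zero.2 one_ne_zero h2.2
        exact absurd ((mul_eq_zero.1 h1).resolve_left (pow_ne_zero _ hb)) hlead
      · rw [hG v (b / c) (fun ij => ?_) (by rwa [hf, (specRel_pencil_coeff _ _ _).2]), mul_zero]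
        have h1 := hWrel ij
        have h2 : W = (a * evalVec v δ) • (1 : Matrix (Fin (m + 4)) (Fin (m + 4)) ℂ) +
            c • ((b / c) • L v x + L v y) := by
          rw [← hkW, smul_add, smul_smul, mul_div_cancel₀ _ hc, add_assoc]
        rw [h2, specRel_add_smul] at h1
        rw [hf, eval_specRel_pencil]
        exact (mul_eq_zero.1 h1).resolve_left (pow_ne_zero _ hc)
  · exfalso
    have key : ∀ ij, specRel l ij y = 0 := by
      intro ij
      have := evalVec_eq_zero_of_forall_isAffForm hl hl3 hcl (G := δ * specRel l ij (ξ y)) ?_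
      · rwa [← hv₀, map_mul, hδ, one_mul, ← specRel_map _ (evalVec_algebraMap v₀), hξ,
          hL₀ y hy] at this
      · intro v A B h h3'
        rw [map_mul, ← specRel_map _ (evalVec_algebraMap v), hξ]
        by_cases hδv : evalVec v δ = 0
        · rw [hδv, zero_mul]
        obtain ⟨hfin, hmem, -⟩ := hpar v hδv (by rwa [ker_tangentPairing, ker_tangentPairing, h3])
        rw [ker_tangentPairing, ker_tangentPairing, h3] at hfin
        obtain ⟨U, -, -, hU, hspan'⟩ := h.exists_eigen hl hmu hfin
        obtain ⟨a, b, c, hy'⟩ := hspan' _ (hmem y hy)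
        rw [specRel_eq_zero (b := b), mul_zero]
        · intro i
          rw [hy', specCoeff_conj h.mul_eq_one, specCoeff_add_eigen hl hmu hU]
        · rw [hy', traceSq_conj h.mul_eq_one, traceSq_add_eigen hl hmu hU]
    obtain ⟨t, ht⟩ := exists_ray_of_specRel hl key
    exact hgen 0 t fun i => by rw [zero_smul, zero_add, ht]

end SpectralRelations

end AffFoliation

namespace AffFoliation

open MvPolynomial

section Wedge

variable {N k : ℕ}

theorem wedgeOne_apply (η : (Fin N → ℂ) →ₗ[ℂ] Poly N) (θ : Form N k)
    (v : Fin (k + 1) → Fin N → ℂ) : wedgeOne η θ v =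
      ∑ i : Fin (k + 1), (-1 : ℤ) ^ (i : ℕ) • (η (v i) * θ (i.removeNth v)) := by
  rw [wedgeOne, AlternatingMap.alternatizeUncurryFin_apply]
  rfl

theorem wedgeOne_smul (η : (Fin N → ℂ) →ₗ[ℂ] Poly N) (c : ℂ) (θ : Form N k) :
    wedgeOne η (c • θ) = c • wedgeOne η θ := by
  ext1 v
  simp only [AlternatingMap.smul_apply, wedgeOne_apply, Finset.smul_sum, mul_smul_comm]
  exact Finset.sum_congr rfl fun i _ => smul_comm _ _ _

theorem wedgeOne_zero (η : (Fin N → ℂ) →ₗ[ℂ] Poly N) : wedgeOne η (0 : Form N k) = 0 := by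
  simpa using wedgeOne_smul η 0 (0 : Form N k)

/-- The interior product is an antiderivation. -/
theorem contract_wedgeOne {η : (Fin N → ℂ) →ₗ[ℂ] Poly N} {X : VField N}
    (hη : ∑ j, X j * η (Pi.single j 1) = 0) (θ : Form N (k + 1)) :
    contract X (wedgeOne η θ) = -wedgeOne η (contract X θ) := by
  ext1 v
  rw [AlternatingMap.neg_apply, wedgeOne_apply]
  simp only [contract_apply, wedgeOne_apply, Fin.sum_univ_succ (n := k + 1)]
  simp only [Fin.val_zero, pow_zero, one_smul, Matrix.cons_val_zero, Matrix.cons_val_succ,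
    Fin.val_succ, pow_succ, mul_add, Finset.sum_add_distrib]
  have h1 : ∀ j, Fin.removeNth 0 (Matrix.vecCons (Pi.single j (1 : ℂ)) v) = v := fun j => rfl
  have h2 : ∀ j (i : Fin (k + 1)), Fin.removeNth i.succ (Matrix.vecCons (Pi.single j (1 : ℂ)) v) =
      Matrix.vecCons (Pi.single j 1) (i.removeNth v) := fun j i => by
    ext t : 1
    refine Fin.cases ?_ (fun t => ?_) t
    · rfl
    · simp [Fin.removeNth, Fin.succ_succAbove_succ]
  simp only [h1, h2, ← mul_assoc, ← Finset.sum_mul, hη, zero_mul, zero_add]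
  simp only [Finset.mul_sum]
  rw [Finset.sum_comm, ← Finset.sum_neg_distrib]
  refine Finset.sum_congr rfl fun i _ => ?_
  rw [Finset.smul_sum, ← Finset.sum_neg_distrib]
  refine Finset.sum_congr rfl fun j _ => ?_
  simp only [zsmul_eq_mul]
  push_cast
  ring

end Wedge

section Diagonal

variable {m : ℕ} {p : Fin (m + 3) → ℤ} {y : Fin (m + 4) → ℂ}

theorem zero_ne_two_fin : (0 : Fin (m + 4)) ≠ 2 := by
  rw [Ne, Fin.ext_iff, Fin.val_two]; simp

theorem one_ne_two_fin : (1 : Fin (m + 4)) ≠ 2 := by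
  rw [Ne, Fin.ext_iff, Fin.val_two, Fin.val_one]; simp

/-- The tuples `(1, …, 1)`, `(p₁, …, pₙ, 0)` and `y` are in general position. -/
def InGeneralPosition (p : Fin (m + 3) → ℤ) (y : Fin (m + 4) → ℂ) : Prop :=
  ∀ i j k, i ≠ j → i ≠ k → j ≠ k →
    ((extWeights p j : ℂ) - extWeights p i) * (y k - y i) -
      ((extWeights p k : ℂ) - extWeights p i) * (y j - y i) ≠ 0

/-- The form `i_R i_S i_Y vol`, where `S` and `Y` are diagonal. -/
noncomputable def diagForm (p : Fin (m + 3) → ℤ) (y : Fin (m + 4) → ℂ) : Form (m + 4) (m + 1) :=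
  tripleForm (weightMatrix p) (Matrix.diagonal y)

theorem linearIndependent_diag (hp : IsWeightTuple p) (hy : InGeneralPosition p y)
    {x : Fin (m + 4) → ℂ} {i j k : Fin (m + 4)} (hij : i ≠ j) (hik : i ≠ k) (hjk : j ≠ k)
    (hx : x i * x j * x k ≠ 0) :
    LinearIndependent ℂ ![(Matrix.diagonal y).mulVec x, (weightMatrix p).mulVec x, x] := by
  have hi : x i ≠ 0 := fun h => hx (by rw [h]; ring)
  have hj : x j ≠ 0 := fun h => hx (by rw [h]; ring)
  have hk : x k ≠ 0 := fun h => hx (by rw [h]; ring)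
  rw [Fintype.linearIndependent_iff]
  intro g hg
  rw [Fin.sum_univ_three] at hg
  have h1 : ∀ t, x t ≠ 0 → g 0 * y t + g 1 * extWeights p t + g 2 = 0 := by
    intro t ht
    have := congrFun hg t
    simp [weightMatrix, Matrix.mulVec_diagonal] at this
    apply mul_right_cancel₀ ht
    linear_combination this
  have h0 : g 0 = 0 := by
    have := hy i j k hij hik hjk
    refine (mul_eq_zero.1 (?_ : g 0 * _ = 0)).resolve_right this
    linear_combination ((extWeights p j : ℂ) - extWeights p i) * (h1 k hk - h1 i hi) -
      ((extWeights p k : ℂ) - extWeights p i) * (h1 j hj - h1 i hi)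
  have h2 : g 1 = 0 := by
    have : (extWeights p i : ℂ) - extWeights p j ≠ 0 :=
      sub_ne_zero.2 fun h => hij (hp.cast_injective h)
    refine (mul_eq_zero.1 (?_ : g 1 * _ = 0)).resolve_right this
    linear_combination h1 i hi - h1 j hj - (y i - y j) * h0
  have h3 : g 2 = 0 := by
    have := h1 i hi
    rwa [h0, h2, zero_mul, zero_mul, zero_add, zero_add] at this
  intro t
  fin_cases t <;> assumption

theorem mul_eq_zero_of_formAt_diagForm (hp : IsWeightTuple p) (hy : InGeneralPosition p y)
    {x : Fin (m + 4) → ℂ} (hx : ∀ v, formAt x (diagForm p y) v = 0) {i j k : Fin (m + 4)}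
    (hij : i ≠ j) (hik : i ≠ k) (hjk : j ≠ k) : x i * x j * x k = 0 := by
  by_contra h
  refine dependent_of_det_cons (fun v => ?_) (linearIndependent_diag hp hy hij hik hjk h)
  rw [← formAt_tripleForm]
  exact hx v

theorem diagForm_ne_zero (hp : IsWeightTuple p) (hy : InGeneralPosition p y) :
    diagForm p y ≠ 0 := by
  intro h
  have := mul_eq_zero_of_formAt_diagForm hp hy (x := 1) (fun v => by rw [h, formAt_zero])
    (i := 0) (j := 1) (k := 2) zero_ne_one zero_ne_two_fin one_ne_two_fin
  simp at this

theorem two_le_height_of_X_mem {σ : Type*} {J : Ideal (MvPolynomial σ ℂ)} [J.IsPrime] {a b : σ}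
    (hab : a ≠ b) (ha : X a ∈ J) (hb : X b ∈ J) : 2 ≤ J.height := by
  have hpr : (Ideal.span {(X a : MvPolynomial σ ℂ)}).IsPrime :=
    (Ideal.span_singleton_prime (X_ne_zero a)).2 (MvPolynomial.X_prime)
  have h1 : (⊥ : Ideal (MvPolynomial σ ℂ)) < Ideal.span {(X a : MvPolynomial σ ℂ)} := by
    rw [bot_lt_iff_ne_bot, Ne, Ideal.span_singleton_eq_bot]
    exact X_ne_zero a
  have h2 : Ideal.span {(X a : MvPolynomial σ ℂ)} < J := by
    refine lt_of_le_of_ne ((Ideal.span_singleton_le_iff_mem _).2 ha) fun h => ?_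
    rw [← h, Ideal.mem_span_singleton, X_dvd_X] at hb
    exact hab hb
  have h3 := Ideal.height_add_one_le_of_lt_of_isPrime h1
  have h4 := Ideal.height_add_one_le_of_lt_of_isPrime h2
  calc (2 : ℕ∞) = 0 + 1 + 1 := by norm_num
    _ ≤ Ideal.height (⊥ : Ideal (MvPolynomial σ ℂ)) + 1 + 1 := by gcongr; exact zero_le
    _ ≤ (Ideal.span {(X a : MvPolynomial σ ℂ)}).height + 1 := by gcongr
    _ ≤ J.height := h4

theorem singCodimGeTwo_diagForm (hp : IsWeightTuple p) (hy : InGeneralPosition p y) :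
    SingCodimGeTwo (diagForm p y) := by
  rw [SingCodimGeTwo, Ideal.height_eq_inf_minimalPrimes]
  refine le_iInf₂ fun J hJ => ?_
  have hJp := hJ.isPrime
  have hmem : ∀ i j k : Fin (m + 4), i ≠ j → i ≠ k → j ≠ k → (X i * X j * X k : Poly (m + 4)) ∈ J := by
    intro i j k hij hik hjk
    have h1 : (X i * X j * X k : Poly (m + 4)) ∈
        (Ideal.span (Set.range (diagForm p y))).radical := by
      rw [← vanishingIdeal_zeroLocus_eq_radical (K := ℂ), mem_vanishingIdeal_iff]
      intro x hx
      rw [map_mul, map_mul, aeval_X, aeval_X, aeval_X]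
      refine mul_eq_zero_of_formAt_diagForm hp hy (fun v => ?_) hij hik hjk
      rw [formAt_apply]
      have := hx _ (Ideal.subset_span ⟨v, rfl⟩)
      rwa [aeval_eq_eval] at this
    exact (hJp.isRadical.radical_le_iff.2 hJ.le) h1
  have key : ∀ i j k : Fin (m + 4), i ≠ j → i ≠ k → j ≠ k →
      (X i : Poly (m + 4)) ∈ J ∨ (X j : Poly (m + 4)) ∈ J ∨ (X k : Poly (m + 4)) ∈ J := by
    intro i j k hij hik hjk
    rcases hJp.mem_or_mem (hmem i j k hij hik hjk) with h | h
    · exact (hJp.mem_or_mem h).imp_right Or.inl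
    · exact Or.inr (Or.inr h)
  obtain ⟨a, ha⟩ : ∃ a, (X a : Poly (m + 4)) ∈ J := by
    rcases key 0 1 2 zero_ne_one zero_ne_two_fin one_ne_two_fin with h | h | h <;>
      exact ⟨_, h⟩
  have hcard : 3 ≤ (Finset.univ.erase a).card := by
    rw [Finset.card_erase_of_mem (Finset.mem_univ _), Finset.card_univ, Fintype.card_fin]; omega
  obtain ⟨T, hT, hT3⟩ := Finset.exists_subset_card_eq hcard
  obtain ⟨i, j, k, hij, hik, hjk, rfl⟩ := Finset.card_eq_three.1 hT3
  have hne : ∀ t ∈ ({i, j, k} : Finset (Fin (m + 4))), a ≠ t := fun t ht =>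
    (Finset.ne_of_mem_erase (hT ht)).symm
  rcases key i j k hij hik hjk with h | h | h
  · exact two_le_height_of_X_mem (hne i (by simp)) ha h
  · exact two_le_height_of_X_mem (hne j (by simp)) ha h
  · exact two_le_height_of_X_mem (hne k (by simp)) ha h

theorem isAdapted_diagForm : IsAdapted (1 : Matrix (Fin (m + 4)) (Fin (m + 4)) ℂ) p
    (formWeight p 0) (diagForm p y) := by
  have h1 : contract (diagField (extWeights p)) (diagForm p y) = 0 := by
    rw [← linField_weightMatrix]
    exact contract_tripleForm_left _ _
  refine ⟨by rw [affPull_one, h1], ?_⟩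
  rw [affPull_one, contract_extD_eq_smul_iff h1]
  intro I
  have h2 := eulerD_tripleForm p (Matrix.diagonal y) I
  have h3 : Matrix.diagonal y * weightMatrix p - weightMatrix p * Matrix.diagonal y = 0 := by
    rw [weightMatrix, Matrix.diagonal_mul_diagonal, Matrix.diagonal_mul_diagonal, sub_eq_zero]
    congr 1
    ext i
    ring
  have h4 : tripleForm (weightMatrix p) 0 = 0 := by
    simpa using tripleForm_smul 0 (weightMatrix p) 0
  rw [h3, h4, AlternatingMap.zero_apply, add_zero] at h2
  rw [formWeight, zero_add, ← sum_extWeights]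
  push_cast
  exact h2

theorem integrable_diagForm (hp : IsWeightTuple p) (hy : InGeneralPosition p y) :
    Integrable (diagForm p y) := by
  intro u j
  set ω := diagForm p y with hω
  set η := ω.toMultilinearMap.toLinearMap u j with hη
  have hR : contract (radial _) ω = 0 := contract_tripleForm_radial _ _
  have hS : contract (linField (weightMatrix p)) ω = 0 := contract_tripleForm_left _ _
  have hY : contract (linField (Matrix.diagonal y)) ω = 0 := contract_tripleForm_right _ _
  have hη0 : ∀ Z : VField (m + 4), contract Z ω = 0 → ∑ i, Z i * η (Pi.single i 1) = 0 := by
    intro Z hZ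
    refine MvPolynomial.funext fun x => ?_
    have h1 := formAt_vecCons_eq_zero hZ x (v := Function.update u j (fieldAt x Z)) (i := j)
      (Function.update_self _ _ _)
    have h2 : ∀ w, formAt x ω (Function.update u j w) =
        (formAt x ω).toMultilinearMap.toLinearMap u j w := fun w => rfl
    have h3 : fieldAt x Z = ∑ t, fieldAt x Z t • (Pi.single t 1 : Fin (m + 4) → ℂ) := by
      ext i; simp [Finset.sum_apply, Pi.single_apply]
    rw [h2, h3, map_sum] at h1
    rw [map_zero, ← h1, map_sum]
    refine Finset.sum_congr rfl fun t _ => ?_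
    rw [map_smul, ← h2, formAt_apply, map_mul]
    rfl
  have key : ∀ {k r : ℕ} (θ : Form (m + 4) (k + 1)) (Z : Fin r → VField (m + 4)),
      (∀ i, contract (Z i) θ = 0) → m + 4 < k + 1 + r →
      (∀ x : Fin (m + 4) → ℂ, x 0 * x 1 * x 2 ≠ 0 →
        LinearIndependent ℂ fun i => fieldAt x (Z i)) → θ = 0 := by
    intro k r θ Z hZ hkr hli
    ext1 v
    have h1 : (X 0 * X 1 * X 2 : Poly (m + 4)) * θ v = 0 := by
      refine MvPolynomial.funext fun x => ?_
      rw [map_mul, map_zero, ← formAt_apply]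
      by_cases hx : x 0 * x 1 * x 2 = 0
      · simp [hx]
      · rw [eq_zero_of_killed (ω := formAt x θ) (hli x hx)
          (fun v i t h => formAt_vecCons_eq_zero (hZ t) x h)
          (by rwa [Module.finrank_fin_fun])]
        simp
    refine (mul_eq_zero.1 h1).resolve_left ?_
    exact mul_ne_zero (mul_ne_zero (X_ne_zero _) (X_ne_zero _)) (X_ne_zero _)
  have hli : ∀ x : Fin (m + 4) → ℂ, x 0 * x 1 * x 2 ≠ 0 → LinearIndependent ℂ
      ![(Matrix.diagonal y).mulVec x, (weightMatrix p).mulVec x, x] := fun x hx =>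
    linearIndependent_diag hp hy (i := 0) (j := 1) (k := 2) zero_ne_one zero_ne_two_fin
      one_ne_two_fin hx
  have h1 : wedgeOne η ω = 0 := by
    refine key _ ![linField (Matrix.diagonal y), linField (weightMatrix p), radial _]
      (fun i => ?_) (by omega) fun x hx => ?_
    · fin_cases i
      · simp [contract_wedgeOne (hη0 _ hY), hY, wedgeOne_zero]
      · simp [contract_wedgeOne (hη0 _ hS), hS, wedgeOne_zero]
      · simp [contract_wedgeOne (hη0 _ hR), hR, wedgeOne_zero]
    · convert hli x hx using 1
      ext i : 1
      fin_cases i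
      · exact fieldAt_linField _ _
      · exact fieldAt_linField _ _
      · exact fieldAt_radial _
  refine ⟨h1, ?_⟩
  have hRd : contract (radial _) (extD ω) = _ :=
    contract_radial_extD (tripleForm_homogeneous _ _) hR
  have hSd := (isAdapted_diagForm (p := p) (y := y)).contract_extD
  rw [affPull_one, ← linField_weightMatrix, ← hω] at hSd
  refine key _ ![linField (weightMatrix p), radial _] (fun i => ?_) (by omega) fun x hx => ?_
  · fin_cases i
    · simp [contract_wedgeOne (hη0 _ hS), hSd, wedgeOne_smul, h1]
    · simp [contract_wedgeOne (hη0 _ hR), hRd, wedgeOne_smul, h1]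
  · have := (hli x hx).comp (Fin.succ : Fin 2 → Fin 3) (Fin.succ_injective _)
    convert this using 1
    ext i : 1
    fin_cases i
    · exact fieldAt_linField _ _
    · exact fieldAt_radial _

theorem exists_inGeneralPosition (hp : IsWeightTuple p) (l : Fin (m + 3) → ℤ) :
    ∃ y : Fin (m + 4) → ℂ, InGeneralPosition p y ∧ ∀ (σ : Equiv.Perm (Fin (m + 4))) (a b c : ℂ),
      ¬ ∀ i, y i = a + b * extWeights p i + c * extWeights l (σ i) := by
  let π : Fin (m + 4) → (Fin (m + 4) → ℂ) →ₗ[ℂ] ℂ := LinearMap.proj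
  let minor : Fin (m + 4) → Fin (m + 4) → Fin (m + 4) → (Fin (m + 4) → ℂ) →ₗ[ℂ] ℂ := fun i j k =>
    ((extWeights p j : ℂ) - extWeights p i) • (π k - π i) -
      ((extWeights p k : ℂ) - extWeights p i) • (π j - π i)
  let ι := {t : Fin (m + 4) × Fin (m + 4) × Fin (m + 4) // t.1 ≠ t.2.1 ∧ t.1 ≠ t.2.2 ∧ t.2.1 ≠ t.2.2}
  let S : Equiv.Perm (Fin (m + 4)) ⊕ ι → Submodule ℂ (Fin (m + 4) → ℂ) := Sum.elim
    (fun σ => Submodule.span ℂ (Set.range ![1, fun i => (extWeights p i : ℂ),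
      fun i => (extWeights l (σ i) : ℂ)]))
    fun t => LinearMap.ker (minor t.1.1 t.1.2.1 t.1.2.2)
  obtain ⟨y, hy⟩ : ∃ y, ∀ s, y ∉ S s := by
    by_contra! hcon
    obtain ⟨s, hs⟩ := Subspace.exists_eq_top_of_iUnion_eq_univ (p := S)
      (Set.eq_univ_of_forall fun y => Set.mem_iUnion.2 (hcon y))
    rcases s with σ | ⟨⟨i, j, k⟩, hij, hik, hjk⟩
    · have h1 := finrank_range_le_card (R := ℂ) (b := ![1, fun i => (extWeights p i : ℂ),
        fun i => (extWeights l (σ i) : ℂ)])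
      rw [Set.finrank, show Submodule.span ℂ _ = ⊤ from hs, finrank_top, Module.finrank_fin_fun,
        Fintype.card_fin] at h1
      omega
    · have h1 : (fun t => (extWeights p t : ℂ) ^ 2) ∈ LinearMap.ker (minor i j k) := by
        rw [show LinearMap.ker (minor i j k) = ⊤ from hs]; trivial
      have h2 : ((extWeights p j : ℂ) - extWeights p i) * ((extWeights p k : ℂ) - extWeights p i) *
          ((extWeights p k : ℂ) - extWeights p j) = 0 := by
        have h3 := LinearMap.mem_ker.1 h1
        simp only [minor, π, LinearMap.sub_apply, LinearMap.smul_apply, LinearMap.proj_apply,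
          smul_eq_mul] at h3
        linear_combination h3
      have h4 : ∀ i j, i ≠ j → (extWeights p j : ℂ) - extWeights p i ≠ 0 := fun i j hij =>
        sub_ne_zero.2 fun h => hij (hp.cast_injective h).symm
      exact mul_ne_zero (mul_ne_zero (h4 i j hij) (h4 i k hik)) (h4 j k hjk) h2
  refine ⟨y, fun i j k hij hik hjk => hy (Sum.inr ⟨(i, j, k), hij, hik, hjk⟩), fun σ a b c h => ?_⟩
  refine hy (Sum.inl σ) ?_
  have : y = a • (1 : Fin (m + 4) → ℂ) + b • (fun i => (extWeights p i : ℂ)) +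
      c • fun i => (extWeights l (σ i) : ℂ) := by
    ext i
    simp [h i]
  rw [this]
  exact add_mem (add_mem (Submodule.smul_mem _ _ (Submodule.subset_span ⟨0, rfl⟩))
    (Submodule.smul_mem _ _ (Submodule.subset_span ⟨1, rfl⟩)))
    (Submodule.smul_mem _ _ (Submodule.subset_span ⟨2, rfl⟩))

theorem InGeneralPosition.smul {a : ℂ} (ha : a ≠ 0) (hy : InGeneralPosition p y) :
    InGeneralPosition p (a • y) := by
  intro i j k hij hik hjk h
  refine mul_ne_zero ha (hy i j k hij hik hjk) ?_
  simp only [Pi.smul_apply, smul_eq_mul] at h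
  linear_combination h

/-- There are foliations of weight zero whose tangent algebra contains a prescribed diagonal field
in general position. -/
theorem exists_mem_AffFoliations_diag (hp : IsWeightTuple p) (hy : InGeneralPosition p y) :
    ∃ F ∈ AffFoliations m p 0 (1 + 1),
      weightMatrix p ∈ tangentFields (F.rep : Form (m + 4) (m + 1)) ∧
      Matrix.diagonal y ∈ tangentFields (F.rep : Form (m + 4) (m + 1)) := by
  let ω : projForms m (1 + 1 + 1) := ⟨diagForm p y, tripleForm_homogeneous _ _,
    contract_tripleForm_radial _ _⟩
  have hω : ω ≠ 0 := fun h => diagForm_ne_zero hp hy (congrArg Subtype.val h)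
  obtain ⟨a, ha⟩ := Projectivization.exists_smul_eq_mk_rep ℂ ω hω
  have hrep : ((Projectivization.mk ℂ ω hω).rep : Form (m + 4) (m + 1)) =
      diagForm p ((a : ℂ) • y) := by
    rw [← ha, diagForm, show Matrix.diagonal ((a : ℂ) • y) = (a : ℂ) • Matrix.diagonal y from
      (Matrix.diagonal_smul _ _), tripleForm_smul]
    rfl
  have hay := hy.smul a.ne_zero
  refine ⟨Projectivization.mk ℂ ω hω, (mem_AffFoliations_iff hp.pos).2 ⟨⟨?_, ?_⟩, 1, ?_⟩, ?_, ?_⟩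
  · rw [hrep]; exact integrable_diagForm hp hay
  · rw [hrep]; exact singCodimGeTwo_diagForm hp hay
  · rw [hrep, Units.val_one]; exact isAdapted_diagForm
  · rw [hrep, mem_tangentFields]
    exact contract_tripleForm_left _ _
  · rw [← ha]
    change _ ∈ tangentFields ((a : ℂ) • diagForm p y)
    rw [tangentFields_smul a.ne_zero, mem_tangentFields]
    exact contract_tripleForm_right _ _

end Diagonal

section Comparison

variable {m d : ℕ} {p l : Fin (m + 3) → ℤ} {lam mu : ℤ}

/-- The case of three-dimensional tangent algebras, one of the weights being zero. -/
theorem weights_of_weight_zero (hp : IsWeightTuple p) (hl : IsWeightTuple l)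
    (hp3 : ∀ F ∈ AffFoliations m p 0 (1 + 1),
      Module.finrank ℂ (tangentFields (F.rep : Form (m + 4) (m + 1))) = 3)
    (hl3 : ∀ F ∈ AffFoliations m l mu (1 + 1),
      Module.finrank ℂ (tangentFields (F.rep : Form (m + 4) (m + 1))) = 3)
    (hcl : AffFoliations m p 0 (1 + 1) ⊆ zariskiClosure (AffFoliations m l mu (1 + 1))) :
    (l = p ∧ mu = 0) ∨ (l = conjTuple p ∧ mu = conjWeight p 0 1) := by
  obtain ⟨y, hy, hgen⟩ := exists_inGeneralPosition hp l
  obtain ⟨F, hF, hP, hQ⟩ := exists_mem_AffFoliations_diag hp hy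
  obtain ⟨A, B, h⟩ := exists_isAffForm hp hF
  have h1 : (1 : Matrix (Fin (m + 4)) (Fin (m + 4)) ℂ) ∈
    tangentFields (F.rep : Form (m + 4) (m + 1)) := h.form.one_mem
  set P := weightMatrix p with hPdef
  set Q : Matrix (Fin (m + 4)) (Fin (m + 4)) ℂ := Matrix.diagonal y with hQdef
  have hli : LinearIndependent ℂ ![Q, 1, P] := by
    have h1P : LinearIndependent ℂ ![(1 : Matrix (Fin (m + 4)) (Fin (m + 4)) ℂ), P] := by
      have := linearIndependent_one_conj (A := 1) (B := 1) hp (mul_one _)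
      rwa [one_mul, mul_one] at this
    refine linearIndependent_finCons.2 ⟨h1P, fun hmem => ?_⟩
    rw [Matrix.range_cons, Matrix.range_cons, Matrix.range_empty, Set.union_empty,
      Set.singleton_union, Submodule.mem_span_pair] at hmem
    obtain ⟨a, b, hab⟩ := hmem
    refine hgen 1 a b 0 fun i => ?_
    have := congrFun (congrFun hab i) i
    simp only [hQdef, hPdef, weightMatrix, Matrix.add_apply, Matrix.smul_apply, Matrix.one_apply_eq,
      Matrix.diagonal_apply_eq, smul_eq_mul] at this
    rw [← this]
    ring
  have hspan : Submodule.span ℂ (Set.range ![Q, 1, P]) =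
      tangentFields (F.rep : Form (m + 4) (m + 1)) := by
    refine Submodule.eq_of_le_of_finrank_le ?_ ?_
    · rw [Submodule.span_le]
      rintro _ ⟨i, rfl⟩
      fin_cases i
      exacts [hQ, h1, hP]
    · rw [hp3 F hF, finrank_span_eq_card hli, Fintype.card_fin]
  have hcomb : ∀ Z ∈ tangentFields (F.rep : Form (m + 4) (m + 1)), ∃ a b c : ℂ,
      Z = a • (1 : Matrix (Fin (m + 4)) (Fin (m + 4)) ℂ) + b • P + c • Q := by
    intro Z hZ
    rw [← hspan, Matrix.range_cons, Matrix.range_cons, Matrix.range_cons, Matrix.range_empty,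
      Set.union_empty, Set.singleton_union, Set.singleton_union, Submodule.mem_span_triple] at hZ
    obtain ⟨c, a, b, rfl⟩ := hZ
    exact ⟨a, b, c, by rw [add_assoc]; exact add_comm _ _⟩
  have hdiag : ∀ s t : ℂ, ¬ ∀ i, specCoeff i (s • P + Q) =
      t ^ i * specCoeff i (weightMatrix l) := by
    intro s t hst
    have hsum : s • P + Q = Matrix.diagonal fun i => s * extWeights p i + y i := by
      rw [hPdef, hQdef, weightMatrix, ← Matrix.diagonal_smul, Matrix.diagonal_add]
      rfl
    rw [hsum] at hst
    obtain ⟨σ, hσ⟩ := exists_perm_of_specCoeff hst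
    have hN : ((Fintype.card (Fin (m + 4)) : ℕ) : ℂ) ≠ 0 := by
      rw [Fintype.card_fin]; exact_mod_cast (by omega : m + 4 ≠ 0)
    refine hgen σ ((∑ j, (s * (extWeights p j : ℂ) + y j) - t * ∑ j, (extWeights l j : ℂ)) /
      (Fintype.card (Fin (m + 4)) : ℕ)) (-s) t fun i => ?_
    have := hσ i
    field_simp
    linear_combination this
  exact weights_of_generic hp hl hP (fun _ => rfl) hQ (hp3 F hF) hcomb hdiag
    (fun F hF => (hl3 F hF).ge) (hcl hF)

theorem finrank_tangentFields_cases (hd : 1 ≤ d) (hp : IsWeightTuple p)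
    {F : ℙ ℂ (projForms m (d + 1 + 1))} (hF : F ∈ AffFoliations m p lam (d + 1))
    (h2 : Module.finrank ℂ (tangentFields (F.rep : Form (m + 4) (m + 1))) ≠ 2) :
    Module.finrank ℂ (tangentFields (F.rep : Form (m + 4) (m + 1))) = 3 ∧ d = 1 := by
  obtain ⟨A, B, h⟩ := exists_isAffForm hp hF
  rcases h.adapted.tangentFields_cases hd h.form hp h.mul_eq_one h.mul_eq_one' with h' | h'
  · exact absurd h'.1 h2
  · exact ⟨h'.1, h'.2.1⟩

theorem weights_symm (h : (p = l ∧ lam = mu) ∨ (p = conjTuple l ∧ lam = conjWeight l mu d)) :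
    (l = p ∧ mu = lam) ∨ (l = conjTuple p ∧ mu = conjWeight p lam d) := by
  rcases h with ⟨rfl, rfl⟩ | ⟨rfl, rfl⟩
  · exact Or.inl ⟨rfl, rfl⟩
  · exact Or.inr ⟨(conjTuple_conjTuple l).symm, (conjWeight_conjWeight l mu d).symm⟩

/-- Two sets `ℱ(𝔓, λ)` and `ℱ(𝔏, μ)`, each contained in the closure of the other, have the same
weights up to conjugation. -/
theorem weights_of_subset_zariskiClosure (hd : 1 ≤ d) (hp : IsWeightTuple p) (hl : IsWeightTuple l)
    (hne : (AffFoliations m p lam (d + 1)).Nonempty)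
    (hpl : AffFoliations m p lam (d + 1) ⊆ zariskiClosure (AffFoliations m l mu (d + 1)))
    (hlp : AffFoliations m l mu (d + 1) ⊆ zariskiClosure (AffFoliations m p lam (d + 1))) :
    (l = p ∧ mu = lam) ∨ (l = conjTuple p ∧ mu = conjWeight p lam d) := by
  by_cases hp2 : ∃ F ∈ AffFoliations m p lam (d + 1),
      Module.finrank ℂ (tangentFields (F.rep : Form (m + 4) (m + 1))) = 2
  · obtain ⟨F, hF, h2⟩ := hp2
    exact weights_of_finrank_eq_two hd hp hl hF h2 (hpl hF)
  by_cases hl2 : ∃ F ∈ AffFoliations m l mu (d + 1),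
      Module.finrank ℂ (tangentFields (F.rep : Form (m + 4) (m + 1))) = 2
  · obtain ⟨F, hF, h2⟩ := hl2
    exact weights_symm (weights_of_finrank_eq_two hd hl hp hF h2 (hlp hF))
  push Not at hp2 hl2
  obtain ⟨F, hF⟩ := hne
  obtain ⟨h3, rfl⟩ := finrank_tangentFields_cases hd hp hF (hp2 F hF)
  have hp3 := fun F hF => (finrank_tangentFields_cases hd hp hF (hp2 F hF)).1
  have hl3 := fun F hF => (finrank_tangentFields_cases hd hl hF (hl2 F hF)).1
  by_cases hlam : lam = 0
  · subst hlam
    exact weights_of_weight_zero hp hl hp3 hl3 hpl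
  by_cases hmu : mu = 0
  · subst hmu
    exact weights_symm (weights_of_weight_zero hl hp hl3 hp3 hlp)
  exact weights_of_ne_zero hp hl hlam hmu hF h3 (fun F hF => (hl3 F hF).ge) (hpl hF)

theorem subset_zariskiClosure {V : Type*} [AddCommGroup V] [Module ℂ V] (Z : Set (ℙ ℂ V)) :
    Z ⊆ zariskiClosure Z := fun _ hx _ _ _ h => h _ hx

theorem AffFoliations_subset_of_closure_eq
    (h : AffFoliationsClosure m p lam (d + 1) = AffFoliationsClosure m l mu (d + 1)) :
    AffFoliations m p lam (d + 1) ⊆ zariskiClosure (AffFoliations m l mu (d + 1)) := fun F hF => by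
  have : F ∈ AffFoliationsClosure m p lam (d + 1) := ⟨subset_zariskiClosure _ hF, hF.1⟩
  rw [h] at this
  exact this.1

end Comparison

end AffFoliation

theorem proposition2p9 (m d : ℕ) (hd : 1 ≤ d) (p l : Fin (m + 3) → ℤ)
    (hp : AffFoliation.IsWeightTuple p) (hl : AffFoliation.IsWeightTuple l) (lam mu : ℤ)
    (hne : (AffFoliation.AffFoliations m p lam (d + 1)).Nonempty ∨
      (AffFoliation.AffFoliations m l mu (d + 1)).Nonempty) :
    AffFoliation.AffFoliationsClosure m p lam (d + 1) =
        AffFoliation.AffFoliationsClosure m l mu (d + 1) ↔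
      (l = p ∧ mu = lam) ∨
        (l = AffFoliation.conjTuple p ∧ mu = AffFoliation.conjWeight p lam d) := by
  constructor
  · intro h
    have hpl := AffFoliation.AffFoliations_subset_of_closure_eq h
    have hlp := AffFoliation.AffFoliations_subset_of_closure_eq h.symm
    rcases hne with hne | hne
    · exact AffFoliation.weights_of_subset_zariskiClosure hd hp hl hne hpl hlp
    · exact AffFoliation.weights_symm
        (AffFoliation.weights_of_subset_zariskiClosure hd hl hp hne hlp hpl)
  · rintro (⟨rfl, rfl⟩ | ⟨rfl, rfl⟩)
    · rfl
    · rw [AffFoliation.AffFoliationsClosure, AffFoliation.AffFoliationsClosure,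
        AffFoliation.AffFoliations_conj hp]
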